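/- Let $d\ge 2$ be an integer and let $\sigma$ be the surface measure of the unit sphere $S^{d-1}\subset\mathbb R^d$, normalized to total mass $1$. For $t>0$ and $f:\mathbb R^d\to\mathbb C$ put $$A_tf(x)=\int_{S^{d-1}} f(x-ty)\,d\sigma(y),\qquad M_Ef(x)=\sup_{t\in E}|A_tf(x)|\qquad (E\subset[1,2]).$$ For a bounded set $E\subset\mathbb R$ and $\delta>0$ let $N(E,\delta)$ be the minimal number of compact intervals of length $\delta$ needed to cover $E$. The upper Minkowski dimension $\dim_M E$ is the smallest $\beta\ge 0$ such that for every $\varepsilon>0$ there is $C_\varepsilon$ with $N(E,\delta)\le C_\varepsilon\,\delta^{-\beta-\varepsilon}$ for all $0<\delta<1$. The upper Assouad dimension $\dim_A E$ is the smallest $\gamma\ge 0$ for which there are $\delta_0>0$ and constants $C_\varepsilon$, $\varepsilon>0$, such that $N(E\cap I,\delta)\le C_\varepsilon\,(\delta/|I|)^{-\gamma-\varepsilon}$ for every $\varepsilon>0$, every $\delta\in(0,\delta_0)$ and every compact interval $I$ of length $|I|\in(\delta,\delta_0)$. For $0\le\beta\le\gamma\le1$ let $$Q_1=(0,0),\quad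 Q_2(\beta)=\Big(\tfrac{d-1}{d-1+\beta},\tfrac{d-1}{d-1+\beta}\Big),\quad Q_3(\beta)=\Big(\tfrac{d-\beta}{d-\beta+1},\tfrac{1}{d-\beta+1}\Big),\quad Q_4(\gamma)=\Big(\tfrac{d(d-1)}{d^2+2\gamma-1},\tfrac{d-1}{d^2+2\gamma-1}\Big),$$ let $\mathcal Q(\beta,\gamma)$ be the closed convex hull of these four points, let $\mathrm{Seg}(\beta)$ be the line segment from $Q_1$ to $Q_2(\beta)$ with $Q_1$ included and $Q_2(\beta)$ excluded, and let $\mathcal R(\beta,\gamma)=\mathrm{Seg}(\beta)\cup\operatorname{int}\mathcal Q(\beta,\gamma)$. **Theorem.** Let $d\ge 3$ and $0\le\beta\le\gamma\le 1$, or $d=2$ and $0\le\beta\le\gamma\le 1/2$. Let $E\subset[1,2]$ satisfy $\dim_M E=\beta$ and $\dim_A E=\gamma$, and let $p,q\in[1,\infty]$ be such that $(1/p,1/q)\in\mathcal R(\beta,\gamma)$ (with $1/\infty=0$). Then there is a constant $C<\infty$ such that for every $f\in L^p(\mathbb R^d)$: for almost every $x$ the function $y\mapsto f(x-ty)$ is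 $\sigma$-integrable for all $t\in E$, the function $M_Ef$ is (Lebesgue) measurable, and $$\|M_Ef\|_{L^q(\mathbb R^d)}\le C\,\|f\|_{L^p(\mathbb R^d)}.$$ -/

import Mathlib

open MeasureTheory
open scoped ENNReal NNReal

namespace SphericalMaximal

/-- The space `ℝ^d` with its Euclidean norm. -/
abbrev Space (d : ℕ) : Type := EuclideanSpace ℝ (Fin d)

/-- The normalized surface measure `σ` on the unit sphere of `ℝ^d`. -/
noncomputable def sigma (d : ℕ) : Measure (Metric.sphere (0 : Space d) 1) :=
  ((volume : Measure (Space d)).toSphere Set.univ)⁻¹ • (volume : Measure (Space d)).toSphere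

/-- The spherical mean `A_t f(x) = ∫ f(x - t y) dσ(y)`. -/
noncomputable def sphericalMean {d : ℕ} (t : ℝ) (f : Space d → ℂ) (x : Space d) : ℂ :=
  ∫ y, f (x - t • (y : Space d)) ∂(sigma d)

/-- The maximal function `M_E f(x) = sup_{t ∈ E} |A_t f(x)|`, with values in `[0, ∞]`. -/
noncomputable def maximalFunction {d : ℕ} (E : Set ℝ) (f : Space d → ℂ) (x : Space d) : ℝ≥0∞ :=
  ⨆ t ∈ E, ‖sphericalMean t f x‖ₑ

/-- `N(E, δ)`: the minimal number of compact intervals of length `δ` needed to cover `E`.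
These intervals are exactly the closed balls of radius `δ / 2` in `ℝ`. -/
noncomputable def intervalCoveringNumber (E : Set ℝ) (δ : ℝ) : ℕ∞ :=
  Metric.externalCoveringNumber (δ / 2).toNNReal E

/-- For every `ε > 0` there is `C` with `N(E, δ) ≤ C δ^(-β-ε)` for all `0 < δ < 1`. -/
def MinkowskiBound (E : Set ℝ) (β : ℝ) : Prop :=
  ∀ ε > 0, ∃ C : ℝ, ∀ δ : ℝ, 0 < δ → δ < 1 →
    (intervalCoveringNumber E δ : ℝ≥0∞) ≤ ENNReal.ofReal (C * δ ^ (-β - ε))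

/-- The upper Minkowski dimension of a bounded set `E ⊆ ℝ`. -/
noncomputable def minkowskiDim (E : Set ℝ) : ℝ :=
  sInf {β : ℝ | 0 ≤ β ∧ MinkowskiBound E β}

/-- There are `δ₀ > 0` and constants `C_ε` for all `ε > 0` such that
`N(E ∩ I, δ) ≤ C_ε (δ / |I|)^(-γ-ε)` for all `δ ∈ (0, δ₀)` and all intervals `I = [a, a + ℓ]`
of length `|I| = ℓ ∈ (δ, δ₀)`. -/
def AssouadBound (E : Set ℝ) (γ : ℝ) : Prop :=
  ∃ δ₀ > 0, ∀ ε > 0, ∃ C : ℝ, ∀ δ : ℝ, 0 < δ → δ < δ₀ →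
    ∀ a ℓ : ℝ, δ < ℓ → ℓ < δ₀ →
      (intervalCoveringNumber (E ∩ Set.Icc a (a + ℓ)) δ : ℝ≥0∞) ≤
        ENNReal.ofReal (C * (δ / ℓ) ^ (-γ - ε))

/-- The upper Assouad dimension of a bounded set `E ⊆ ℝ`. -/
noncomputable def assouadDim (E : Set ℝ) : ℝ :=
  sInf {γ : ℝ | 0 ≤ γ ∧ AssouadBound E γ}

/-- The vertex `Q₁`. -/
def Q₁ : ℝ × ℝ := (0, 0)

/-- The vertex `Q₂(β)`. -/
noncomputable def Q₂ (d : ℕ) (β : ℝ) : ℝ × ℝ :=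
  (((d : ℝ) - 1) / (d - 1 + β), ((d : ℝ) - 1) / (d - 1 + β))

/-- The vertex `Q₃(β)`. -/
noncomputable def Q₃ (d : ℕ) (β : ℝ) : ℝ × ℝ :=
  (((d : ℝ) - β) / (d - β + 1), 1 / ((d : ℝ) - β + 1))

/-- The vertex `Q₄(γ)`. -/
noncomputable def Q₄ (d : ℕ) (γ : ℝ) : ℝ × ℝ :=
  ((d : ℝ) * (d - 1) / (d ^ 2 + 2 * γ - 1), ((d : ℝ) - 1) / (d ^ 2 + 2 * γ - 1))

/-- The closed quadrangle `𝒬(β, γ)`; the convex hull of finitely many points is closed. -/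
noncomputable def quadrangle (d : ℕ) (β γ : ℝ) : Set (ℝ × ℝ) :=
  convexHull ℝ {Q₁, Q₂ d β, Q₃ d β, Q₄ d γ}

/-- The segment from `Q₁` to `Q₂(β)`, with `Q₁` included and `Q₂(β)` excluded. -/
noncomputable def Seg (d : ℕ) (β : ℝ) : Set (ℝ × ℝ) :=
  segment ℝ Q₁ (Q₂ d β) \ {Q₂ d β}

/-- The region `ℛ(β, γ)`. -/
noncomputable def region (d : ℕ) (β γ : ℝ) : Set (ℝ × ℝ) :=
  Seg d β ∪ interior (quadrangle d β γ)

end SphericalMaximal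

/-! The averages are decomposed in frequency with bumps that are compactly supported in space. The
`j`-th piece of `A_t` is convolution with `shellK (meanProfile ψ) (2^{-j}) t`, which lives in a
shell of width comparable to `2^{-j}` around the sphere of radius `t`. By `exists_isShellKernel`
these kernels have bounded L¹ norm, height `O(2^j)` and Fourier transform `O(2^{-j(d-1)/2})`. The
last bound rests on the decay of the Fourier transform of `σ`, obtained from a Bessel equation and a
monotone energy (`exists_energy_bound`). The radial derivative of a piece is `2^j` times a kernel of
the same type, so the supremum over `E` reduces to one over a `2^{-j}`-separated net `T`.

Splitting space according to the maximising `t ∈ T` linearises the supremum. What has to be bounded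
is `∑ ∫_{G_t} |k_t * f|` for `|f| ≤ 1_F`, by `2^{je} |F|^a (∑ |G_t|)^{1-b}` (`RestrictedBound`). Up
to `ε` in the exponent `e`, five such estimates at points `(a, b)` suffice. Trivial bounds give `e =
0` at `(0,0)` and `e = 1` at `(1,0)`. Counting the net with the Minkowski dimension gives `e = β` at
`(1,1)` and, with Plancherel, `e = (β-(d-1))/2` at `(1/2,1/2)`. The Assouad dimension enters at
`(1/2, b)`, `b = ttExponent d γ`, with `e = 1/2 - d b`: a `TT*` argument groups pairs of radii by
dyadic distance and, for each distance, balances the number of such pairs against the decay of the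
composed kernel (`exists_integral_sq_sum_conv_le`).

Interpolating these estimates is taking geometric means. The exponent `e` vanishes at all four
vertices of the quadrangle (`VertexBounds.quadrangle_subset`). It is negative in the interior and on
the segment apart from its origin (`VertexBounds.exists_neg`), because the estimate at `(1/2,1/2)`
has a negative exponent. Negativity leaves room to perturb `(a, b)`. This slack allows summation
over `j`, over the dyadic levels of `f` and over the level sets of the maximal function, so strong
bounds follow on balls (`localBound_of_restrictedBound`). Since radii are at most `2` and `p ≤ q`,
the local bounds add up to global ones.

All this concerns continuous functions of compact support. The extension to `L^p` uses a rapidly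
convergent approximation, together with the fact that for almost every `x` no sphere about `x` with
radius in `E` charges a given null set (`StrongBound.ae_null`). The origin of the region, `p = q =
∞`, follows from the L² bound and the same fact. -/

namespace SphericalMaximal

open scoped Pointwise
open Metric Set Filter Topology FourierTransform Real

/-! ### Invariance, cap estimates and differentiation for the measure on the sphere. -/

section Sphere

variable {d : ℕ}

/-- The unit sphere of `ℝ^d`. -/
abbrev Sph (d : ℕ) : Type := sphere (0 : Space d) 1

/-- The action of a linear isometry on the unit sphere. -/
noncomputable def sphereMap (L : Space d ≃ₗᵢ[ℝ] Space d) (y : Sph d) : Sph d :=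
  ⟨L y, by simp⟩

lemma continuous_sphereMap (L : Space d ≃ₗᵢ[ℝ] Space d) : Continuous (sphereMap L) :=
  (L.continuous.comp continuous_subtype_val).subtype_mk _

lemma nontrivial_space (hd : 2 ≤ d) : Nontrivial (Space d) := by
  have : Nonempty (Fin d) := ⟨⟨0, by omega⟩⟩
  infer_instance

instance isProbabilityMeasure_sigma [h : Fact (2 ≤ d)] : IsProbabilityMeasure (sigma d) := by
  have := nontrivial_space h.out
  constructor
  rw [sigma, Measure.smul_apply, smul_eq_mul]
  refine ENNReal.inv_mul_cancel ?_ (measure_ne_top _ _)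
  rw [Ne, Measure.measure_univ_eq_zero]
  exact Measure.toSphere_ne_zero _

lemma measurePreserving_sphereMap (L : Space d ≃ₗᵢ[ℝ] Space d) :
    MeasurePreserving (sphereMap L) (sigma d) (sigma d) := by
  refine ⟨(continuous_sphereMap L).measurable, ?_⟩
  rw [sigma, Measure.map_smul]
  congr 1
  ext s hs
  rw [Measure.map_apply (continuous_sphereMap L).measurable hs, Measure.toSphere_apply' _ hs,
    Measure.toSphere_apply' _ ((continuous_sphereMap L).measurable hs)]
  congr 1
  rw [← L.measurePreserving.measure_preimage_emb L.toHomeomorph.measurableEmbedding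
    (Ioo (0 : ℝ) 1 • (Subtype.val '' s))]
  congr 1
  ext x
  simp only [Set.mem_smul, Set.mem_image, Set.mem_preimage, Subtype.exists]
  constructor
  · rintro ⟨a, ha, _, ⟨y, hy, hys, rfl⟩, rfl⟩
    exact ⟨a, ha, L y, ⟨L y, (sphereMap L ⟨y, hy⟩).2, hys, rfl⟩, (L.map_smul a y).symm⟩
  · rintro ⟨a, ha, _, ⟨y, hy, hys, rfl⟩, h⟩
    refine ⟨a, ha, L.symm y, ⟨L.symm y, by simpa using hy, ?_, rfl⟩, ?_⟩
    · simpa [sphereMap] using hys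
    · apply L.injective
      simpa using h

lemma integral_sphere_comp {G : Type*} [NormedAddCommGroup G] [NormedSpace ℝ G]
    (L : Space d ≃ₗᵢ[ℝ] Space d) (F : Sph d → G) (hF : Continuous F) :
    ∫ y, F (sphereMap L y) ∂sigma d = ∫ y, F y ∂sigma d := by
  have h := (measurePreserving_sphereMap L)
  conv_rhs => rw [← h.map_eq]
  rw [integral_map h.measurable.aemeasurable]
  exact hF.aestronglyMeasurable

lemma exists_isometry_map_eq {v w : Space d} (h : ‖v‖ = ‖w‖) :
    ∃ L : Space d ≃ₗᵢ[ℝ] Space d, L v = w :=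
  ⟨_, Submodule.reflection_sub h⟩

/-- The normalized measure of a spherical cap of radius `r` is at most a multiple of `r^(d-1)`. -/
lemma exists_sigma_ball_le [h : Fact (2 ≤ d)] : ∃ C : ℝ, 0 ≤ C ∧ ∀ (z : Space d) (r : ℝ), 0 < r →
    (sigma d).real {y | ‖z - (y : Space d)‖ ≤ r} ≤ C * r ^ (d - 1) := by
  have := nontrivial_space h.out
  set V := (volume : Measure (Space d)) (ball 0 1)
  have hV : V ≠ ∞ := measure_ball_lt_top.ne
  set τ := (volume : Measure (Space d)).toSphere Set.univ
  have hτ0 : τ ≠ 0 := by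
    rw [Ne, Measure.measure_univ_eq_zero]; exact Measure.toSphere_ne_zero _
  refine ⟨(τ⁻¹ * (d * (ENNReal.ofReal (4 ^ d) * V))).toReal, ENNReal.toReal_nonneg, ?_⟩
  intro z r hr
  set s : Set (Sph d) := {y | ‖z - (y : Space d)‖ ≤ r}
  have hs : MeasurableSet s := by
    apply IsClosed.measurableSet
    exact isClosed_le (by fun_prop) continuous_const
  rcases s.eq_empty_or_nonempty with he | ⟨y₀, hy₀⟩
  · rw [he]; simp; positivity
  set cone : Set (Space d) := Ioo (0 : ℝ) 1 • (Subtype.val '' s)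
  have hcone1 : MeasurableSet cone := by
    have := (Homeomorph.measurableEmbedding (homeomorphUnitSphereProd (Space d)).symm)
    have h2 := ((MeasurableEmbedding.subtype_coe (measurableSet_singleton (0 : Space d)).compl).comp
      this).measurableSet_image.2 (hs.prod (measurableSet_Iio (a := (⟨1, mem_Ioi.2 one_pos⟩ : Ioi (0 : ℝ)))))
    convert h2 using 1
    ext x
    simp only [cone, Set.mem_smul, Set.mem_image]
    constructor
    · rintro ⟨a, ha, _, ⟨y, hy, rfl⟩, rfl⟩
      exact ⟨(y, ⟨a, ha.1⟩), ⟨hy, ha.2⟩, rfl⟩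
    · rintro ⟨⟨y, a⟩, ⟨hy, ha⟩, rfl⟩
      exact ⟨a, ⟨a.2, ha⟩, y, ⟨y, hy, rfl⟩, rfl⟩
  have hcone2 : (volume : Measure (Space d)) cone ≠ ∞ := by
    refine ((measure_mono (t := ball (0 : Space d) 1) ?_).trans_lt measure_ball_lt_top).ne
    rintro _ ⟨a, ha, _, ⟨y, hy, rfl⟩, rfl⟩
    simp [norm_smul, abs_of_pos ha.1, ha.2]
  -- Stretching the cone over the cap by `1 + r` adds only points within `4r` of `y₀`, while the
  -- volume grows by a factor of at least `1 + r`. Comparing the two bounds the volume of the cone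
  -- by a multiple of `r^(d-1)`.
  have hsub : ((1 + r) • cone) \ cone ⊆ ball (y₀ : Space d) (4 * r) := by
    rintro _ ⟨⟨_, ⟨a, ha, _, ⟨y, hy, rfl⟩, rfl⟩, rfl⟩, hn⟩
    simp only at hn ⊢
    have h1 : 1 ≤ (1 + r) * a := by
      by_contra! hlt
      refine hn ⟨(1 + r) * a, ⟨by have := ha.1; positivity, hlt⟩, y, ⟨y, hy, rfl⟩, ?_⟩
      simp [smul_smul]
    have h2 : (1 + r) * a < 1 + r := by nlinarith [ha.2]
    rw [mem_ball, dist_eq_norm]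
    have h3 : ‖(y : Space d) - y₀‖ ≤ 2 * r := by
      have e : (y : Space d) - y₀ = (z - y₀) - (z - y) := by abel
      rw [e]
      have := norm_sub_le (z - (y₀ : Space d)) (z - y)
      have i1 : ‖z - (y₀ : Space d)‖ ≤ r := hy₀
      have i2 : ‖z - (y : Space d)‖ ≤ r := hy
      linarith
    have h4 : ((1 + r) • a • (y : Space d)) - y₀ = (((1 + r) * a) - 1) • (y : Space d) + (y - y₀) := by
      rw [sub_smul, one_smul, mul_smul]; abel
    rw [h4]
    refine (norm_add_le _ _).trans_lt ?_
    rw [norm_smul, norm_eq_of_mem_sphere, mul_one, Real.norm_eq_abs, abs_of_nonneg (by linarith)]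
    linarith
  have hvol : (ENNReal.ofReal ((1 + r) ^ d) - 1) * volume cone ≤ ENNReal.ofReal ((4 * r) ^ d) * V := by
    calc (ENNReal.ofReal ((1 + r) ^ d) - 1) * volume cone
        = volume ((1 + r) • cone) - volume cone := by
          rw [Measure.addHaar_smul_of_nonneg _ (by positivity), finrank_euclideanSpace_fin,
            ENNReal.sub_mul (fun _ _ => hcone2), one_mul]
      _ ≤ volume (((1 + r) • cone) \ cone) := le_measure_sdiff
      _ ≤ volume (ball (y₀ : Space d) (4 * r)) := measure_mono hsub
      _ = _ := by
          rw [Measure.addHaar_ball_of_pos _ _ (by positivity), finrank_euclideanSpace_fin]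
  have hr1 : ENNReal.ofReal r ≤ ENNReal.ofReal ((1 + r) ^ d) - 1 := by
    rw [← ENNReal.ofReal_one, ← ENNReal.ofReal_sub _ zero_le_one]
    apply ENNReal.ofReal_le_ofReal
    have := one_add_mul_le_pow (a := r) (by linarith) d
    have h2 : (2 : ℝ) ≤ d := by exact_mod_cast h.out
    nlinarith
  have hc : volume cone ≤ ENNReal.ofReal (4 ^ d) * V * ENNReal.ofReal (r ^ (d - 1)) := by
    have h3 : ENNReal.ofReal r * volume cone ≤
        ENNReal.ofReal r * (ENNReal.ofReal (4 ^ d) * V * ENNReal.ofReal (r ^ (d - 1))) := by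
      refine (mul_le_mul_left hr1 _).trans (hvol.trans (le_of_eq ?_))
      have : (4 * r) ^ d = r * (4 ^ d) * r ^ (d - 1) := by
        have e : r ^ d = r ^ (d - 1) * r := by
          rw [← pow_succ, Nat.sub_add_cancel (by have := h.out; omega)]
        rw [mul_pow, e]; ring
      rw [this, ENNReal.ofReal_mul (by positivity), ENNReal.ofReal_mul (by positivity)]
      ring
    exact (ENNReal.mul_le_mul_iff_right (by simpa using hr) ENNReal.ofReal_ne_top).1 h3
  have hfin : sigma d s ≤ (τ⁻¹ * (d * (ENNReal.ofReal (4 ^ d) * V))) * ENNReal.ofReal (r ^ (d - 1)) := by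
    rw [sigma, Measure.smul_apply, smul_eq_mul, Measure.toSphere_apply' _ hs,
      finrank_euclideanSpace_fin, mul_assoc, mul_assoc]
    gcongr
  rw [Measure.real]
  refine (ENNReal.toReal_mono ?_ hfin).trans (le_of_eq ?_)
  · have : τ⁻¹ ≠ ∞ := ENNReal.inv_ne_top.2 hτ0
    exact ENNReal.mul_ne_top (ENNReal.mul_ne_top this (ENNReal.mul_ne_top (by simp)
      (ENNReal.mul_ne_top ENNReal.ofReal_ne_top hV))) ENNReal.ofReal_ne_top
  · rw [ENNReal.toReal_mul (b := ENNReal.ofReal _), ENNReal.toReal_ofReal (by positivity)]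

lemma integrable_sphere [Fact (2 ≤ d)] {G : Type*} [NormedAddCommGroup G] {F : Sph d → G}
    (hF : Continuous F) : Integrable F (sigma d) := by
  obtain ⟨C, hC⟩ := (isCompact_range hF).isBounded.exists_norm_le
  exact Integrable.of_bound hF.aestronglyMeasurable C (ae_of_all _ fun y => hC _ ⟨y, rfl⟩)

lemma hasDerivAt_integral_sphere [Fact (2 ≤ d)] {G : Type*} [NormedAddCommGroup G] [NormedSpace ℝ G]
    {Φ Φ' : ℝ → Sph d → G} (hΦ : ∀ t, Continuous (Φ t)) (hΦ' : Continuous (Function.uncurry Φ'))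
    (h : ∀ t y, HasDerivAt (fun t => Φ t y) (Φ' t y) t) (t₀ : ℝ) :
    HasDerivAt (fun t => ∫ y, Φ t y ∂sigma d) (∫ y, Φ' t₀ y ∂sigma d) t₀ := by
  obtain ⟨C, hC⟩ := (((isCompact_Icc (a := t₀ - 1) (b := t₀ + 1)).prod
    (isCompact_univ (X := Sph d))).image hΦ').isBounded.exists_norm_le
  refine (hasDerivAt_integral_of_dominated_loc_of_deriv_le (bound := fun _ => C)
    (s := Icc (t₀ - 1) (t₀ + 1)) (Icc_mem_nhds (by linarith) (by linarith))
    (Eventually.of_forall fun t => (hΦ t).aestronglyMeasurable) (integrable_sphere (hΦ t₀))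
    (hΦ'.comp (Continuous.prodMk_right t₀)).aestronglyMeasurable ?_ (integrable_const _) ?_).2
  · exact ae_of_all _ fun y t ht => hC _ ⟨(t, y), ⟨ht, mem_univ _⟩, rfl⟩
  · exact ae_of_all _ fun y t _ => h t y

end Sphere

/-! ### Fourier decay of the surface measure through a Bessel equation. -/

section Decay

variable {d : ℕ}

/-- The reflection in the hyperplane orthogonal to `w` fixes `u` and negates `w`, so the integrand
is odd under a symmetry of `σ`. -/
lemma integral_sphere_sin_inner_mul_inner (r : ℝ) {u w : Space d}
    (h : inner ℝ u w = 0) :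
    ∫ y : Sph d, sin (r * inner ℝ (y : Space d) u) * inner ℝ (y : Space d) w ∂sigma d = 0 := by
  set L := (Submodule.reflection (ℝ ∙ w)ᗮ)
  have hw : L w = -w := Submodule.reflection_mem_subspace_orthogonal_precomplement_eq_neg (by simp)
  have hu : L u = u := by
    rw [Submodule.reflection_eq_self_iff, Submodule.mem_orthogonal_singleton_iff_inner_left]
    exact h
  have e1 (y : Space d) : inner ℝ (L y) u = inner ℝ y u := by
    conv_lhs => rw [← hu]
    exact L.inner_map_map _ _
  have e2 (y : Space d) : inner ℝ (L y) w = - inner ℝ y w := by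
    have : inner ℝ (L y) (L w) = inner ℝ y w := L.inner_map_map _ _
    rw [hw, inner_neg_right] at this
    linarith
  have := integral_sphere_comp L
    (fun y : Sph d => sin (r * inner ℝ (y : Space d) u) * inner ℝ (y : Space d) w) (by fun_prop)
  simp only [sphereMap, e1, e2, mul_neg, integral_neg] at this
  linarith

/-- The preceding identity holds for `u = cos θ e + sin θ f` and `w = u'(θ)` at every angle `θ`.
Differentiating it at `θ = 0` gives this one, which plays the role of an integration by parts on the
sphere. -/
lemma mul_integral_cos_inner_mul_sq [Fact (2 ≤ d)] (r : ℝ) {e f : Space d} (he : ‖e‖ = 1)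
    (hf : ‖f‖ = 1) (h : inner ℝ e f = 0) :
    r * ∫ y : Sph d, cos (r * inner ℝ (y : Space d) e) * (inner ℝ (y : Space d) f) ^ 2 ∂sigma d =
      ∫ y : Sph d, sin (r * inner ℝ (y : Space d) e) * inner ℝ (y : Space d) e ∂sigma d := by
  set A : Sph d → ℝ := fun y => inner ℝ (y : Space d) e
  set B : Sph d → ℝ := fun y => inner ℝ (y : Space d) f
  have hA : Continuous A := by fun_prop
  have hB : Continuous B := by fun_prop
  have hI (θ : ℝ) : ∫ y, sin (r * (cos θ * A y + sin θ * B y)) *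
      (-sin θ * A y + cos θ * B y) ∂sigma d = 0 := by
    have := integral_sphere_sin_inner_mul_inner r (u := cos θ • e + sin θ • f)
      (w := -sin θ • e + cos θ • f) (by
        simp only [inner_add_left, inner_add_right, inner_smul_left, inner_smul_right,
          real_inner_self_eq_norm_sq, he, hf, h, real_inner_comm e f]
        simp; ring)
    simpa only [inner_add_right, inner_smul_right] using this
  have hD := hasDerivAt_integral_sphere (d := d)
    (Φ := fun θ y => sin (r * (cos θ * A y + sin θ * B y)) * (-sin θ * A y + cos θ * B y))
    (Φ' := fun θ y => cos (r * (cos θ * A y + sin θ * B y)) * (r * (-sin θ * A y + cos θ * B y)) *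
      (-sin θ * A y + cos θ * B y) +
        sin (r * (cos θ * A y + sin θ * B y)) * (-cos θ * A y + -sin θ * B y))
    (by intro t; fun_prop) (by unfold Function.uncurry; fun_prop)
    (by
      intro t y
      have h1 : HasDerivAt (fun θ => r * (cos θ * A y + sin θ * B y))
          (r * (-sin t * A y + cos t * B y)) t :=
        (((hasDerivAt_cos t).mul_const _).add ((hasDerivAt_sin t).mul_const _)).const_mul r
      have h2 : HasDerivAt (fun θ => -sin θ * A y + cos θ * B y)
          (-cos t * A y + -sin t * B y) t :=
        (((hasDerivAt_sin t).neg.mul_const _).add ((hasDerivAt_cos t).mul_const _))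
      exact (h1.sin).mul h2) 0
  simp only [hI] at hD
  have h0 := hD.unique (hasDerivAt_const (0 : ℝ) (0 : ℝ))
  simp only [cos_zero, sin_zero] at h0
  have i1 : Integrable (fun y => r * (cos (r * A y) * B y ^ 2)) (sigma d) :=
    integrable_sphere (by fun_prop)
  have i2 : Integrable (fun y => sin (r * A y) * A y) (sigma d) :=
    integrable_sphere (by fun_prop)
  rw [← integral_const_mul, ← sub_eq_zero, ← integral_sub i1 i2, ← h0]
  congr 1
  ext y
  simp
  ring

/-- `∫ cos (r ⟨y, e⟩) dσ(y)`, the Fourier transform of the sphere in the direction `e`. -/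
noncomputable def sphereCos (e : Space d) (r : ℝ) : ℝ :=
  ∫ y : Sph d, cos (r * inner ℝ (y : Space d) e) ∂sigma d

/-- The derivative of `sphereCos`. -/
noncomputable def sphereCosDeriv (e : Space d) (r : ℝ) : ℝ :=
  -∫ y : Sph d, sin (r * inner ℝ (y : Space d) e) * inner ℝ (y : Space d) e ∂sigma d

lemma hasDerivAt_sphereCos [Fact (2 ≤ d)] (e : Space d) (r : ℝ) :
    HasDerivAt (sphereCos e) (sphereCosDeriv e r) r := by
  set A : Sph d → ℝ := fun y => inner ℝ (y : Space d) e with hAdef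
  have hA : Continuous A := by fun_prop
  have := hasDerivAt_integral_sphere (d := d) (Φ := fun r y => cos (r * A y))
    (Φ' := fun r y => -(sin (r * A y) * A y))
    (by intro t; fun_prop) (by unfold Function.uncurry; fun_prop) (fun t y => ?_) r
  · rw [integral_neg] at this
    exact this
  · have := ((hasDerivAt_id t).mul_const (A y)).cos
    simpa using this

lemma hasDerivAt_sphereCosDeriv [Fact (2 ≤ d)] (e : Space d) (r : ℝ) :
    HasDerivAt (sphereCosDeriv e)
      (-∫ y : Sph d, cos (r * inner ℝ (y : Space d) e) * inner ℝ (y : Space d) e ^ 2 ∂sigma d) r := by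
  set A : Sph d → ℝ := fun y => inner ℝ (y : Space d) e with hAdef
  have hA : Continuous A := by fun_prop
  have := (hasDerivAt_integral_sphere (d := d)
    (Φ := fun r y => sin (r * A y) * A y)
    (Φ' := fun r y => cos (r * A y) * A y ^ 2)
    (by intro t; fun_prop) (by unfold Function.uncurry; fun_prop) (fun t y => ?_) r).neg
  · exact this
  · refine ((((hasDerivAt_id t).mul_const (A y)).sin).mul_const (A y)).congr_deriv ?_
    simp; ring

/-- Since the squared coordinates of `y` sum to one, the left side is a sum over the `d - 1`
directions orthogonal to `v i`. Each of them contributes the same multiple of the derivative by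
`mul_integral_cos_inner_mul_sq`. -/
lemma sphereCos_ode [Fact (2 ≤ d)] (v : OrthonormalBasis (Fin d) ℝ (Space d)) (i : Fin d) (r : ℝ) :
    r * (sphereCos (v i) r -
      ∫ y : Sph d, cos (r * inner ℝ (y : Space d) (v i)) * inner ℝ (y : Space d) (v i) ^ 2 ∂sigma d) =
      -((d : ℝ) - 1) * sphereCosDeriv (v i) r := by
  have h1 : sphereCos (v i) r = ∑ k, ∫ y : Sph d, cos (r * inner ℝ (y : Space d) (v i)) *
      inner ℝ (y : Space d) (v k) ^ 2 ∂sigma d := by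
    rw [← integral_finsetSum _ (fun k _ => integrable_sphere (by fun_prop)), sphereCos]
    congr 1
    ext y
    rw [← Finset.mul_sum]
    have := v.sum_sq_norm_inner_left (y : Space d)
    simp only [Real.norm_eq_abs, sq_abs, norm_eq_of_mem_sphere] at this
    rw [this]; simp
  rw [h1, ← Finset.add_sum_erase _ _ (Finset.mem_univ i), add_sub_cancel_left, Finset.mul_sum,
    Finset.sum_congr rfl (fun k hk => mul_integral_cos_inner_mul_sq r (v.orthonormal.1 i)
      (v.orthonormal.1 k) (v.orthonormal.2 (Finset.ne_of_mem_erase hk).symm))]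
  rw [Finset.sum_const, Finset.card_erase_of_mem (Finset.mem_univ i), sphereCosDeriv]
  have : 1 ≤ d := by have := (Fact.out : 2 ≤ d); omega
  simp [Nat.cast_sub this]
  ring

/-- Boundedness of the energy for solutions of a Bessel type equation. -/
lemma exists_energy_bound {n : ℕ} (hn : 1 ≤ n) {b b₁ b₂ : ℝ → ℝ} (h1 : ∀ r, HasDerivAt b (b₁ r) r)
    (h2 : ∀ r, HasDerivAt b₁ (b₂ r) r) (ode : ∀ r, r * (b r + b₂ r) = -n * b₁ r)
    (hb : ∀ r, |b r| ≤ 1) (hb₁ : ∀ r, |b₁ r| ≤ 1) :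
    ∃ C, 0 ≤ C ∧ ∀ r, 0 ≤ r → r ^ n * (b r ^ 2 + b₁ r ^ 2) ≤ C := by
  have hn0 : (1 : ℝ) ≤ n := by exact_mod_cast hn
  -- The correction term `n r^(n-1) b b₁` cancels the leading terms in the derivative of the energy.
  -- What remains is of size `r^(n-2)`, hence integrable relative to the energy.
  set E : ℝ → ℝ := fun r => r ^ n * (b r ^ 2 + b₁ r ^ 2) + n * r ^ (n - 1) * (b r * b₁ r)
  have hpow (r : ℝ) : r ^ n = r ^ (n - 1) * r := by rw [← pow_succ, Nat.sub_add_cancel hn]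
  have hE (r : ℝ) (hr : 0 < r) : HasDerivAt E (-n * (r ^ (n - 1) / r) * (b r * b₁ r)) r := by
    have hb2 : b₂ r = - b r - n / r * b₁ r := by
      have := ode r
      field_simp
      linarith
    have d1 := ((hasDerivAt_pow n r).mul (((h1 r).pow 2).add ((h2 r).pow 2)))
    have d2 := ((hasDerivAt_pow (n - 1) r).const_mul (n : ℝ)).mul ((h1 r).mul (h2 r))
    refine (d1.add d2).congr_deriv ?_
    have e2 : ((n - 1 : ℕ) : ℝ) * r ^ (n - 1 - 1) = (n - 1) * (r ^ (n - 1) / r) := by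
      rcases Nat.lt_or_ge 1 n with h | h
      · have : r ^ (n - 1) = r ^ (n - 1 - 1) * r := by
          rw [← pow_succ, Nat.sub_add_cancel (by omega)]
        rw [this, mul_div_assoc, div_self hr.ne', mul_one, Nat.cast_sub hn, Nat.cast_one]
      · obtain rfl : n = 1 := by omega
        simp
    simp only [Pi.pow_apply, Pi.add_apply, Pi.mul_apply]
    rw [e2, hb2, hpow r]
    field_simp
    ring
  have hlow (r : ℝ) (hr : (n : ℝ) ≤ r) : r ^ n * (b r ^ 2 + b₁ r ^ 2) ≤ 2 * E r := by
    have hr0 : 0 < r := by linarith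
    have : |(n : ℝ) * r ^ (n - 1) * (b r * b₁ r)| ≤ r ^ n * (b r ^ 2 + b₁ r ^ 2) / 2 := by
      rw [abs_mul, abs_of_nonneg (by positivity), hpow]
      have h3 : |b r * b₁ r| ≤ (b r ^ 2 + b₁ r ^ 2) / 2 := by
        rw [abs_le]; constructor <;> nlinarith [sq_nonneg (b r + b₁ r), sq_nonneg (b r - b₁ r)]
      calc n * r ^ (n - 1) * |b r * b₁ r| ≤ r * r ^ (n - 1) * ((b r ^ 2 + b₁ r ^ 2) / 2) := by
            gcongr
        _ = _ := by ring
    have := neg_le_of_abs_le this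
    simp only [E]; linarith
  -- Grönwall: `E' ≤ (n / r²) E` on `[n, ∞)`, and `exp (n / r)` is the corresponding integrating
  -- factor.
  have hanti : AntitoneOn (fun r => E r * exp (n / r)) (Ici (n : ℝ)) := by
    have hd' (r : ℝ) (hr : 0 < r) : HasDerivAt (fun r => E r * exp (n / r))
        ((-n * (r ^ (n - 1) / r) * (b r * b₁ r)) * exp (n / r) +
          E r * (exp (n / r) * (-n / r ^ 2))) r := by
      have : HasDerivAt (fun r : ℝ => n / r) (-n / r ^ 2) r := by
        refine ((hasDerivAt_const r (n : ℝ)).div (hasDerivAt_id r) hr.ne').congr_deriv ?_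
        simp
      exact (hE r hr).mul this.exp
    refine antitoneOn_of_deriv_nonpos (convex_Ici _) ?_ ?_ ?_
    · intro r hr
      exact (hd' r (by have := mem_Ici.1 hr; linarith)).continuousAt.continuousWithinAt
    · intro r hr
      rw [interior_Ici, mem_Ioi] at hr
      exact (hd' r (by linarith)).differentiableAt.differentiableWithinAt
    · intro r hr
      rw [interior_Ici, mem_Ioi] at hr
      have hr0 : 0 < r := by linarith
      rw [(hd' r hr0).deriv]
      have h3 : -(b r * b₁ r) ≤ (b r ^ 2 + b₁ r ^ 2) / 2 := by nlinarith [sq_nonneg (b r + b₁ r)]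
      have h4 := hlow r hr.le
      have h5 : (-n * (r ^ (n - 1) / r) * (b r * b₁ r)) ≤ E r * (n / r ^ 2) := by
        calc (-n * (r ^ (n - 1) / r) * (b r * b₁ r)) = n * (r ^ (n - 1) / r) * -(b r * b₁ r) := by ring
          _ ≤ n * (r ^ (n - 1) / r) * ((b r ^ 2 + b₁ r ^ 2) / 2) := by gcongr
          _ = (r ^ n * (b r ^ 2 + b₁ r ^ 2)) / 2 * (n / r ^ 2) := by
            rw [hpow]; field_simp
          _ ≤ E r * (n / r ^ 2) := by gcongr; linarith
      have h6 := mul_le_mul_of_nonneg_right h5 (exp_pos (n / r)).le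
      have h7 : E r * (exp (n / r) * (-n / r ^ 2)) = -(E r * (n / r ^ 2) * exp (n / r)) := by ring
      linarith
  have hEn : 0 ≤ E n := by
    have := hlow n le_rfl
    have h0 : 0 ≤ (n : ℝ) ^ n * (b n ^ 2 + b₁ n ^ 2) := by positivity
    linarith
  refine ⟨2 * (E n * exp 1) + n ^ n * 2, by positivity, fun r hr => ?_⟩
  rcases le_total r n with h | h
  · have : b r ^ 2 + b₁ r ^ 2 ≤ 2 := by
      have := (sq_le_one_iff_abs_le_one (b r)).2 (hb r)
      have := (sq_le_one_iff_abs_le_one (b₁ r)).2 (hb₁ r)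
      linarith
    have h2 : r ^ n * (b r ^ 2 + b₁ r ^ 2) ≤ n ^ n * 2 := by gcongr
    have : 0 ≤ 2 * (E n * exp 1) := by positivity
    linarith
  · have hr0 : 0 < r := by linarith
    have h3 := hanti (mem_Ici.2 le_rfl) (mem_Ici.2 h) h
    simp only [div_self (show (n : ℝ) ≠ 0 by positivity)] at h3
    have h4 := hlow r h
    have hE0 : 0 ≤ E r := by
      have h0 : 0 ≤ r ^ n * (b r ^ 2 + b₁ r ^ 2) := by positivity
      linarith
    have h5 : E r ≤ E r * exp (n / r) := le_mul_of_one_le_right hE0 (one_le_exp (by positivity))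
    have : (0 : ℝ) ≤ n ^ n * 2 := by positivity
    linarith

lemma abs_inner_sphere_le (y : Sph d) {e : Space d} (he : ‖e‖ = 1) :
    |inner ℝ (y : Space d) e| ≤ 1 := by
  have := abs_real_inner_le_norm (y : Space d) e
  rwa [he, norm_eq_of_mem_sphere, one_mul] at this

lemma sphereCos_eq (r : ℝ) {e e' : Space d} (h : ‖e‖ = ‖e'‖) : sphereCos e r = sphereCos e' r := by
  obtain ⟨L, hL⟩ := exists_isometry_map_eq h
  have := integral_sphere_comp L (fun y : Sph d => cos (r * inner ℝ (y : Space d) e'))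
    (by fun_prop)
  rw [sphereCos, sphereCos, ← this]
  congr 1
  ext y
  simp only [sphereMap]
  rw [← hL, L.inner_map_map]

lemma sphereCosDeriv_eq (r : ℝ) {e e' : Space d} (h : ‖e‖ = ‖e'‖) :
    sphereCosDeriv e r = sphereCosDeriv e' r := by
  obtain ⟨L, hL⟩ := exists_isometry_map_eq h
  have := integral_sphere_comp L (fun y : Sph d => sin (r * inner ℝ (y : Space d) e') *
    inner ℝ (y : Space d) e') (by fun_prop)
  rw [sphereCosDeriv, sphereCosDeriv, ← this]
  congr 2
  ext y
  simp only [sphereMap]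
  rw [← hL, L.inner_map_map]

lemma exists_sphereCos_decay [h : Fact (2 ≤ d)] : ∃ C, 0 ≤ C ∧ ∀ (e : Space d) (r : ℝ), ‖e‖ = 1 →
    0 ≤ r → r ^ (d - 1) * (sphereCos e r ^ 2 + sphereCosDeriv e r ^ 2) ≤ C := by
  have hd := h.out
  set v := EuclideanSpace.basisFun (Fin d) ℝ
  set i : Fin d := ⟨0, by omega⟩
  have hv : ‖v i‖ = 1 := v.orthonormal.1 i
  have hbound (F : Sph d → ℝ) (hF : ∀ y, |F y| ≤ 1) : |∫ y, F y ∂sigma d| ≤ 1 := by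
    have := norm_integral_le_of_norm_le_const (μ := sigma d) (f := F) (C := 1) (ae_of_all _ hF)
    simpa using this
  obtain ⟨C, hC0, hC⟩ := exists_energy_bound (n := d - 1) (by omega) (hasDerivAt_sphereCos (v i))
    (hasDerivAt_sphereCosDeriv (v i)) (fun r => by
      have := sphereCos_ode v i r
      rw [Nat.cast_sub (by omega), Nat.cast_one, ← this]; ring)
    (fun r => hbound _ fun y => abs_cos_le_one _)
    (fun r => by
      rw [sphereCosDeriv, abs_neg]
      refine hbound _ fun y => ?_
      rw [abs_mul]
      exact mul_le_one₀ (abs_sin_le_one _) (abs_nonneg _) (abs_inner_sphere_le y hv))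
  refine ⟨C, hC0, fun e r he hr => ?_⟩
  rw [sphereCos_eq r (he.trans hv.symm), sphereCosDeriv_eq r (he.trans hv.symm)]
  exact hC r hr

/-- The Fourier transform of the surface measure. -/
noncomputable def sphereFourier (ξ : Space d) : ℂ :=
  ∫ y : Sph d, (𝐞 (-inner ℝ (y : Space d) ξ) : ℂ) ∂sigma d

/-- `∫ ⟨y, ξ⟩ exp (-2πi⟨y, ξ⟩) dσ(y)`, up to a constant the radial derivative of the
Fourier transform of the surface measure. -/
noncomputable def sphereFourierDeriv (ξ : Space d) : ℂ :=
  ∫ y : Sph d, (inner ℝ (y : Space d) ξ : ℝ) * (𝐞 (-inner ℝ (y : Space d) ξ) : ℂ) ∂sigma d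

lemma integral_sphere_odd (F : Sph d → ℝ) (hF : Continuous F)
    (hodd : ∀ y, F (sphereMap (LinearIsometryEquiv.neg ℝ) y) = -F y) :
    ∫ y, F y ∂sigma d = 0 := by
  have := integral_sphere_comp (LinearIsometryEquiv.neg ℝ) F hF
  simp only [hodd, integral_neg] at this
  linarith

lemma fourierChar_neg_eq (x : ℝ) : (𝐞 (-x) : ℂ) =
    ((cos (2 * π * x) : ℝ) : ℂ) - ((sin (2 * π * x) : ℝ) : ℂ) * Complex.I := by
  rw [Real.fourierChar_apply]
  rw [show (2 * π * (-x) : ℝ) = -(2 * π * x) by ring, Complex.ofReal_neg, Complex.exp_mul_I,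
    Complex.cos_neg, Complex.sin_neg, Complex.ofReal_cos, Complex.ofReal_sin]
  ring

/-- The sine part is odd under `y ↦ -y` and integrates to zero. -/
lemma sphereFourier_eq [Fact (2 ≤ d)] (e : Space d) (r : ℝ) :
    sphereFourier (r • e) = sphereCos e (2 * π * r) := by
  have h1 (y : Sph d) : (𝐞 (-inner ℝ (y : Space d) (r • e)) : ℂ) =
      ((cos (2 * π * r * inner ℝ (y : Space d) e) : ℝ) : ℂ) -
        ((sin (2 * π * r * inner ℝ (y : Space d) e) : ℝ) : ℂ) * Complex.I := by
    rw [fourierChar_neg_eq, inner_smul_right, mul_assoc (2 * π)]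
  rw [sphereFourier, integral_congr_ae (ae_of_all _ h1), integral_sub, integral_mul_const,
    integral_complex_ofReal, integral_complex_ofReal,
    integral_sphere_odd (fun y : Sph d => sin (2 * π * r * inner ℝ (y : Space d) e)), sphereCos]
  · simp
  · fun_prop
  · intro y; simp [sphereMap]
  · exact integrable_sphere (by fun_prop)
  · exact integrable_sphere (by fun_prop)

lemma sphereFourierDeriv_eq [Fact (2 ≤ d)] (e : Space d) (r : ℝ) :
    sphereFourierDeriv (r • e) = r * sphereCosDeriv e (2 * π * r) * Complex.I := by
  have h1 (y : Sph d) : (inner ℝ (y : Space d) (r • e) : ℝ) *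
      (𝐞 (-inner ℝ (y : Space d) (r • e)) : ℂ) =
      ((r * (cos (2 * π * r * inner ℝ (y : Space d) e) * inner ℝ (y : Space d) e) : ℝ) : ℂ) -
        ((r * (sin (2 * π * r * inner ℝ (y : Space d) e) * inner ℝ (y : Space d) e) : ℝ) : ℂ) *
          Complex.I := by
    rw [fourierChar_neg_eq, inner_smul_right, mul_assoc (2 * π)]
    push_cast
    ring
  rw [sphereFourierDeriv, integral_congr_ae (ae_of_all _ h1), integral_sub, integral_mul_const,
    integral_complex_ofReal, integral_complex_ofReal,
    integral_sphere_odd (fun y : Sph d => r * (cos (2 * π * r * inner ℝ (y : Space d) e) *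
      inner ℝ (y : Space d) e)), integral_const_mul, sphereCosDeriv]
  · simp
  · fun_prop
  · intro y; simp [sphereMap]
  · exact integrable_sphere (by fun_prop)
  · exact integrable_sphere (by fun_prop)

lemma exists_sphereFourier_decay [h : Fact (2 ≤ d)] : ∃ C, 0 < C ∧ ∀ ξ : Space d, ξ ≠ 0 →
    ‖sphereFourier ξ‖ ≤ C * ‖ξ‖ ^ (-(((d : ℝ) - 1) / 2)) ∧
    ‖sphereFourierDeriv ξ‖ ≤ C * ‖ξ‖ * ‖ξ‖ ^ (-(((d : ℝ) - 1) / 2)) := by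
  have hd := h.out
  obtain ⟨C, hC0, hC⟩ := exists_sphereCos_decay (d := d)
  refine ⟨√C + 1, by positivity, fun ξ hξ => ?_⟩
  set r := ‖ξ‖
  have hr : 0 < r := norm_pos_iff.2 hξ
  set e := r⁻¹ • ξ
  have he : ‖e‖ = 1 := by
    rw [norm_smul, norm_inv, Real.norm_of_nonneg hr.le]; exact inv_mul_cancel₀ hr.ne'
  have hξe : ξ = r • e := by rw [smul_smul, mul_inv_cancel₀ hr.ne', one_smul]
  have hk := hC e (2 * π * r) he (by positivity)
  have hpi : 1 ≤ 2 * π := by nlinarith [pi_gt_three]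
  have hk2 : r ^ (d - 1) * (sphereCos e (2 * π * r) ^ 2 + sphereCosDeriv e (2 * π * r) ^ 2) ≤ C := by
    refine le_trans ?_ hk
    gcongr
    exact le_mul_of_one_le_left hr.le hpi
  have hgen (x : ℝ) (hx : r ^ (d - 1) * x ^ 2 ≤ C) :
      |x| ≤ (√C + 1) * r ^ (-(((d : ℝ) - 1) / 2)) := by
    have hs : (r ^ (-(((d : ℝ) - 1) / 2))) ^ 2 = (r ^ (d - 1))⁻¹ := by
      rw [← Real.rpow_natCast (r ^ _) 2, ← Real.rpow_mul hr.le, ← Real.rpow_natCast r (d - 1),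
        ← Real.rpow_neg hr.le, Nat.cast_sub (by omega)]
      congr 1; push_cast; ring
    have hpos : 0 < r ^ (-(((d : ℝ) - 1) / 2)) := by positivity
    apply abs_le_of_sq_le_sq _ (by positivity)
    rw [mul_pow, hs, ← div_eq_mul_inv, le_div_iff₀ (by positivity), mul_comm]
    refine hx.trans ?_
    nlinarith [Real.sq_sqrt hC0, Real.sqrt_nonneg C]
  have hp : 0 < r ^ (d - 1) := by positivity
  constructor
  · rw [hξe, sphereFourier_eq, Complex.norm_real, Real.norm_eq_abs]
    apply hgen
    nlinarith [sq_nonneg (sphereCosDeriv e (2 * π * r))]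
  · rw [hξe, sphereFourierDeriv_eq]
    simp only [norm_mul, Complex.norm_real, Complex.norm_I, mul_one, Real.norm_eq_abs]
    rw [abs_of_pos hr]
    refine (mul_le_mul_of_nonneg_left (hgen _ ?_) hr.le).trans (le_of_eq (by ring))
    nlinarith [sq_nonneg (sphereCos e (2 * π * r))]

end Decay

/-! ### Convolutions, their Fourier transforms and Littlewood–Paley bumps. -/

section Convolution

variable {d : ℕ}

/-- The convolution of real functions on `ℝ^d`. -/
noncomputable def conv (k f : Space d → ℝ) (x : Space d) : ℝ := ∫ y, k (x - y) * f y

open scoped Convolution in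
lemma conv_eq_convolution (k f : Space d → ℝ) :
    conv k f = f ⋆[ContinuousLinearMap.mul ℝ ℝ] k := by
  ext x
  simp only [conv, convolution, ContinuousLinearMap.mul_apply']
  simp_rw [mul_comm]

/-- The Fourier transform of a real function. -/
noncomputable def rft (k : Space d → ℝ) : Space d → ℂ := 𝓕 (fun x => (k x : ℂ))

lemma rft_apply (k : Space d → ℝ) (ξ : Space d) :
    rft k ξ = ∫ x, (𝐞 (-inner ℝ x ξ) : ℂ) * (k x : ℂ) := by
  rw [rft, Real.fourier_eq]
  rfl

lemma rft_conv {k f : Space d → ℝ} (hk : Integrable k) (hf : Integrable f) (ξ : Space d) :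
    rft (conv k f) ξ = rft k ξ * rft f ξ := by
  have h := Real.fourier_mul_convolution_eq (f₁ := fun x => (f x : ℂ)) (f₂ := fun x => (k x : ℂ))
    hf.ofReal hk.ofReal ξ
  rw [rft, rft, rft, mul_comm, ← h]
  refine congrArg (fun F : Space d → ℂ => (𝓕 F : Space d → ℂ) ξ) (funext fun x => ?_)
  rw [conv, ← integral_complex_ofReal]
  simp only [convolution, ContinuousLinearMap.mul_apply', Complex.ofReal_mul]
  simp_rw [mul_comm]

lemma integrable_conv {k f : Space d → ℝ} (hk : Integrable k) (hf : Integrable f) :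
    Integrable (conv k f) := by
  rw [conv_eq_convolution]
  exact hf.integrable_convolution _ hk

lemma integrable_fourierChar_mul {k : Space d → ℝ} (hk : Integrable k) (ξ : Space d) :
    Integrable (fun x => (𝐞 (-inner ℝ x ξ) : ℂ) * (k x : ℂ)) := by
  have := (Real.fourierIntegral_convergent_iff (μ := volume) (f := fun x => (k x : ℂ)) ξ).2 hk.ofReal
  exact this

lemma rft_add {k f : Space d → ℝ} (hk : Integrable k) (hf : Integrable f) (ξ : Space d) :
    rft (fun x => k x + f x) ξ = rft k ξ + rft f ξ := by
  rw [rft_apply, rft_apply, rft_apply, ← integral_add (integrable_fourierChar_mul hk ξ)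
    (integrable_fourierChar_mul hf ξ)]
  congr 1
  ext x
  push_cast
  ring

lemma rft_const_mul (c : ℝ) (k : Space d → ℝ) (ξ : Space d) :
    rft (fun x => c * k x) ξ = c * rft k ξ := by
  rw [rft_apply, rft_apply, ← integral_const_mul]
  congr 1
  ext x
  push_cast
  ring

lemma rft_sub {k f : Space d → ℝ} (hk : Integrable k) (hf : Integrable f) (ξ : Space d) :
    rft (fun x => k x - f x) ξ = rft k ξ - rft f ξ := by
  have := rft_add hk (hf.const_mul (-1)) ξ
  rw [rft_const_mul] at this
  simpa [sub_eq_add_neg] using this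

lemma rft_dilate (k : Space d → ℝ) {s : ℝ} (hs : 0 < s) (ξ : Space d) :
    rft (fun x => s ^ d * k (s • x)) ξ = rft k (s⁻¹ • ξ) := by
  rw [rft_const_mul, rft_apply, rft_apply]
  have := Measure.integral_comp_smul_of_nonneg (volume : Measure (Space d))
    (fun x => (𝐞 (-inner ℝ x (s⁻¹ • ξ)) : ℂ) * (k x : ℂ)) s (hR := hs.le)
  have h2 (x : Space d) : inner ℝ (s • x) (s⁻¹ • ξ) = inner ℝ x ξ := by
    rw [inner_smul_left, inner_smul_right]; simp [hs.ne']
  simp only [h2, finrank_euclideanSpace_fin] at this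
  rw [this]
  simp [hs.ne']

/-- A smooth function of compact support invariant under linear isometries. -/
structure IsRadialTest (φ : Space d → ℝ) : Prop where
  smooth : ContDiff ℝ ((⊤ : ℕ∞) : WithTop ℕ∞) φ
  compact : HasCompactSupport φ
  radial : ∀ (L : Space d ≃ₗᵢ[ℝ] Space d) x, φ (L x) = φ x

lemma IsRadialTest.integrable {φ : Space d → ℝ} (h : IsRadialTest φ) : Integrable φ :=
  h.smooth.continuous.integrable_of_hasCompactSupport h.compact

lemma conv_radial {k f : Space d → ℝ} (hk : ∀ (L : Space d ≃ₗᵢ[ℝ] Space d) x, k (L x) = k x)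
    (hf : ∀ (L : Space d ≃ₗᵢ[ℝ] Space d) x, f (L x) = f x) (L : Space d ≃ₗᵢ[ℝ] Space d)
    (x : Space d) : conv k f (L x) = conv k f x := by
  rw [conv, conv, ← L.measurePreserving.integral_comp L.toHomeomorph.measurableEmbedding]
  simp_rw [← map_sub, hk, hf]

lemma IsRadialTest.conv {φ η : Space d → ℝ} (h : IsRadialTest φ) (h' : IsRadialTest η) :
    IsRadialTest (conv φ η) where
  smooth := by
    rw [conv_eq_convolution]
    exact h.compact.contDiff_convolution_right _ h'.smooth.continuous.locallyIntegrable h.smooth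
  compact := by
    rw [conv_eq_convolution]
    exact HasCompactSupport.convolution _ h'.compact h.compact
  radial := conv_radial h.radial h'.radial

/-- Total mass one together with support in the unit ball makes the Fourier transform
Lipschitz-close to `1` at the origin. This is the base factor of the mollifiers of higher order. -/
lemma exists_bump : ∃ η : Space d → ℝ, IsRadialTest η ∧ ∃ C, ∀ ξ, ‖1 - rft η ξ‖ ≤ C * ‖ξ‖ := by
  set g : Space d → ℝ := fun x => smoothTransition (1 - ‖x‖ ^ 2)
  have g0 (x) : 0 ≤ g x := smoothTransition.nonneg _
  have gs : ContDiff ℝ ((⊤ : ℕ∞) : WithTop ℕ∞) g := smoothTransition.contDiff.comp (contDiff_const.sub (contDiff_norm_sq ℝ))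
  have gsupp (x) (hx : 1 < ‖x‖) : g x = 0 := by
    apply smoothTransition.zero_of_nonpos
    nlinarith
  have gc : HasCompactSupport g :=
    HasCompactSupport.intro (isCompact_closedBall (0 : Space d) 1) (fun x hx => gsupp x (by simpa using hx))
  have gi : Integrable g := gs.continuous.integrable_of_hasCompactSupport gc
  have gpos : 0 < ∫ x, g x := by
    refine gs.continuous.integral_pos_of_hasCompactSupport_nonneg_nonzero gc g0 (x := 0) ?_
    simp [g, smoothTransition.one_of_one_le]
  set c := (∫ x, g x)⁻¹
  have cpos : 0 < c := inv_pos.2 gpos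
  refine ⟨fun x => c * g x, ⟨contDiff_const.mul gs, gc.mul_left, fun L x => by simp [g]⟩, 2 * π, fun ξ => ?_⟩
  have hi : Integrable (fun x => c * g x) := gi.const_mul c
  have h1 : ∫ x, c * g x = 1 := by rw [integral_const_mul]; exact inv_mul_cancel₀ gpos.ne'
  have h2 : (1 : ℂ) = ∫ x, ((c * g x : ℝ) : ℂ) := by
    rw [integral_complex_ofReal, h1]; simp
  have hio : Integrable (fun x => ((c * g x : ℝ) : ℂ)) := hi.ofReal
  rw [rft_apply, h2, ← integral_sub hio (integrable_fourierChar_mul hi ξ)]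
  calc _ ≤ ∫ x, 2 * π * ‖ξ‖ * (c * g x) := by
        refine norm_integral_le_of_norm_le (hi.const_mul _) (ae_of_all _ fun x => ?_)
        rw [← one_sub_mul, norm_mul, Complex.norm_real, Real.norm_of_nonneg (mul_nonneg cpos.le (g0 x))]
        rcases le_or_gt ‖x‖ 1 with hx | hx
        · refine mul_le_mul_of_nonneg_right ?_ (mul_nonneg cpos.le (g0 x))
          rw [norm_sub_rev, Real.fourierChar_apply, mul_comm _ Complex.I]
          refine (Real.norm_exp_I_mul_ofReal_sub_one_le).trans ?_
          rw [Real.norm_eq_abs, abs_mul, abs_of_pos (by positivity : 0 < 2 * π), abs_neg]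
          gcongr
          refine (abs_real_inner_le_norm x ξ).trans ?_
          exact mul_le_of_le_one_left (norm_nonneg _) hx
        · simp [gsupp x hx]
    _ = _ := by rw [integral_const_mul, h1, mul_one]

/-- Each step multiplies `1 - φ̂` by `1 - η̂`, which corresponds to replacing `φ` by `φ + η - η *
φ`. Compact support in space is kept while the order of contact with `1` at frequency zero
increases. -/
lemma exists_mollifier (m : ℕ) : ∃ φ : Space d → ℝ, IsRadialTest φ ∧
    ∃ C, ∀ ξ, ‖1 - rft φ ξ‖ ≤ C * ‖ξ‖ ^ m := by
  induction m with
  | zero =>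
    refine ⟨fun _ => 0, ⟨contDiff_const, HasCompactSupport.zero, fun _ _ => rfl⟩, 1, fun ξ => ?_⟩
    simp [rft_apply]
  | succ m ih =>
    obtain ⟨φ, hφ, C, hC⟩ := ih
    obtain ⟨η, hη, D, hD⟩ := exists_bump (d := d)
    have hc := hη.conv hφ
    refine ⟨fun x => φ x + η x - conv η φ x, ⟨(hφ.smooth.add hη.smooth).sub hc.smooth, ?_, ?_⟩,
      D * C, fun ξ => ?_⟩
    · exact (hφ.compact.add hη.compact).sub hc.compact
    · intro L x; rw [hφ.radial, hη.radial, hc.radial]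
    · rw [rft_sub (k := fun x => φ x + η x) (hφ.integrable.add hη.integrable) hc.integrable,
        rft_add hφ.integrable hη.integrable, rft_conv hη.integrable hφ.integrable]
      have : 1 - (rft φ ξ + rft η ξ - rft η ξ * rft φ ξ) = (1 - rft η ξ) * (1 - rft φ ξ) := by ring
      rw [this, norm_mul]
      calc _ ≤ (D * ‖ξ‖) * (C * ‖ξ‖ ^ m) :=
            mul_le_mul (hD ξ) (hC ξ) (norm_nonneg _) ((norm_nonneg _).trans (hD ξ))
        _ = _ := by ring

lemma exists_rft_decay {φ : Space d → ℝ} (h : IsRadialTest φ) (N : ℕ) :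
    ∃ C, ∀ ξ, (1 + ‖ξ‖) ^ N * ‖rft φ ξ‖ ≤ C := by
  have hs : ContDiff ℝ ((⊤ : ℕ∞) : WithTop ℕ∞) (fun x => (φ x : ℂ)) := Complex.ofRealCLM.contDiff.comp h.smooth
  have hc : HasCompactSupport (fun x => (φ x : ℂ)) := h.compact.comp_left (g := Complex.ofReal) (by simp)
  set F := hc.toSchwartzMap hs
  refine ⟨2 ^ N * (Finset.Iic (N, 0)).sup (fun m => SchwartzMap.seminorm ℝ m.1 m.2) (𝓕 F),
    fun ξ => ?_⟩
  have := SchwartzMap.one_add_le_sup_seminorm_apply (𝕜 := ℝ) (m := (N, 0)) (k := N) (n := 0)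
    le_rfl le_rfl (𝓕 F) ξ
  simp only [norm_iteratedFDeriv_zero] at this
  exact this

/-- The Littlewood-Paley bump: a radial mollifier `φ` together with the pieces built from it. -/
lemma exists_littlewoodPaley (m N : ℕ) : ∃ φ ψ : Space d → ℝ, IsRadialTest φ ∧ IsRadialTest ψ ∧
    (∫ x, φ x = 1) ∧ (∀ x, ψ x = φ x - (2⁻¹ : ℝ) ^ d * φ ((2⁻¹ : ℝ) • x)) ∧
    ∃ C, 0 ≤ C ∧ ∀ ξ, ‖rft ψ ξ‖ * (1 + ‖ξ‖) ^ N ≤ C * ‖ξ‖ ^ m := by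
  -- Order `m + 1` rather than `m` forces `φ̂(0) = 1`, hence `∫ φ = 1`, even when `m = 0`.
  obtain ⟨φ, hφ, C, hC⟩ := exists_mollifier (d := d) (m + 1)
  set ψ : Space d → ℝ := fun x => φ x - (2⁻¹ : ℝ) ^ d * φ ((2⁻¹ : ℝ) • x)
  have h2 : IsRadialTest (fun x => (2⁻¹ : ℝ) ^ d * φ ((2⁻¹ : ℝ) • x)) := by
    refine ⟨contDiff_const.mul (hφ.smooth.comp (contDiff_const_smul _)), ?_, fun L x => ?_⟩
    · exact (hφ.compact.comp_smul (by norm_num : (2⁻¹ : ℝ) ≠ 0)).mul_left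
    · rw [← L.map_smul, hφ.radial]
  have hψ : IsRadialTest ψ := ⟨hφ.smooth.sub h2.smooth, hφ.compact.sub h2.compact, fun L x => by
    have := h2.radial L x
    simp only [ψ] at this ⊢
    rw [this, hφ.radial]⟩
  have hψf (ξ) : rft ψ ξ = rft φ ξ - rft φ ((2 : ℝ) • ξ) := by
    rw [rft_sub hφ.integrable h2.integrable, rft_dilate φ (by norm_num), inv_inv]
  have hC0 : 0 ≤ |C| := abs_nonneg C
  have hsmall (ξ) : ‖rft ψ ξ‖ ≤ |C| * (1 + 2 ^ (m + 1)) * ‖ξ‖ ^ (m + 1) := by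
    have e : rft ψ ξ = (1 - rft φ ((2 : ℝ) • ξ)) - (1 - rft φ ξ) := by rw [hψf]; ring
    rw [e]
    refine (norm_sub_le _ _).trans ?_
    have a1 := hC ((2 : ℝ) • ξ)
    have a2 := hC ξ
    rw [norm_smul, Real.norm_ofNat, mul_pow] at a1
    have a3 : C * ‖ξ‖ ^ (m + 1) ≤ |C| * ‖ξ‖ ^ (m + 1) := by gcongr; exact le_abs_self C
    have a4 : C * (2 ^ (m + 1) * ‖ξ‖ ^ (m + 1)) ≤ |C| * (2 ^ (m + 1) * ‖ξ‖ ^ (m + 1)) := by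
      gcongr; exact le_abs_self C
    linarith
  obtain ⟨D, hD⟩ := exists_rft_decay hψ N
  have hD0 : 0 ≤ |D| := abs_nonneg D
  refine ⟨φ, ψ, hφ, hψ, ?_, fun x => rfl, |C| * (1 + 2 ^ (m + 1)) * 2 ^ N + |D|, by positivity,
    fun ξ => ?_⟩
  · have h0 := hC 0
    simp only [norm_zero, ne_eq, Nat.add_eq_zero_iff, one_ne_zero, and_false, not_false_eq_true,
      zero_pow, mul_zero, norm_le_zero_iff, sub_eq_zero] at h0
    rw [rft_apply] at h0
    simp only [inner_zero_right, neg_zero, AddChar.map_zero_eq_one, Circle.coe_one, one_mul] at h0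
    rw [integral_complex_ofReal] at h0
    exact_mod_cast h0.symm
  · rcases le_total ‖ξ‖ 1 with h | h
    · calc ‖rft ψ ξ‖ * (1 + ‖ξ‖) ^ N ≤ (|C| * (1 + 2 ^ (m + 1)) * ‖ξ‖ ^ (m + 1)) * 2 ^ N := by
            gcongr
            · exact hsmall ξ
            · linarith
        _ ≤ (|C| * (1 + 2 ^ (m + 1)) * ‖ξ‖ ^ m) * 2 ^ N := by
            gcongr ?_ * _
            exact mul_le_mul_of_nonneg_left (pow_le_pow_of_le_one (norm_nonneg _) h (by omega))
              (by positivity)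
        _ ≤ _ := by
            have : 0 ≤ |D| * ‖ξ‖ ^ m := by positivity
            linarith
    · calc ‖rft ψ ξ‖ * (1 + ‖ξ‖) ^ N ≤ |D| := by
            rw [mul_comm]; exact (hD ξ).trans (le_abs_self D)
        _ ≤ |D| * ‖ξ‖ ^ m := le_mul_of_one_le_right hD0 (one_le_pow₀ h)
        _ ≤ _ := by
            have : 0 ≤ |C| * (1 + 2 ^ (m + 1)) * 2 ^ N * ‖ξ‖ ^ m := by positivity
            linarith

end Convolution

/-! ### Plancherel for concrete functions and the adjoint of a convolution operator. -/

section Plancherel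

variable {d : ℕ}

/-- The Fourier integral of a function in `L¹ ∩ L²` agrees with its `L²` Fourier transform. -/
lemma fourier_ae_eq_fourier_toLp {f : Space d → ℂ} (h1 : Integrable f) (h2 : MemLp f 2) :
    (𝓕 f : Space d → ℂ) =ᵐ[volume] (𝓕 (h2.toLp f) : Lp ℂ 2 (volume : Measure (Space d))) := by
  set G := (𝓕 (h2.toLp f) : Lp ℂ 2 (volume : Measure (Space d)))
  have hcont : Continuous (𝓕 f : Space d → ℂ) :=
    VectorFourier.fourierIntegral_continuous Real.continuous_fourierChar
      (by exact continuous_inner) h1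
  refine ae_eq_of_integral_contDiff_smul_eq hcont.locallyIntegrable
    ((Lp.memLp G).locallyIntegrable one_le_two) fun g hg hgc => ?_
  have hs : ContDiff ℝ ((⊤ : ℕ∞) : WithTop ℕ∞) (fun x => (g x : ℂ)) :=
    Complex.ofRealCLM.contDiff.comp hg
  have hc : HasCompactSupport (fun x => (g x : ℂ)) := hgc.comp_left (g := Complex.ofReal) (by simp)
  set S := hc.toSchwartzMap hs
  have hS (x) : S x = (g x : ℂ) := rfl
  have e1 := DFunLike.congr_fun (Lp.fourier_toTemperedDistribution_eq (h2.toLp f)) S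
  rw [TemperedDistribution.fourier_apply, Lp.toTemperedDistribution_apply,
    Lp.toTemperedDistribution_apply] at e1
  have e2 := VectorFourier.integral_fourierIntegral_smul_eq_flip (μ := volume) (ν := volume)
    (L := innerₗ (Space d)) (f := (S : Space d → ℂ)) (g := f) Real.continuous_fourierChar
      (by exact continuous_inner) S.integrable h1
  rw [flip_innerₗ] at e2
  have e3 : ∫ x, (𝓕 S) x • (h2.toLp f) x = ∫ x, (𝓕 S) x • f x := by
    apply integral_congr_ae
    filter_upwards [h2.coeFn_toLp] with x hx
    rw [hx]
  rw [e3] at e1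
  calc ∫ x, g x • 𝓕 f x = ∫ x, S x • 𝓕 f x := rfl
    _ = ∫ x, (𝓕 S) x • f x := e2.symm
    _ = ∫ x, S x • G x := e1
    _ = _ := rfl

lemma eLpNorm_fourier_eq {f : Space d → ℂ} (h1 : Integrable f) (h2 : MemLp f 2) :
    eLpNorm (𝓕 f : Space d → ℂ) 2 volume = eLpNorm f 2 volume := by
  rw [eLpNorm_congr_ae (fourier_ae_eq_fourier_toLp h1 h2), ← eLpNorm_congr_ae h2.coeFn_toLp,
    ← Lp.enorm_def, ← Lp.enorm_def, ← ofReal_norm, ← ofReal_norm, Lp.norm_fourier_eq]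

/-- Bounded integrable functions. -/
structure IsNice (f : Space d → ℝ) : Prop where
  int : Integrable f
  bdd : ∃ M, ∀ x, |f x| ≤ M

lemma IsNice.memLp_two {f : Space d → ℝ} (h : IsNice f) : MemLp f 2 := by
  obtain ⟨M, hM⟩ := h.bdd
  rw [memLp_two_iff_integrable_sq h.int.aestronglyMeasurable]
  simp_rw [sq]
  exact h.int.bdd_mul h.int.aestronglyMeasurable (ae_of_all _ hM)

lemma eLpNorm_rft_eq {f : Space d → ℝ} (h : IsNice f) :
    eLpNorm (rft f) 2 volume = eLpNorm f 2 volume := by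
  have e : eLpNorm (rft f) 2 volume = eLpNorm (fun x => (f x : ℂ)) 2 volume :=
    eLpNorm_fourier_eq h.int.ofReal h.memLp_two.ofReal
  rw [e]
  exact eLpNorm_congr_norm_ae (ae_of_all _ fun x => by simp)

lemma abs_conv_le {k f : Space d → ℝ} {M : ℝ} (hM : ∀ x, |k x| ≤ M) (hf : Integrable f) (x : Space d) :
    |conv k f x| ≤ M * ∫ y, |f y| := by
  rw [← integral_const_mul, conv, ← Real.norm_eq_abs]
  refine norm_integral_le_of_norm_le (hf.abs.const_mul _) (ae_of_all _ fun y => ?_)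
  rw [norm_mul]
  exact mul_le_mul_of_nonneg_right (hM _) (abs_nonneg _)

lemma IsNice.conv {k f : Space d → ℝ} (hk : IsNice k) (hf : Integrable f) : IsNice (conv k f) := by
  obtain ⟨M, hM⟩ := hk.bdd
  exact ⟨integrable_conv hk.int hf, _, abs_conv_le hM hf⟩

lemma eLpNorm_conv_le {k f : Space d → ℝ} (hk : IsNice k) (hf : IsNice f) {B : ℝ}
    (hB : ∀ᵐ ξ, ‖rft k ξ‖ ≤ B) :
    eLpNorm (conv k f) 2 volume ≤ ENNReal.ofReal B * eLpNorm f 2 volume := by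
  rw [← eLpNorm_rft_eq (hk.conv hf.int), ← eLpNorm_rft_eq hf]
  refine eLpNorm_le_mul_eLpNorm_of_ae_le_mul ?_ 2
  filter_upwards [hB] with ξ h
  rw [rft_conv hk.int hf.int, norm_mul]
  gcongr

lemma integrable_mul_conv {k u v : Space d → ℝ} (hk : Integrable k) (hu : IsNice u) (hv : Integrable v) :
    Integrable (fun p : Space d × Space d => u p.1 * (k (p.1 - p.2) * v p.2))
      (volume.prod volume) := by
  obtain ⟨M, hM⟩ := hu.bdd
  have h := hv.convolution_integrand (ContinuousLinearMap.mul ℝ ℝ) hk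
  simp only [ContinuousLinearMap.mul_apply'] at h
  simp_rw [mul_comm (k _)]
  exact h.bdd_mul hu.int.aestronglyMeasurable.comp_fst (ae_of_all _ fun p => hM _)

lemma integral_mul_conv {k u v : Space d → ℝ} (hk : Integrable k) (hu : IsNice u) (hv : Integrable v)
    (heven : ∀ x, k (-x) = k x) :
    ∫ x, u x * conv k v x = ∫ x, conv k u x * v x := by
  have h := integrable_mul_conv hk hu hv
  simp only [conv, ← integral_const_mul, ← integral_mul_const]
  rw [integral_integral_swap h]
  congr 1; ext y
  congr 1; ext x
  rw [← heven, neg_sub]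
  ring

lemma conv_conv {k k' g : Space d → ℝ} (hk' : IsNice k') (hk : Integrable k) (hg : Integrable g)
    (x : Space d) : conv k' (conv k g) x = conv (conv k' k) g x := by
  have hu : IsNice (fun z => k' (x - z)) := by
    obtain ⟨M, hM⟩ := hk'.bdd
    exact ⟨hk'.int.comp_sub_left x, M, fun z => hM _⟩
  have h := integrable_mul_conv hk hu hg
  simp only [conv, ← integral_const_mul, ← integral_mul_const]
  rw [integral_integral_swap h]
  congr 1; ext y
  rw [← integral_add_right_eq_self _ y]
  congr 1; ext z
  rw [add_sub_cancel_right, sub_add_eq_sub_sub_swap]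
  ring

/-- An even kernel gives a self-adjoint operator, so the pairing is governed by the composed kernel
`conv k' k`. This is the algebra behind the `TT*` argument. -/
lemma integral_conv_mul_conv {k k' g g' : Space d → ℝ} (hk : IsNice k) (hk' : IsNice k')
    (hg : Integrable g) (hg' : Integrable g') (heven : ∀ x, k' (-x) = k' x) :
    ∫ x, conv k g x * conv k' g' x = ∫ x, conv (conv k' k) g x * g' x := by
  rw [integral_mul_conv hk'.int (hk.conv hg) hg' heven]
  congr 1; ext x
  rw [conv_conv hk' hk.int hg]

end Plancherel

/-! ### Shell kernels and the decay of their compositions. -/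

section ShellKernel

variable {d : ℕ}

/-- A radial kernel concentrated in a shell of width `δ` around the sphere of radius `s`, with the
size and Fourier decay of a frequency localized spherical measure. -/
structure IsShellKernel (C R δ s : ℝ) (k : Space d → ℝ) : Prop where
  cont : Continuous k
  radial : ∀ (L : Space d ≃ₗᵢ[ℝ] Space d) x, k (L x) = k x
  supp : ∀ x, k x ≠ 0 → |‖x‖ - s| ≤ R * δ
  l1 : ∫ x, |k x| ≤ C
  bdd : ∀ x, |k x| ≤ C * δ⁻¹
  fourier : ∀ ξ, ξ ≠ 0 → ‖rft k ξ‖ ≤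
    C * δ ^ (((d : ℝ) - 1) / 2) * (‖δ • ξ‖ ^ d / (1 + ‖δ • ξ‖) ^ (2 * d))

variable {C R δ s : ℝ} {k : Space d → ℝ}

lemma IsShellKernel.hasCompactSupport (h : IsShellKernel C R δ s k) : HasCompactSupport k := by
  refine HasCompactSupport.intro (isCompact_closedBall (0 : Space d) (s + R * δ)) fun x hx => ?_
  by_contra hne
  have := (abs_le.1 (h.supp x hne)).2
  simp only [mem_closedBall, dist_zero_right, not_le] at hx
  linarith

lemma IsShellKernel.isNice (h : IsShellKernel C R δ s k) : IsNice k :=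
  ⟨h.cont.integrable_of_hasCompactSupport h.hasCompactSupport, _, h.bdd⟩

lemma IsShellKernel.even (h : IsShellKernel C R δ s k) (x : Space d) : k (-x) = k x :=
  h.radial (LinearIsometryEquiv.neg ℝ) x

lemma IsShellKernel.eLpNorm_conv_le [hd : Fact (2 ≤ d)] (h : IsShellKernel C R δ s k) (hC : 0 ≤ C)
    (hδ : 0 < δ) {f : Space d → ℝ} (hf : IsNice f) :
    eLpNorm (conv k f) 2 volume ≤
      ENNReal.ofReal (C * δ ^ (((d : ℝ) - 1) / 2)) * eLpNorm f 2 volume := by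
  have := nontrivial_space hd.out
  refine SphericalMaximal.eLpNorm_conv_le h.isNice hf ?_
  have h0 : ∀ᵐ ξ : Space d, ξ ≠ 0 := by
    exact compl_mem_ae_iff.2 (measure_singleton (μ := (volume : Measure (Space d))) 0)
  filter_upwards [h0] with ξ hξ
  refine (h.fourier ξ hξ).trans ?_
  refine mul_le_of_le_one_right (by positivity) ?_
  rw [div_le_one (by positivity)]
  calc ‖δ • ξ‖ ^ d ≤ (1 + ‖δ • ξ‖) ^ d := by gcongr; linarith
    _ ≤ _ := pow_le_pow_right₀ (by linarith [norm_nonneg (δ • ξ)]) (by omega)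

lemma conv_continuous {k f : Space d → ℝ} (hk : Continuous k) (hc : HasCompactSupport k)
    (hf : Integrable f) : Continuous (conv k f) := by
  rw [conv_eq_convolution]
  exact hc.continuous_convolution_right _ hf.locallyIntegrable hk

/-- A radial function takes the same value at all points of the sphere of radius `‖x‖`. Averaging
Fourier inversion over that sphere replaces the exponential by the transform of `σ`, whose decay
then becomes available. -/
lemma eq_integral_rft_mul_sphereFourier [hd : Fact (2 ≤ d)] {K : Space d → ℝ} (hK : Continuous K)
    (hi : Integrable K) (hr : ∀ (L : Space d ≃ₗᵢ[ℝ] Space d) x, K (L x) = K x)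
    (hf : Integrable (rft K)) (x : Space d) :
    (K x : ℂ) = ∫ ξ, rft K ξ * sphereFourier (-‖x‖ • ξ) := by
  have hinv (z : Space d) : (K z : ℂ) = ∫ ξ, (𝐞 (inner ℝ ξ z) : ℂ) * rft K ξ := by
    have := congrFun ((Complex.continuous_ofReal.comp hK).fourierInv_fourier_eq hi.ofReal hf) z
    rw [Real.fourierInv_eq] at this
    exact this.symm
  have hsph (y : Sph d) : (K x : ℂ) = ∫ ξ, (𝐞 (-inner ℝ (y : Space d) (-‖x‖ • ξ)) : ℂ) * rft K ξ := by
    obtain ⟨L, hL⟩ := exists_isometry_map_eq (d := d) (v := x) (w := ‖x‖ • (y : Space d))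
      (by simp [norm_smul])
    rw [← hr L x, hL, hinv]
    congr 1; ext ξ
    rw [neg_smul, inner_neg_right, neg_neg, inner_smul_right, inner_smul_right, real_inner_comm]
  have h1 : (K x : ℂ) = ∫ y : Sph d, (K x : ℂ) ∂sigma d := by simp
  rw [h1]
  have h2 : ∫ y : Sph d, (K x : ℂ) ∂sigma d = ∫ y : Sph d,
      (∫ ξ, (𝐞 (-inner ℝ (y : Space d) (-‖x‖ • ξ)) : ℂ) * rft K ξ) ∂sigma d :=
    integral_congr_ae (ae_of_all _ hsph)
  rw [h2, integral_integral_swap]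
  · congr 1; ext ξ
    rw [integral_mul_const, mul_comm]
    rfl
  · have := (hf.comp_snd (sigma d))
    refine this.bdd_mul (f := fun p : Sph d × Space d =>
      (𝐞 (-inner ℝ (p.1 : Space d) (-‖x‖ • p.2)) : ℂ)) (c := 1) ?_ ?_
    · apply Continuous.aestronglyMeasurable
      have : Continuous fun p : Sph d × Space d => -inner ℝ (p.1 : Space d) (-‖x‖ • p.2) := by fun_prop
      exact continuous_subtype_val.comp (Real.continuous_fourierChar.comp this)
    · exact ae_of_all _ fun p => (Circle.norm_coe _).le

/-- On the Fourier side the composition has two factors `δ^((d-1)/2)` and is concentrated at `‖ξ‖ ≈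
1/δ`, where the transform of `σ` at `‖x‖ξ` supplies `(‖x‖/δ)^(-(d-1)/2)`. The volume `δ^(-d)` of
that region leaves the factor `δ⁻¹`. -/
lemma exists_conv_shellKernel_le_rpow [hd : Fact (2 ≤ d)] (hC : 0 ≤ C) :
    ∃ A, 0 ≤ A ∧ ∀ (R δ s s' : ℝ) (k k' : Space d → ℝ), 0 < δ → IsShellKernel C R δ s k →
      IsShellKernel C R δ s' k' → ∀ x ≠ 0, |conv k k' x| ≤
        A * (δ⁻¹ * (‖x‖ / δ) ^ (-(((d : ℝ) - 1) / 2))) := by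
  have := nontrivial_space hd.out
  have h2d : 2 ≤ d := hd.out
  obtain ⟨D, hD0, hD⟩ := exists_sphereFourier_decay (d := d)
  set I := ∫ ξ : Space d, (1 + ‖ξ‖) ^ (-(2 * d : ℝ))
  have hI₀ : Integrable (fun ξ : Space d => (1 + ‖ξ‖) ^ (-(2 * d : ℝ))) := by
    apply integrable_one_add_norm
    rw [finrank_euclideanSpace_fin]
    have : (2 : ℝ) ≤ d := by exact_mod_cast h2d
    linarith
  have hI0 : 0 ≤ I := integral_nonneg fun ξ => by positivity
  refine ⟨C ^ 2 * D * I, by positivity, ?_⟩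
  intro R δ s s' k k' hδ hk hk' x hx
  set a : ℝ := ((d : ℝ) - 1) / 2
  have ha0 : 0 ≤ a := by
    have : (2 : ℝ) ≤ d := by exact_mod_cast h2d
    simp only [a]; linarith
  have had : a ≤ d := by simp only [a]; linarith [(Nat.cast_nonneg d : (0 : ℝ) ≤ d)]
  have hrft (ξ) : rft (conv k k') ξ = rft k ξ * rft k' ξ := rft_conv hk.isNice.int hk'.isNice.int ξ
  have h0 : ∀ᵐ ξ : Space d, ξ ≠ 0 := by
    exact compl_mem_ae_iff.2 (measure_singleton (μ := (volume : Measure (Space d))) 0)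
  have hrft2 (ξ : Space d) (hξ : ξ ≠ 0) : ‖rft (conv k k') ξ‖ ≤
      C ^ 2 * δ ^ (2 * a) * (‖δ • ξ‖ ^ (2 * d) / (1 + ‖δ • ξ‖) ^ (4 * d)) := by
    rw [hrft, norm_mul]
    calc _ ≤ (C * δ ^ a * (‖δ • ξ‖ ^ d / (1 + ‖δ • ξ‖) ^ (2 * d))) *
          (C * δ ^ a * (‖δ • ξ‖ ^ d / (1 + ‖δ • ξ‖) ^ (2 * d))) :=
          mul_le_mul (hk.fourier ξ hξ) (hk'.fourier ξ hξ) (norm_nonneg _) (by positivity)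
      _ = C ^ 2 * (δ ^ a * δ ^ a) * (‖δ • ξ‖ ^ (2 * d) / (1 + ‖δ • ξ‖) ^ (4 * d)) := by
          rw [show 4 * d = 2 * d + 2 * d by ring, pow_add, two_mul d, pow_add]
          field_simp
          ring
      _ = _ := by rw [← Real.rpow_add hδ, two_mul a]
  have hI₁ : Integrable (fun ξ : Space d => (1 + ‖δ • ξ‖) ^ (-(2 * d : ℝ))) :=
    (integrable_comp_smul_iff volume _ hδ.ne').2 hI₀
  -- The zero of order `2d` at the origin absorbs the singularity `‖η‖^(-b)`, and the decay of order
  -- `4d` leaves an integrable majorant. The case `b = 0` serves Fourier inversion, the case `b =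
  -- (d-1)/2` the decay.
  have hpow (η : Space d) (b : ℝ) (hη : η ≠ 0) (hb0 : 0 ≤ b) (hb : b ≤ 2 * d) :
      ‖η‖ ^ (2 * d) / (1 + ‖η‖) ^ (4 * d) * ‖η‖ ^ (-b) ≤ (1 + ‖η‖) ^ (-(2 * d : ℝ)) := by
    have hn : 0 < ‖η‖ := norm_pos_iff.2 hη
    have h1 : ‖η‖ ^ (2 * d) * ‖η‖ ^ (-b) ≤ (1 + ‖η‖) ^ (2 * d : ℝ) := by
      rw [← Real.rpow_natCast, ← Real.rpow_add hn]
      push_cast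
      calc ‖η‖ ^ (2 * d + -b) ≤ (1 + ‖η‖) ^ (2 * d + -b) :=
            Real.rpow_le_rpow hn.le (by linarith) (by linarith)
        _ ≤ _ := Real.rpow_le_rpow_of_exponent_le (by linarith) (by linarith)
    calc ‖η‖ ^ (2 * d) / (1 + ‖η‖) ^ (4 * d) * ‖η‖ ^ (-b)
        = ‖η‖ ^ (2 * d) * ‖η‖ ^ (-b) / (1 + ‖η‖) ^ (4 * d) := by ring
      _ ≤ (1 + ‖η‖) ^ (2 * d : ℝ) / (1 + ‖η‖) ^ (4 * d) := by gcongr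
      _ = _ := by
        rw [← Real.rpow_natCast (1 + ‖η‖) (4 * d), ← Real.rpow_sub (by linarith)]
        congr 1; push_cast; ring
  have hfi : Integrable (rft (conv k k')) := by
    refine (hI₁.const_mul (C ^ 2 * δ ^ (2 * a))).mono' ?_ ?_
    · refine (VectorFourier.fourierIntegral_continuous Real.continuous_fourierChar
        (by exact continuous_inner) ((hk.isNice.conv hk'.isNice.int).int.ofReal (𝕜 := ℂ))).aestronglyMeasurable
    · filter_upwards [h0] with ξ hξ
      refine (hrft2 ξ hξ).trans ?_
      gcongr
      have := hpow (δ • ξ) 0 (by simp [hδ.ne', hξ]) le_rfl (by positivity)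
      simpa using this
  have hmain := eq_integral_rft_mul_sphereFourier (d := d)
    (conv_continuous hk.cont hk.hasCompactSupport hk'.isNice.int)
    (hk.isNice.conv hk'.isNice.int).int (conv_radial hk.radial hk'.radial) hfi x
  rw [← Real.norm_eq_abs, ← Complex.norm_real, hmain]
  have hxn : 0 < ‖x‖ := norm_pos_iff.2 hx
  have hbound : ∀ᵐ ξ : Space d, ‖rft (conv k k') ξ * sphereFourier (-‖x‖ • ξ)‖ ≤
      C ^ 2 * D * (δ ^ (2 * a) * (‖x‖ / δ) ^ (-a)) * (1 + ‖δ • ξ‖) ^ (-(2 * d : ℝ)) := by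
    filter_upwards [h0] with ξ hξ
    have hξn : 0 < ‖ξ‖ := norm_pos_iff.2 hξ
    have hδξ : δ • ξ ≠ 0 := by simp [hδ.ne', hξ]
    have hs := (hD (-‖x‖ • ξ) (by simp [hx, hξ])).1
    have hs2 : ‖-‖x‖ • ξ‖ = (‖x‖ / δ) * ‖δ • ξ‖ := by
      rw [norm_smul, norm_smul, norm_neg, norm_norm, Real.norm_of_nonneg hδ.le]
      field_simp
    rw [hs2, Real.mul_rpow (by positivity) (norm_nonneg _)] at hs
    rw [norm_mul]
    calc _ ≤ (C ^ 2 * δ ^ (2 * a) * (‖δ • ξ‖ ^ (2 * d) / (1 + ‖δ • ξ‖) ^ (4 * d))) *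
          (D * ((‖x‖ / δ) ^ (-a) * ‖δ • ξ‖ ^ (-a))) :=
          mul_le_mul (hrft2 ξ hξ) hs (norm_nonneg _) (by positivity)
      _ = C ^ 2 * D * (δ ^ (2 * a) * (‖x‖ / δ) ^ (-a)) *
          (‖δ • ξ‖ ^ (2 * d) / (1 + ‖δ • ξ‖) ^ (4 * d) * ‖δ • ξ‖ ^ (-a)) := by ring
      _ ≤ _ := by
        gcongr
        exact hpow _ a hδξ ha0 (by linarith [(Nat.cast_nonneg d : (0 : ℝ) ≤ d)])
  refine (norm_integral_le_of_norm_le (hI₁.const_mul _) hbound).trans (le_of_eq ?_)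
  rw [integral_const_mul]
  have hsc := Measure.integral_comp_smul_of_nonneg (volume : Measure (Space d))
    (fun ξ => (1 + ‖ξ‖) ^ (-(2 * d : ℝ))) δ (hR := hδ.le)
  rw [hsc, finrank_euclideanSpace_fin, smul_eq_mul]
  have hδe : δ ^ (2 * a) * (δ ^ d)⁻¹ = δ⁻¹ := by
    rw [← Real.rpow_natCast, ← Real.rpow_neg hδ.le, ← Real.rpow_add hδ, ← Real.rpow_neg_one]
    congr 1; simp only [a]; ring
  rw [← hδe]
  ring

/-- The kernel of the composition of two operators given by shell kernels decays with the distance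
of the radii. -/
lemma exists_conv_shellKernel_le [hd : Fact (2 ≤ d)] (hC : 0 ≤ C) (hR : 0 ≤ R) :
    ∃ A, 0 ≤ A ∧ ∀ (δ s s' ρ : ℝ) (k k' : Space d → ℝ), 0 < δ → IsShellKernel C R δ s k →
      IsShellKernel C R δ s' k' → 1 ≤ ρ → (ρ - 2) * δ ≤ |s - s'| → ∀ x, |conv k k' x| ≤
        A * (δ⁻¹ * ρ ^ (-(((d : ℝ) - 1) / 2))) := by
  obtain ⟨A, hA0, hA⟩ := exists_conv_shellKernel_le_rpow (d := d) hC
  set a : ℝ := ((d : ℝ) - 1) / 2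
  have ha0 : 0 ≤ a := by
    have : (2 : ℝ) ≤ d := by exact_mod_cast hd.out
    simp only [a]; linarith
  refine ⟨C ^ 2 * (4 * R + 4) ^ a + A * 2 ^ a, by positivity, ?_⟩
  intro δ s s' ρ k k' hδ hk hk' hρ hs x
  have hρ0 : 0 < ρ := by linarith
  have hρa : 0 < ρ ^ (-a) := by positivity
  -- For bounded `ρ` the trivial bound by height times L¹ norm is enough. For large `ρ` the supports
  -- of the two shells force `‖x‖ ≥ (ρ - 2 - 2R) δ ≥ ρ δ / 2`, and the decay in `‖x‖` applies.
  rcases le_total ρ (4 * R + 4) with h | h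
  · have h1 : |conv k k' x| ≤ C * δ⁻¹ * C :=
      (abs_conv_le hk.bdd hk'.isNice.int x).trans
        (mul_le_mul_of_nonneg_left hk'.l1 (by positivity))
    have h2 : 1 ≤ (4 * R + 4) ^ a * ρ ^ (-a) := by
      rw [Real.rpow_neg hρ0.le, ← div_eq_mul_inv, le_div_iff₀ (by positivity), one_mul]
      exact Real.rpow_le_rpow hρ0.le h ha0
    calc |conv k k' x| ≤ C ^ 2 * δ⁻¹ * 1 := h1.trans (le_of_eq (by ring))
      _ ≤ C ^ 2 * δ⁻¹ * ((4 * R + 4) ^ a * ρ ^ (-a)) := by gcongr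
      _ ≤ _ := by
        have : 0 ≤ A * 2 ^ a * (δ⁻¹ * ρ ^ (-a)) := by positivity
        linarith
  · rcases eq_or_ne (conv k k' x) 0 with h0 | h0
    · rw [h0, abs_zero]; positivity
    have hex : ∃ y, k (x - y) * k' y ≠ 0 := by
      by_contra! hc
      exact h0 (by simp [conv, hc])
    obtain ⟨y, hy⟩ := hex
    have y1 := hk.supp _ (left_ne_zero_of_mul hy)
    have y2 := hk'.supp _ (right_ne_zero_of_mul hy)
    have hxl : ρ * δ / 2 ≤ ‖x‖ := by
      have t1 : |‖x - y‖ - ‖y‖| ≤ ‖x‖ := by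
        rw [abs_le]
        have e1 := norm_sub_le x y
        have e2 : ‖y‖ ≤ ‖x - y‖ + ‖x‖ := by
          have := norm_sub_le x (x - y)
          rw [sub_sub_cancel] at this; linarith
        constructor <;> linarith
      have t2 : |s - s'| ≤ |‖x - y‖ - ‖y‖| + R * δ + R * δ := by
        have : s - s' = (‖x - y‖ - ‖y‖) - (‖x - y‖ - s) + (‖y‖ - s') := by ring
        rw [this]
        refine (abs_add_le _ _).trans ?_
        have := abs_sub (‖x - y‖ - ‖y‖) (‖x - y‖ - s)
        linarith
      nlinarith
    have hx0 : x ≠ 0 := by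
      rintro rfl
      rw [norm_zero] at hxl
      have : 0 < ρ * δ / 2 := by positivity
      linarith
    refine (hA R δ s s' k k' hδ hk hk' x hx0).trans ?_
    have h3 : (‖x‖ / δ) ^ (-a) ≤ 2 ^ a * ρ ^ (-a) := by
      have : 2 ^ a * ρ ^ (-a) = (ρ / 2) ^ (-a) := by
        rw [Real.div_rpow hρ0.le (by norm_num), Real.rpow_neg (by norm_num : (0:ℝ) ≤ 2)]
        field_simp
      rw [this]
      refine Real.rpow_le_rpow_of_nonpos (by positivity) ?_ (by linarith)
      rw [le_div_iff₀ hδ]; linarith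
    calc A * (δ⁻¹ * (‖x‖ / δ) ^ (-a)) ≤ A * (δ⁻¹ * (2 ^ a * ρ ^ (-a))) := by gcongr
      _ ≤ _ := by
        have : 0 ≤ C ^ 2 * (4 * R + 4) ^ a * (δ⁻¹ * ρ ^ (-a)) := by positivity
        linarith

end ShellKernel

/-! ### Mollified spherical measures and their radial derivatives as shell kernels. -/

section ShellProfile

variable {d : ℕ}

/-- A profile function for kernels concentrated near a sphere. -/
structure IsShellProfile (M R : ℝ) (Θ : Sph d → Space d → ℝ) : Prop where
  cont : Continuous (Function.uncurry Θ)
  bdd : ∀ y z, |Θ y z| ≤ M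
  supp : ∀ y z, Θ y z ≠ 0 → ‖z‖ ≤ R
  equivariant : ∀ (L : Space d ≃ₗᵢ[ℝ] Space d) y z, Θ (sphereMap L y) (L z) = Θ y z

/-- The kernel obtained by placing the rescaled profile at the points of the sphere of radius `s`. -/
noncomputable def shellK (Θ : Sph d → Space d → ℝ) (δ s : ℝ) (x : Space d) : ℝ :=
  ∫ y : Sph d, δ⁻¹ ^ d * Θ y (δ⁻¹ • (x - s • (y : Space d))) ∂sigma d

variable {M R δ s : ℝ} {Θ : Sph d → Space d → ℝ}

lemma IsShellProfile.continuous_uncurry [Fact (2 ≤ d)] (h : IsShellProfile M R Θ) (δ : ℝ) :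
    Continuous (fun p : ℝ × Space d => shellK Θ δ p.1 p.2) := by
  have hc : Continuous (fun q : (ℝ × Space d) × Sph d =>
      δ⁻¹ ^ d * Θ q.2 (δ⁻¹ • (q.1.2 - q.1.1 • (q.2 : Space d)))) :=
    continuous_const.mul (h.cont.comp (f := fun q : (ℝ × Space d) × Sph d =>
      (q.2, δ⁻¹ • (q.1.2 - q.1.1 • (q.2 : Space d)))) (by fun_prop))
  have := continuous_parametric_integral_of_continuous (μ := sigma d)
    (f := fun (p : ℝ × Space d) (y : Sph d) => δ⁻¹ ^ d * Θ y (δ⁻¹ • (p.2 - p.1 • (y : Space d))))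
    hc isCompact_univ
  simp only [Measure.restrict_univ] at this
  exact this

lemma IsShellProfile.continuous [Fact (2 ≤ d)] (h : IsShellProfile M R Θ) (δ s : ℝ) :
    Continuous (shellK Θ δ s) :=
  (h.continuous_uncurry δ).comp (Continuous.prodMk_right s)

lemma IsShellProfile.shellK_radial (h : IsShellProfile M R Θ) (δ s : ℝ)
    (L : Space d ≃ₗᵢ[ℝ] Space d) (x : Space d) : shellK Θ δ s (L x) = shellK Θ δ s x := by
  have := integral_sphere_comp L (fun y : Sph d => δ⁻¹ ^ d * Θ y (δ⁻¹ • (L x - s • (y : Space d))))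
    (continuous_const.mul (h.cont.comp (f := fun y : Sph d =>
      (y, δ⁻¹ • (L x - s • (y : Space d)))) (by fun_prop)))
  rw [shellK, ← this, shellK]
  congr 1; ext y
  rw [← h.equivariant L y]
  simp [sphereMap]

lemma IsShellProfile.shellK_supp (h : IsShellProfile M R Θ) (hδ : 0 < δ) (hs : 0 ≤ s) (x : Space d)
    (hx : shellK Θ δ s x ≠ 0) : |‖x‖ - s| ≤ R * δ := by
  have : ∃ y : Sph d, Θ y (δ⁻¹ • (x - s • (y : Space d))) ≠ 0 := by
    by_contra! hc
    exact hx (by simp [shellK, hc])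
  obtain ⟨y, hy⟩ := this
  have h1 := h.supp _ _ hy
  rw [norm_smul, norm_inv, Real.norm_of_nonneg hδ.le, inv_mul_le_iff₀ hδ] at h1
  have h2 := abs_norm_sub_norm_le x (s • (y : Space d))
  rw [norm_smul, norm_eq_of_mem_sphere, mul_one, Real.norm_of_nonneg hs] at h2
  linarith

/-- Only `y` in a cap of radius `2Rδ` contribute, because `s ≥ 1/2`. The measure `O(δ^(d-1))` of the
cap meets the height `δ^(-d)` of the rescaled profile. -/
lemma exists_shellK_bdd [hd : Fact (2 ≤ d)] (hM : 0 ≤ M) (hR : 0 < R) : ∃ C, 0 ≤ C ∧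
    ∀ (Θ : Sph d → Space d → ℝ) (δ s : ℝ), IsShellProfile M R Θ → 0 < δ → 1 / 2 ≤ s →
      ∀ x, |shellK Θ δ s x| ≤ C * δ⁻¹ := by
  obtain ⟨A, hA0, hA⟩ := exists_sigma_ball_le (d := d)
  refine ⟨M * A * (2 * R) ^ (d - 1), by positivity, ?_⟩
  intro Θ δ s h hδ hs x
  have hs0 : 0 < s := by linarith
  set S : Set (Sph d) := {y | ‖s⁻¹ • x - (y : Space d)‖ ≤ 2 * R * δ}
  have hS : MeasurableSet S := (isClosed_le (by fun_prop) continuous_const).measurableSet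
  have hpt (y : Sph d) : |δ⁻¹ ^ d * Θ y (δ⁻¹ • (x - s • (y : Space d)))| ≤
      S.indicator (fun _ => δ⁻¹ ^ d * M) y := by
    by_cases hy : y ∈ S
    · rw [indicator_of_mem hy, abs_mul, abs_of_nonneg (by positivity)]
      gcongr
      exact h.bdd _ _
    · rw [indicator_of_notMem hy]
      have : Θ y (δ⁻¹ • (x - s • (y : Space d))) = 0 := by
        by_contra hne
        have h1 := h.supp _ _ hne
        rw [norm_smul, norm_inv, Real.norm_of_nonneg hδ.le, inv_mul_le_iff₀ hδ] at h1
        apply hy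
        have e : x - s • (y : Space d) = s • (s⁻¹ • x - (y : Space d)) := by
          rw [smul_sub, smul_smul, mul_inv_cancel₀ hs0.ne', one_smul]
        rw [e, norm_smul, Real.norm_of_nonneg hs0.le] at h1
        simp only [S, mem_ofPred_eq]
        nlinarith [norm_nonneg (s⁻¹ • x - (y : Space d))]
      simp [this]
  have h1 : |shellK Θ δ s x| ≤ ∫ y, S.indicator (fun _ => δ⁻¹ ^ d * M) y ∂sigma d := by
    rw [shellK, ← Real.norm_eq_abs]
    exact norm_integral_le_of_norm_le ((integrable_const _).indicator hS) (ae_of_all _ hpt)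
  rw [integral_indicator_const _ hS, smul_eq_mul] at h1
  refine h1.trans ?_
  have h2 := hA (s⁻¹ • x) (2 * R * δ) (by positivity)
  calc (sigma d).real S * (δ⁻¹ ^ d * M) ≤ A * (2 * R * δ) ^ (d - 1) * (δ⁻¹ ^ d * M) := by gcongr
    _ = M * A * (2 * R) ^ (d - 1) * (δ ^ (d - 1) * δ⁻¹ ^ d) := by rw [mul_pow]; ring
    _ = _ := by
      congr 1
      have : δ⁻¹ ^ d = δ⁻¹ ^ (d - 1) * δ⁻¹ := by
        rw [← pow_succ, Nat.sub_add_cancel (by have := hd.out; omega)]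
      rw [this, ← mul_assoc, ← mul_pow, mul_inv_cancel₀ hδ.ne', one_pow, one_mul]

lemma IsShellProfile.integrable_prod [Fact (2 ≤ d)] (h : IsShellProfile M R Θ) (hδ : 0 < δ) (s : ℝ) :
    Integrable (fun p : Sph d × Space d => δ⁻¹ ^ d * Θ p.1 (δ⁻¹ • (p.2 - s • (p.1 : Space d))))
      ((sigma d).prod volume) := by
  refine Continuous.integrable_of_hasCompactSupport ?_ ?_
  · exact continuous_const.mul (h.cont.comp (f := fun p : Sph d × Space d =>
      (p.1, δ⁻¹ • (p.2 - s • (p.1 : Space d)))) (by fun_prop))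
  · refine HasCompactSupport.intro (isCompact_univ.prod
      (isCompact_closedBall (0 : Space d) (|s| + R * δ))) ?_
    rintro ⟨y, x⟩ hx
    simp only [mem_prod, mem_univ, true_and, mem_closedBall, dist_zero_right, not_le] at hx
    have : Θ y (δ⁻¹ • (x - s • (y : Space d))) = 0 := by
      by_contra hne
      have h1 := h.supp _ _ hne
      rw [norm_smul, norm_inv, Real.norm_of_nonneg hδ.le, inv_mul_le_iff₀ hδ] at h1
      have h2 := norm_sub_norm_le x (s • (y : Space d))
      rw [norm_smul, norm_eq_of_mem_sphere, mul_one, Real.norm_eq_abs] at h2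
      linarith
    simp [this]

lemma integral_rescaled_translate (F : Space d → ℝ) (hδ : 0 < δ) (v : Space d) :
    ∫ x, δ⁻¹ ^ d * F (δ⁻¹ • (x - v)) = ∫ z, F z := by
  rw [integral_sub_right_eq_self (fun x => δ⁻¹ ^ d * F (δ⁻¹ • x)) v, integral_const_mul,
    Measure.integral_comp_smul_of_nonneg _ _ _ (hR := by positivity), finrank_euclideanSpace_fin,
    smul_eq_mul, ← mul_assoc, mul_inv_cancel₀ (by positivity), one_mul]

lemma IsShellProfile.integral_abs_shellK_le [Fact (2 ≤ d)] (h : IsShellProfile M R Θ) (hδ : 0 < δ)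
    (s : ℝ) : ∫ x, |shellK Θ δ s x| ≤ M * volume.real (closedBall (0 : Space d) R) := by
  have hi := h.integrable_prod hδ s
  have h1 : ∫ x, |shellK Θ δ s x| ≤ ∫ x, ∫ y : Sph d, |δ⁻¹ ^ d * Θ y (δ⁻¹ • (x - s • (y : Space d)))|
      ∂sigma d := by
    refine integral_mono_of_nonneg (ae_of_all _ fun x => abs_nonneg _) hi.swap.norm.integral_prod_left
      (ae_of_all _ fun x => ?_)
    exact norm_integral_le_integral_norm (μ := sigma d)
      (fun y : Sph d => δ⁻¹ ^ d * Θ y (δ⁻¹ • (x - s • (y : Space d))))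
  refine h1.trans ?_
  rw [integral_integral_swap (f := fun x (y : Sph d) => |δ⁻¹ ^ d * Θ y (δ⁻¹ • (x - s • (y : Space d)))|)
    hi.swap.norm]
  have h2 (y : Sph d) : ∫ x, |δ⁻¹ ^ d * Θ y (δ⁻¹ • (x - s • (y : Space d)))| ≤
      M * volume.real (closedBall (0 : Space d) R) := by
    have : ∀ x, |δ⁻¹ ^ d * Θ y (δ⁻¹ • (x - s • (y : Space d)))| =
        δ⁻¹ ^ d * |Θ y (δ⁻¹ • (x - s • (y : Space d)))| := fun x => by
      rw [abs_mul, abs_of_nonneg (by positivity)]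
    simp_rw [this]
    rw [integral_rescaled_translate (fun z => |Θ y z|) hδ]
    have h3 : ∫ z, |Θ y z| ≤ ∫ z, (closedBall (0 : Space d) R).indicator (fun _ => M) z := by
      refine integral_mono_of_nonneg (ae_of_all _ fun x => abs_nonneg _) ?_ (ae_of_all _ fun z => ?_)
      · exact (integrable_indicator_iff measurableSet_closedBall).2
          (integrableOn_const measure_closedBall_lt_top.ne)
      · by_cases hz : Θ y z = 0
        · simp only [hz, abs_zero]
          exact indicator_nonneg (fun _ _ => (abs_nonneg _).trans (h.bdd y z)) z
        · rw [indicator_of_mem (by simpa using h.supp y z hz)]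
          exact h.bdd y z
    refine h3.trans (le_of_eq ?_)
    rw [integral_indicator_const _ measurableSet_closedBall, smul_eq_mul, mul_comm]
  refine (integral_mono_of_nonneg (ae_of_all _ fun y => integral_nonneg fun x => abs_nonneg _)
    (integrable_const _) (ae_of_all _ h2)).trans (le_of_eq ?_)
  simp

lemma rft_rescaled_translate (F : Space d → ℝ) (hδ : 0 < δ) (v ξ : Space d) :
    ∫ x, (𝐞 (-inner ℝ x ξ) : ℂ) * ((δ⁻¹ ^ d * F (δ⁻¹ • (x - v)) : ℝ) : ℂ) =
      (𝐞 (-inner ℝ v ξ) : ℂ) * rft F (δ • ξ) := by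
  have h1 := rft_dilate F (s := δ⁻¹) (by positivity) ξ
  rw [inv_inv] at h1
  rw [← h1, rft_apply, ← integral_const_mul,
    ← integral_sub_right_eq_self (fun x => _ * ((𝐞 (-inner ℝ x ξ) : ℂ) * _)) v]
  congr 1; ext x
  rw [← mul_assoc, ← Circle.coe_mul, ← AddChar.map_add_eq_mul, inner_sub_left]
  congr 3; ring

lemma IsShellProfile.rft_shellK [Fact (2 ≤ d)] (h : IsShellProfile M R Θ) (hδ : 0 < δ)
    (s : ℝ) (ξ : Space d) : rft (shellK Θ δ s) ξ =
      ∫ y : Sph d, (𝐞 (-inner ℝ (y : Space d) (s • ξ)) : ℂ) * rft (Θ y) (δ • ξ) ∂sigma d := by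
  have hi := h.integrable_prod hδ s
  have e1 (x : Space d) : (𝐞 (-inner ℝ x ξ) : ℂ) * (shellK Θ δ s x : ℂ) = ∫ y : Sph d,
      (𝐞 (-inner ℝ x ξ) : ℂ) * ((δ⁻¹ ^ d * Θ y (δ⁻¹ • (x - s • (y : Space d))) : ℝ) : ℂ) ∂sigma d := by
    rw [integral_const_mul, integral_complex_ofReal, shellK]
  have e2 : rft (shellK Θ δ s) ξ = ∫ x, ∫ y : Sph d,
      (𝐞 (-inner ℝ x ξ) : ℂ) * ((δ⁻¹ ^ d * Θ y (δ⁻¹ • (x - s • (y : Space d))) : ℝ) : ℂ) ∂sigma d := by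
    rw [rft_apply]
    exact integral_congr_ae (ae_of_all _ e1)
  rw [e2, integral_integral_swap]
  · congr 1; ext y
    rw [rft_rescaled_translate (Θ y) hδ, inner_smul_left, inner_smul_right]
    rfl
  · refine hi.swap.ofReal.bdd_mul (f := fun p : Space d × Sph d => (𝐞 (-inner ℝ p.1 ξ) : ℂ))
      (c := 1) ?_ (ae_of_all _ fun p => (Circle.norm_coe _).le)
    apply Continuous.aestronglyMeasurable
    have : Continuous fun p : Space d × Sph d => -inner ℝ p.1 ξ := by fun_prop
    exact continuous_subtype_val.comp (Real.continuous_fourierChar.comp this)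

/-- The profile of a frequency localized spherical mean. -/
def meanProfile (ψ : Space d → ℝ) : Sph d → Space d → ℝ := fun _ z => ψ z

/-- The profile of the radial derivative of a frequency localized spherical mean. -/
noncomputable def derivProfile (ψ : Space d → ℝ) : Sph d → Space d → ℝ :=
  fun y z => -(fderiv ℝ ψ z (y : Space d))

lemma IsRadialTest.exists_isShellProfile {ψ : Space d → ℝ} (h : IsRadialTest ψ) :
    ∃ M R, 0 ≤ M ∧ 0 < R ∧ IsShellProfile M R (meanProfile ψ) ∧
      IsShellProfile M R (derivProfile ψ) := by
  have hd := h.smooth.continuous_fderiv (by simp)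
  have hd2 : HasCompactSupport (fderiv ℝ ψ) := h.compact.fderiv ℝ
  obtain ⟨M₁, hM₁⟩ := h.compact.exists_bound_of_continuous h.smooth.continuous
  obtain ⟨M₂, hM₂⟩ := hd2.exists_bound_of_continuous hd
  obtain ⟨R₁, hR₁⟩ := h.compact.isBounded.exists_norm_le
  obtain ⟨R₂, hR₂⟩ := hd2.isBounded.exists_norm_le
  refine ⟨max M₁ M₂, max (max R₁ R₂) 1, ?_, by positivity, ⟨?_, ?_, ?_, ?_⟩, ⟨?_, ?_, ?_, ?_⟩⟩
  · exact ((norm_nonneg _).trans (hM₁ 0)).trans (le_max_left _ _)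
  · exact h.smooth.continuous.comp continuous_snd
  · exact fun y z => (hM₁ z).trans (le_max_left _ _)
  · exact fun y z hz => (hR₁ z (subset_tsupport _ hz)).trans ((le_max_left _ _).trans (le_max_left _ _))
  · exact fun L y z => h.radial L z
  · exact ((hd.comp continuous_snd).clm_apply (continuous_subtype_val.comp continuous_fst)).neg
  · intro y z
    rw [derivProfile, abs_neg, ← Real.norm_eq_abs]
    refine ((fderiv ℝ ψ z).le_opNorm _).trans ?_
    rw [norm_eq_of_mem_sphere, mul_one]
    exact (hM₂ z).trans (le_max_right _ _)
  · intro y z hz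
    refine (hR₂ z (subset_tsupport _ fun h0 => hz ?_)).trans
      ((le_max_right _ _).trans (le_max_left _ _))
    simp [derivProfile, h0]
  · intro L y z
    -- Equivariance of the derivative comes from differentiating the invariance of `ψ`.
    have h1 : ψ = ψ ∘ L := by ext x; exact (h.radial L x).symm
    have h2 : fderiv ℝ ψ z = (fderiv ℝ ψ (L z)).comp (L : Space d →L[ℝ] Space d) := by
      conv_lhs => rw [h1]
      rw [fderiv_comp z ((h.smooth.differentiable (by simp)) _) L.differentiableAt]
      congr 1
      exact L.fderiv
    simp only [derivProfile, h2, sphereMap]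
    rfl

lemma rft_derivProfile {ψ : Space d → ℝ} (h : IsRadialTest ψ) (y : Sph d) (η : Space d) :
    rft (derivProfile ψ y) η = -(2 * π * Complex.I) * (inner ℝ (y : Space d) η : ℝ) * rft ψ η := by
  have hd := h.smooth.continuous_fderiv (by simp)
  set f : Space d → ℂ := fun x => (ψ x : ℂ)
  have hfd (z) : HasFDerivAt f (Complex.ofRealCLM.comp (fderiv ℝ ψ z)) z :=
    Complex.ofRealCLM.hasFDerivAt.comp z
      ((h.smooth.differentiable (by simp)) z).hasFDerivAt
  have hfe : fderiv ℝ f = fun z => Complex.ofRealCLM.comp (fderiv ℝ ψ z) := by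
    ext1 z; exact (hfd z).fderiv
  have hfi : Integrable (fderiv ℝ f) := by
    rw [hfe]
    refine Continuous.integrable_of_hasCompactSupport (by fun_prop) ?_
    exact (h.compact.fderiv ℝ).comp_left (g := fun T => Complex.ofRealCLM.comp T) (by simp)
  have h1 := Real.fourier_fderiv (f := f) h.integrable.ofReal (fun z => (hfd z).differentiableAt) hfi
  have h2 := congrArg (fun T : Space d →L[ℝ] ℂ => T (y : Space d)) (congrFun h1 η)
  simp only [VectorFourier.fourierSMulRight_apply] at h2
  rw [Real.fourier_continuousLinearMap_apply hfi] at h2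
  have h3 : rft (derivProfile ψ y) η = -𝓕 (fun x => fderiv ℝ f x (y : Space d)) η := by
    rw [rft_apply, Real.fourier_eq, ← integral_neg]
    congr 1; ext z
    rw [hfe]
    simp [derivProfile, Circle.smul_def]
  rw [h3, h2]
  have h4 : (-innerSL ℝ) η (y : Space d) = -inner ℝ (y : Space d) η := by
    rw [real_inner_comm]; rfl
  have h5 : 𝓕 f η = rft ψ η := rfl
  rw [h4, h5]
  simp only [smul_eq_mul, Complex.real_smul, Complex.ofReal_neg]
  ring

/-- Frequency localized spherical means and their normalized radial derivatives are given by shell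
kernels with uniform constants. -/
lemma exists_isShellKernel [hd : Fact (2 ≤ d)] {ψ : Space d → ℝ} (h : IsRadialTest ψ)
    (hψ : ∃ C, 0 ≤ C ∧ ∀ ξ, ‖rft ψ ξ‖ * (1 + ‖ξ‖) ^ (3 * d + 1) ≤ C * ‖ξ‖ ^ (2 * d)) :
    ∃ C R, 0 ≤ C ∧ 0 ≤ R ∧ ∀ δ s : ℝ, 0 < δ → 1 / 2 ≤ s →
      IsShellKernel C R δ s (shellK (meanProfile ψ) δ s) ∧
      IsShellKernel C R δ s (shellK (derivProfile ψ) δ s) := by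
  obtain ⟨P, hP0, hP⟩ := hψ
  obtain ⟨M, R, hM0, hR0, hm, hdp⟩ := h.exists_isShellProfile
  obtain ⟨B, hB0, hB⟩ := exists_shellK_bdd (d := d) hM0 hR0
  obtain ⟨D, hD0, hD⟩ := exists_sphereFourier_decay (d := d)
  set a : ℝ := ((d : ℝ) - 1) / 2
  have h2d : (2 : ℝ) ≤ d := by exact_mod_cast hd.out
  have ha0 : 0 ≤ a := by simp only [a]; linarith
  have had : a ≤ d := by simp only [a]; linarith
  set Q : ℝ := 2 * π * D * 2 ^ a * P
  set V := M * volume.real (closedBall (0 : Space d) R)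
  have hQ0 : 0 ≤ Q := by positivity
  have hV0 : 0 ≤ V := by positivity
  -- Half of the `2d` orders of vanishing of `ψ̂` absorb the singularity `‖η‖^(-a)`; the other `d`
  -- remain in the bound. The factor `1 + ‖δ • ξ‖` on the left covers the mean and its derivative at
  -- once.
  have key (δ s : ℝ) (hδ : 0 < δ) (hs : 1 / 2 ≤ s) (ξ : Space d) (hξ : ξ ≠ 0) :
      2 * π * D * ‖s • ξ‖ ^ (-a) * (1 + ‖δ • ξ‖) * ‖rft ψ (δ • ξ)‖ ≤
        Q * δ ^ a * (‖δ • ξ‖ ^ d / (1 + ‖δ • ξ‖) ^ (2 * d)) := by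
    have hs0 : 0 < s := by linarith
    set η := δ • ξ
    have hη : 0 < ‖η‖ := norm_pos_iff.2 (by simp [η, hδ.ne', hξ])
    have e1 : ‖s • ξ‖ ^ (-a) ≤ 2 ^ a * δ ^ a * ‖η‖ ^ (-a) := by
      have : ‖s • ξ‖ = s * δ⁻¹ * ‖η‖ := by
        rw [norm_smul, norm_smul, Real.norm_of_nonneg hδ.le, Real.norm_of_nonneg hs0.le]
        field_simp
      rw [this, Real.mul_rpow (by positivity) (by positivity), Real.mul_rpow (by positivity) (by positivity)]
      gcongr
      · rw [Real.rpow_neg hs0.le, ← Real.inv_rpow hs0.le]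
        refine Real.rpow_le_rpow (by positivity) ?_ ha0
        rw [inv_le_comm₀ hs0 (by norm_num)]
        linarith
      · rw [Real.rpow_neg (by positivity), Real.inv_rpow hδ.le, inv_inv]
    have e2 : ‖rft ψ η‖ ≤ P * ‖η‖ ^ (2 * d) / (1 + ‖η‖) ^ (3 * d + 1) := by
      rw [le_div_iff₀ (by positivity)]
      exact hP η
    have e3 : ‖η‖ ^ (-a) * ‖η‖ ^ d ≤ (1 + ‖η‖) ^ d := by
      rw [← Real.rpow_natCast, ← Real.rpow_add hη, ← Real.rpow_natCast]
      calc ‖η‖ ^ (-a + d) ≤ (1 + ‖η‖) ^ (-a + d) :=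
            Real.rpow_le_rpow hη.le (by linarith) (by linarith)
        _ ≤ _ := Real.rpow_le_rpow_of_exponent_le (by linarith) (by linarith)
    calc 2 * π * D * ‖s • ξ‖ ^ (-a) * (1 + ‖η‖) * ‖rft ψ η‖
        ≤ 2 * π * D * (2 ^ a * δ ^ a * ‖η‖ ^ (-a)) * (1 + ‖η‖) *
          (P * ‖η‖ ^ (2 * d) / (1 + ‖η‖) ^ (3 * d + 1)) := by gcongr
      _ = Q * δ ^ a * (‖η‖ ^ d * (‖η‖ ^ (-a) * ‖η‖ ^ d) / (1 + ‖η‖) ^ (3 * d)) := by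
          rw [pow_succ, two_mul d, pow_add]
          simp only [Q]
          field_simp
      _ ≤ Q * δ ^ a * (‖η‖ ^ d * (1 + ‖η‖) ^ d / (1 + ‖η‖) ^ (3 * d)) := by gcongr
      _ = _ := by
          rw [show 3 * d = 2 * d + d by ring, pow_add]
          field_simp
  refine ⟨max (max B V) Q, R, by positivity, hR0.le, fun δ s hδ hs => ?_⟩
  have hs0 : 0 < s := by linarith
  have hBC : B ≤ max (max B V) Q := (le_max_left _ _).trans (le_max_left _ _)
  have hVC : V ≤ max (max B V) Q := (le_max_right _ _).trans (le_max_left _ _)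
  have hQC : Q ≤ max (max B V) Q := le_max_right _ _
  have hfin (ξ : Space d) (w : ℂ) (hw : ‖w‖ ≤ Q * δ ^ a * (‖δ • ξ‖ ^ d / (1 + ‖δ • ξ‖) ^ (2 * d))) :
      ‖w‖ ≤ max (max B V) Q * δ ^ a * (‖δ • ξ‖ ^ d / (1 + ‖δ • ξ‖) ^ (2 * d)) := by
    refine hw.trans ?_
    gcongr
  constructor
  · refine ⟨hm.continuous δ s, hm.shellK_radial δ s, hm.shellK_supp hδ hs0.le,
      (hm.integral_abs_shellK_le hδ s).trans hVC, fun x => (hB _ δ s hm hδ hs x).trans (by gcongr),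
      fun ξ hξ => hfin ξ _ ((le_trans ?_ (key δ s hδ hs ξ hξ)))⟩
    rw [hm.rft_shellK hδ]
    have e : ∫ y : Sph d, (𝐞 (-inner ℝ (y : Space d) (s • ξ)) : ℂ) * rft (meanProfile ψ y) (δ • ξ)
        ∂sigma d = sphereFourier (s • ξ) * rft ψ (δ • ξ) := by
      exact integral_mul_const (μ := sigma d) (rft ψ (δ • ξ))
        (fun y : Sph d => (𝐞 (-inner ℝ (y : Space d) (s • ξ)) : ℂ))
    rw [e, norm_mul]
    gcongr
    refine (hD (s • ξ) (by simp [hs0.ne', hξ])).1.trans ?_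
    have p1 : 1 ≤ 2 * π := by nlinarith [pi_gt_three]
    calc D * ‖s • ξ‖ ^ (-a) = 1 * D * ‖s • ξ‖ ^ (-a) * 1 := by ring
      _ ≤ _ := by
        gcongr
        linarith [norm_nonneg (δ • ξ)]
  · refine ⟨hdp.continuous δ s, hdp.shellK_radial δ s, hdp.shellK_supp hδ hs0.le,
      (hdp.integral_abs_shellK_le hδ s).trans hVC, fun x => (hB _ δ s hdp hδ hs x).trans (by gcongr),
      fun ξ hξ => hfin ξ _ ((le_trans ?_ (key δ s hδ hs ξ hξ)))⟩
    rw [hdp.rft_shellK hδ]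
    -- The growth `‖s • ξ‖` of `sphereFourierDeriv` is compensated by the normalising factor `δ /
    -- s`: together they give `‖δ • ξ‖`, which the decay of `ψ̂` controls.
    have e : ∫ y : Sph d, (𝐞 (-inner ℝ (y : Space d) (s • ξ)) : ℂ) * rft (derivProfile ψ y) (δ • ξ)
        ∂sigma d = -(2 * π * Complex.I) * ((δ / s : ℝ) : ℂ) * sphereFourierDeriv (s • ξ) *
          rft ψ (δ • ξ) := by
      rw [sphereFourierDeriv, ← integral_const_mul, ← integral_mul_const]
      congr 1; ext y
      rw [rft_derivProfile h]
      have : (inner ℝ (y : Space d) (δ • ξ) : ℝ) = δ / s * inner ℝ (y : Space d) (s • ξ) := by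
        rw [inner_smul_right, inner_smul_right]; field_simp
      rw [this]
      push_cast
      ring
    rw [e, norm_mul, norm_mul, norm_mul]
    refine mul_le_mul_of_nonneg_right ?_ (norm_nonneg _)
    have hn : ‖-(2 * π * Complex.I)‖ = 2 * π := by
      simp [abs_of_pos pi_pos]
    rw [hn, Complex.norm_real, Real.norm_of_nonneg (by positivity : (0 : ℝ) ≤ δ / s)]
    have h4 := (hD (s • ξ) (by simp [hs0.ne', hξ])).2
    have h5 : δ / s * ‖s • ξ‖ = ‖δ • ξ‖ := by
      rw [norm_smul, norm_smul, Real.norm_of_nonneg hδ.le, Real.norm_of_nonneg hs0.le]; field_simp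
    calc 2 * π * (δ / s) * ‖sphereFourierDeriv (s • ξ)‖
        ≤ 2 * π * (δ / s) * (D * ‖s • ξ‖ * ‖s • ξ‖ ^ (-a)) := by gcongr
      _ = 2 * π * D * ‖s • ξ‖ ^ (-a) * (δ / s * ‖s • ξ‖) := by ring
      _ ≤ _ := by
        rw [h5]
        gcongr
        linarith

end ShellProfile

/-! ### Linearised restricted weak type estimates: interpolation and the elementary cases. -/

section RestrictedBounds

variable {d : ℕ}

/-- A finite family of shell kernels at scale `2^(-j)` whose radii are close to a
`2^(-j)`-separated set of points of `E`. -/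
structure ShellFamily (E : Set ℝ) (C R : ℝ) (j : ℕ) (T : Finset ℝ) (k : ℝ → Space d → ℝ) : Prop where
  sub : ∀ t ∈ T, t ∈ E
  sep : ∀ t ∈ T, ∀ t' ∈ T, t ≠ t' → (2⁻¹ : ℝ) ^ j ≤ |t - t'|
  ker : ∀ t ∈ T, ∃ s, |s - t| ≤ (2⁻¹ : ℝ) ^ j ∧ IsShellKernel C R ((2⁻¹ : ℝ) ^ j) s (k t)

/-- A restricted weak type bound, with exponents `a`, `b` and growth `2^(j e)`, for families of
shell kernels. -/
def RestrictedBound (d : ℕ) (E : Set ℝ) (C R a b e : ℝ) : Prop :=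
  0 ≤ a ∧ b ≤ 1 ∧ ∃ A : ℝ≥0, ∀ (j : ℕ) (T : Finset ℝ) (k : ℝ → Space d → ℝ),
    ShellFamily E C R j T k → ∀ (f : Space d → ℝ) (F : Set (Space d)) (G : ℝ → Set (Space d)),
    Measurable f → MeasurableSet F → volume F ≠ ∞ → (∀ x, |f x| ≤ F.indicator 1 x) →
    (∀ t, MeasurableSet (G t)) → (∀ t, volume (G t) ≠ ∞) →
    ∑ t ∈ T, ∫⁻ x in G t, ‖conv (k t) f x‖ₑ ≤
      A * (2 : ℝ≥0∞) ^ ((j : ℝ) * e) * volume F ^ a * (∑ t ∈ T, volume (G t)) ^ (1 - b)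

lemma ENNReal_le_rpow_mul_rpow {X Y Z : ℝ≥0∞} {s : ℝ} (h0 : 0 ≤ s) (h1 : s ≤ 1) (hY : X ≤ Y)
    (hZ : X ≤ Z) : X ≤ Y ^ (1 - s) * Z ^ s := by
  calc X = X ^ (1 - s) * X ^ s := by
        rw [← ENNReal.rpow_add_of_nonneg _ _ (by linarith) h0]; simp
    _ ≤ _ := by
        gcongr

/-- Both hypotheses bound the same quantity, so interpolation is a weighted geometric mean of two
upper bounds. The sign conditions `0 ≤ a` and `b ≤ 1` make exponents add in `ℝ≥0∞` also at the bases
`0` and `∞`. -/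
lemma RestrictedBound.interpolate {E : Set ℝ} {C R a₀ b₀ e₀ a₁ b₁ e₁ s : ℝ}
    (h₀ : RestrictedBound d E C R a₀ b₀ e₀) (h₁ : RestrictedBound d E C R a₁ b₁ e₁)
    (hs0 : 0 ≤ s) (hs1 : s ≤ 1) :
    RestrictedBound d E C R ((1 - s) * a₀ + s * a₁) ((1 - s) * b₀ + s * b₁)
      ((1 - s) * e₀ + s * e₁) := by
  obtain ⟨ha₀, hb₀, A₀, hA₀⟩ := h₀
  obtain ⟨ha₁, hb₁, A₁, hA₁⟩ := h₁
  have hs1' : 0 ≤ 1 - s := by linarith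
  refine ⟨by positivity, by nlinarith, A₀ ^ (1 - s) * A₁ ^ s, ?_⟩
  intro j T k hfam f F G hf hF hF' hfF hG hG'
  refine (ENNReal_le_rpow_mul_rpow hs0 hs1 (hA₀ j T k hfam f F G hf hF hF' hfF hG hG')
    (hA₁ j T k hfam f F G hf hF hF' hfF hG hG')).trans (le_of_eq ?_)
  set m := ∑ t ∈ T, volume (G t)
  have h2 : (2 : ℝ≥0∞) ≠ 0 := by norm_num
  have h2' : (2 : ℝ≥0∞) ≠ ∞ := by norm_num
  rw [ENNReal.mul_rpow_of_nonneg _ _ hs1', ENNReal.mul_rpow_of_nonneg _ _ hs1',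
    ENNReal.mul_rpow_of_nonneg _ _ hs1', ENNReal.mul_rpow_of_nonneg _ _ hs0,
    ENNReal.mul_rpow_of_nonneg _ _ hs0, ENNReal.mul_rpow_of_nonneg _ _ hs0]
  simp only [← ENNReal.rpow_mul]
  have e1 : (2 : ℝ≥0∞) ^ ((j : ℝ) * ((1 - s) * e₀ + s * e₁)) =
      2 ^ ((j : ℝ) * e₀ * (1 - s)) * 2 ^ ((j : ℝ) * e₁ * s) := by
    rw [← ENNReal.rpow_add _ _ h2 h2']; congr 1; ring
  have e2 : volume F ^ ((1 - s) * a₀ + s * a₁) =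
      volume F ^ (a₀ * (1 - s)) * volume F ^ (a₁ * s) := by
    rw [← ENNReal.rpow_add_of_nonneg _ _ (by positivity) (by positivity)]; congr 1; ring
  have e3 : m ^ (1 - ((1 - s) * b₀ + s * b₁)) = m ^ ((1 - b₀) * (1 - s)) * m ^ ((1 - b₁) * s) := by
    rw [← ENNReal.rpow_add_of_nonneg _ _ (mul_nonneg (by linarith) hs1') (mul_nonneg (by linarith) hs0)]
    congr 1; ring
  rw [e1, e2, e3]
  push_cast
  rw [ENNReal.coe_rpow_of_nonneg _ hs1', ENNReal.coe_rpow_of_nonneg _ hs0]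
  ring

section Basic

variable {f : Space d → ℝ} {F : Set (Space d)}

lemma isNice_of_le_indicator (hf : Measurable f) (hF : MeasurableSet F) (hF' : volume F ≠ ∞)
    (hfF : ∀ x, |f x| ≤ F.indicator 1 x) : IsNice f := by
  refine ⟨?_, 1, fun x => (hfF x).trans ?_⟩
  · refine Integrable.mono' (g := F.indicator 1) ?_ hf.aestronglyMeasurable (ae_of_all _ hfF)
    exact (integrable_indicator_iff hF).2 (integrableOn_const hF')
  · exact indicator_le_self' (fun _ _ => zero_le_one) x

lemma integral_abs_le_of_le_indicator (hF : MeasurableSet F) (hF' : volume F ≠ ∞)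
    (hfF : ∀ x, |f x| ≤ F.indicator 1 x) : ∫ x, |f x| ≤ volume.real F := by
  have : ∫ x, |f x| ≤ ∫ x, F.indicator (1 : Space d → ℝ) x :=
    integral_mono_of_nonneg (ae_of_all _ fun x => abs_nonneg _)
      ((integrable_indicator_iff hF).2 (integrableOn_const hF')) (ae_of_all _ hfF)
  rwa [integral_indicator_one hF] at this

lemma integral_sq_le_of_le_indicator (hF : MeasurableSet F) (hF' : volume F ≠ ∞)
    (hfF : ∀ x, |f x| ≤ F.indicator 1 x) : ∫ x, f x ^ 2 ≤ volume.real F := by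
  have : ∫ x, f x ^ 2 ≤ ∫ x, F.indicator (1 : Space d → ℝ) x := by
    refine integral_mono_of_nonneg (ae_of_all _ fun x => sq_nonneg _)
      ((integrable_indicator_iff hF).2 (integrableOn_const hF')) (ae_of_all _ fun x => ?_)
    have h1 := hfF x
    by_cases hx : x ∈ F
    · simp only [indicator_of_mem hx, Pi.one_apply] at h1 ⊢
      exact (sq_le_one_iff_abs_le_one _).2 h1
    · simp only [indicator_of_notMem hx] at h1 ⊢
      have : f x = 0 := abs_nonpos_iff.1 h1
      simp [this]
  rwa [integral_indicator_one hF] at this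

lemma abs_le_one_of_le_indicator (hfF : ∀ x, |f x| ≤ F.indicator 1 x) (x : Space d) : |f x| ≤ 1 :=
  (hfF x).trans (indicator_le_self' (fun _ _ => zero_le_one) x)

lemma abs_conv_le_of_abs_le_one {k : Space d → ℝ} (hk : Integrable k) (hf : ∀ x, |f x| ≤ 1)
    (x : Space d) : |conv k f x| ≤ ∫ y, |k y| := by
  rw [conv, ← Real.norm_eq_abs, ← integral_sub_left_eq_self (fun y => |k y|) volume x]
  refine norm_integral_le_of_norm_le (hk.abs.comp_sub_left x) (ae_of_all _ fun y => ?_)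
  rw [norm_mul]
  exact mul_le_of_le_one_right (norm_nonneg _) (hf y)

lemma integral_abs_conv_le {k : Space d → ℝ} (hk : Integrable k) (hf : Integrable f) :
    ∫ x, |conv k f x| ≤ (∫ x, |k x|) * ∫ x, |f x| := by
  have h := hf.convolution_integrand (ContinuousLinearMap.mul ℝ ℝ) hk
  simp only [ContinuousLinearMap.mul_apply'] at h
  calc ∫ x, |conv k f x| ≤ ∫ x, ∫ y, |f y * k (x - y)| := by
        refine integral_mono_of_nonneg (ae_of_all _ fun x => abs_nonneg _) h.norm.integral_prod_left
          (ae_of_all _ fun x => ?_)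
        have := norm_integral_le_integral_norm (μ := volume) (fun y => f y * k (x - y))
        simp_rw [mul_comm (f _)] at this ⊢
        exact this
    _ = ∫ y, ∫ x, |f y * k (x - y)| := integral_integral_swap (f := fun x y => |f y * k (x - y)|) h.norm
    _ = _ := by
        rw [← integral_const_mul]
        congr 1; ext y
        simp_rw [abs_mul]
        rw [integral_const_mul, integral_sub_right_eq_self (fun x => |k x|) y, mul_comm]

end Basic

lemma inv_two_pow_pos (j : ℕ) : (0 : ℝ) < (2⁻¹ : ℝ) ^ j := by positivity

lemma ofReal_two_rpow (x : ℝ) : ENNReal.ofReal ((2 : ℝ) ^ x) = (2 : ℝ≥0∞) ^ x := by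
  rw [← ENNReal.ofReal_rpow_of_pos (by norm_num)]; simp

/-- The L¹ bound of the kernels makes every convolution uniformly bounded. -/
lemma restrictedBound_zero_zero {E : Set ℝ} {C R : ℝ} : RestrictedBound d E C R 0 0 0 := by
  refine ⟨le_rfl, zero_le_one, C.toNNReal, ?_⟩
  intro j T k hfam f F G hf hF hF' hfF hG hG'
  simp only [mul_zero, ENNReal.rpow_zero, mul_one, sub_zero, ENNReal.rpow_one]
  rw [Finset.mul_sum]
  refine Finset.sum_le_sum fun t ht => ?_
  obtain ⟨s, -, hk⟩ := hfam.ker t ht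
  refine (lintegral_mono (g := fun _ => (C.toNNReal : ℝ≥0∞)) fun x => ?_).trans ?_
  · rw [Real.enorm_eq_ofReal_abs]
    exact ENNReal.ofReal_le_ofReal ((abs_conv_le_of_abs_le_one hk.isNice.int
      (abs_le_one_of_le_indicator hfF) x).trans hk.l1)
  · simp

/-- The height `C 2^j` of the kernels is the only input. -/
lemma restrictedBound_one_zero {E : Set ℝ} {C R : ℝ} (hC : 0 ≤ C) : RestrictedBound d E C R 1 0 1 := by
  refine ⟨zero_le_one, zero_le_one, C.toNNReal, ?_⟩
  intro j T k hfam f F G hf hF hF' hfF hG hG'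
  simp only [mul_one, sub_zero, ENNReal.rpow_one]
  rw [Finset.mul_sum]
  refine Finset.sum_le_sum fun t ht => ?_
  obtain ⟨s, -, hk⟩ := hfam.ker t ht
  have hn := isNice_of_le_indicator hf hF hF' hfF
  refine (lintegral_mono (g := fun _ => C.toNNReal * (2 : ℝ≥0∞) ^ (j : ℝ) * volume F) fun x => ?_).trans ?_
  · rw [Real.enorm_eq_ofReal_abs]
    have h1 : |conv (k t) f x| ≤ C * (2 : ℝ) ^ (j : ℝ) * volume.real F := by
      refine (abs_conv_le hk.bdd hn.int x).trans ?_
      rw [Real.rpow_natCast, inv_pow, inv_inv]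
      gcongr
      exact integral_abs_le_of_le_indicator hF hF' hfF
    refine (ENNReal.ofReal_le_ofReal h1).trans (le_of_eq ?_)
    rw [ENNReal.ofReal_mul (by positivity), ENNReal.ofReal_mul hC, ofReal_two_rpow,
      Measure.real, ENNReal.ofReal_toReal hF']
    rfl
  · simp

/-- The number of points of a `2^(-j)`-separated subset of `E` grows at most like `2^(j e)`. -/
def CardBound (E : Set ℝ) (e : ℝ) : Prop :=
  ∃ N : ℝ≥0, ∀ (j : ℕ) (T : Finset ℝ), (∀ t ∈ T, t ∈ E) →
    (∀ t ∈ T, ∀ t' ∈ T, t ≠ t' → (2⁻¹ : ℝ) ^ j ≤ |t - t'|) →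
    (T.card : ℝ≥0∞) ≤ N * (2 : ℝ≥0∞) ^ ((j : ℝ) * e)

/-- Every radius satisfies the same L¹ bound, and the number of radii is counted. -/
lemma restrictedBound_one_one {E : Set ℝ} {C R e : ℝ} (hC : 0 ≤ C) (hE : CardBound E e) :
    RestrictedBound d E C R 1 1 e := by
  obtain ⟨N, hN⟩ := hE
  refine ⟨zero_le_one, le_rfl, N * C.toNNReal, ?_⟩
  intro j T k hfam f F G hf hF hF' hfF hG hG'
  simp only [sub_self, ENNReal.rpow_zero, mul_one, ENNReal.rpow_one]
  have hn := isNice_of_le_indicator hf hF hF' hfF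
  have h1 : ∀ t ∈ T, ∫⁻ x in G t, ‖conv (k t) f x‖ₑ ≤ C.toNNReal * volume F := by
    intro t ht
    obtain ⟨s, -, hk⟩ := hfam.ker t ht
    refine (setLIntegral_le_lintegral _ _).trans ?_
    rw [← ofReal_integral_norm_eq_lintegral_enorm (integrable_conv hk.isNice.int hn.int)]
    have h2 : ∫ x, ‖conv (k t) f x‖ ≤ C * volume.real F := by
      refine (integral_abs_conv_le hk.isNice.int hn.int).trans ?_
      exact mul_le_mul hk.l1 (integral_abs_le_of_le_indicator hF hF' hfF)
        (integral_nonneg fun x => abs_nonneg _) hC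
    refine (ENNReal.ofReal_le_ofReal h2).trans (le_of_eq ?_)
    rw [ENNReal.ofReal_mul hC, Measure.real, ENNReal.ofReal_toReal hF']
    rfl
  refine (Finset.sum_le_sum h1).trans ?_
  rw [Finset.sum_const, nsmul_eq_mul]
  calc (T.card : ℝ≥0∞) * (C.toNNReal * volume F)
      ≤ (N * (2 : ℝ≥0∞) ^ ((j : ℝ) * e)) * (C.toNNReal * volume F) := by
        gcongr
        exact hN j T hfam.sub hfam.sep
    _ = _ := by push_cast; ring

lemma inv_two_pow_rpow (j : ℕ) (x : ℝ) : ((2⁻¹ : ℝ) ^ j) ^ x = (2 : ℝ) ^ (-((j : ℝ) * x)) := by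
  rw [← Real.rpow_natCast, ← Real.rpow_mul (by norm_num), Real.inv_rpow (by norm_num),
    Real.rpow_neg (by norm_num)]

lemma eLpNorm_two_le_of_le_indicator {f : Space d → ℝ} {F : Set (Space d)} (hF : MeasurableSet F)
    (hfF : ∀ x, |f x| ≤ F.indicator 1 x) : eLpNorm f 2 volume ≤ volume F ^ (1 / 2 : ℝ) := by
  have h1 : eLpNorm f 2 volume ≤ eLpNorm (F.indicator (fun _ => (1 : ℝ))) 2 volume :=
    eLpNorm_mono_real hfF
  refine h1.trans (le_of_eq ?_)
  rw [eLpNorm_indicator_const hF (by norm_num) (by norm_num)]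
  simp

/-- Plancherel gains `2^(-j(d-1)/2)` for each radius, and Cauchy–Schwarz over the net costs the
square root of its cardinality. -/
lemma restrictedBound_half_half [hd : Fact (2 ≤ d)] {E : Set ℝ} {C R e : ℝ} (hC : 0 ≤ C)
    (hE : CardBound E e) :
    RestrictedBound d E C R (1 / 2) (1 / 2) ((e - ((d : ℝ) - 1)) / 2) := by
  obtain ⟨N, hN⟩ := hE
  refine ⟨by norm_num, by norm_num, N ^ (1 / 2 : ℝ) * C.toNNReal, ?_⟩
  intro j T k hfam f F G hf hF hF' hfF hG hG'
  have hn := isNice_of_le_indicator hf hF hF' hfF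
  set m := ∑ t ∈ T, volume (G t)
  set D := ENNReal.ofReal (C * ((2⁻¹ : ℝ) ^ j) ^ (((d : ℝ) - 1) / 2)) * volume F ^ (1 / 2 : ℝ)
  have h1 : ∀ t ∈ T, ∫⁻ x in G t, ‖conv (k t) f x‖ₑ ≤ D * volume (G t) ^ (1 / 2 : ℝ) := by
    intro t ht
    obtain ⟨s, -, hk⟩ := hfam.ker t ht
    have h2 := eLpNorm_le_eLpNorm_mul_rpow_measure_univ (μ := volume.restrict (G t))
      (f := conv (k t) f) (p := 1) (q := 2) (by norm_num)
      (integrable_conv hk.isNice.int hn.int).aestronglyMeasurable.restrict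
    rw [eLpNorm_one_eq_lintegral_enorm, Measure.restrict_apply_univ] at h2
    refine h2.trans ?_
    have e1 : (1 / (1 : ℝ≥0∞).toReal - 1 / (2 : ℝ≥0∞).toReal) = (1 / 2 : ℝ) := by norm_num
    rw [e1]
    gcongr
    calc eLpNorm (conv (k t) f) 2 (volume.restrict (G t)) ≤ eLpNorm (conv (k t) f) 2 volume :=
          eLpNorm_mono_measure _ Measure.restrict_le_self
      _ ≤ _ := hk.eLpNorm_conv_le hC (inv_two_pow_pos j) hn
      _ ≤ _ := by
        simp only [D]
        gcongr
        exact eLpNorm_two_le_of_le_indicator hF hfF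
  refine (Finset.sum_le_sum h1).trans ?_
  rw [← Finset.mul_sum]
  have h3 : ∑ t ∈ T, volume (G t) ^ (1 / 2 : ℝ) ≤ (T.card : ℝ≥0∞) ^ (1 / 2 : ℝ) * m ^ (1 / 2 : ℝ) := by
    have := ENNReal.inner_le_Lp_mul_Lq T (fun _ => (1 : ℝ≥0∞)) (fun t => volume (G t) ^ (1 / 2 : ℝ))
      (p := 2) (q := 2) (by constructor <;> norm_num)
    simp only [one_mul, ENNReal.one_rpow, Finset.sum_const, nsmul_eq_mul, mul_one,
      ← ENNReal.rpow_mul] at this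
    simpa using this
  have h4 : (T.card : ℝ≥0∞) ^ (1 / 2 : ℝ) ≤ N ^ (1 / 2 : ℝ) * (2 : ℝ≥0∞) ^ ((j : ℝ) * e / 2) := by
    calc (T.card : ℝ≥0∞) ^ (1 / 2 : ℝ) ≤ (N * (2 : ℝ≥0∞) ^ ((j : ℝ) * e)) ^ (1 / 2 : ℝ) := by
          gcongr
          exact hN j T hfam.sub hfam.sep
      _ = _ := by
          rw [ENNReal.mul_rpow_of_nonneg _ _ (by norm_num), ← ENNReal.rpow_mul]
          congr 2; ring
  have h5 : ENNReal.ofReal (C * ((2⁻¹ : ℝ) ^ j) ^ (((d : ℝ) - 1) / 2)) =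
      C.toNNReal * (2 : ℝ≥0∞) ^ (-((j : ℝ) * (((d : ℝ) - 1) / 2))) := by
    rw [ENNReal.ofReal_mul hC, inv_two_pow_rpow, ofReal_two_rpow]; rfl
  calc D * ∑ t ∈ T, volume (G t) ^ (1 / 2 : ℝ)
      ≤ D * ((N ^ (1 / 2 : ℝ) * (2 : ℝ≥0∞) ^ ((j : ℝ) * e / 2)) * m ^ (1 / 2 : ℝ)) := by
        gcongr
        exact h3.trans (by gcongr)
    _ = N ^ (1 / 2 : ℝ) * C.toNNReal * ((2 : ℝ≥0∞) ^ (-((j : ℝ) * (((d : ℝ) - 1) / 2))) *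
          (2 : ℝ≥0∞) ^ ((j : ℝ) * e / 2)) * volume F ^ (1 / 2 : ℝ) * m ^ (1 / 2 : ℝ) := by
        simp only [D, h5]; ring
    _ = _ := by
        rw [← ENNReal.rpow_add _ _ (by norm_num) (by norm_num)]
        push_cast
        rw [ENNReal.coe_rpow_of_nonneg _ (by norm_num : (0 : ℝ) ≤ 1 / 2)]
        congr 2
        · congr 3; ring
        · norm_num

end RestrictedBounds

/-! ### The `TT*` estimate governed by the local size of `E`. -/

section TTStar

variable {d : ℕ}

lemma eLpNorm_two_eq_ofReal_sqrt {u : Space d → ℝ} (hu : MemLp u 2) :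
    eLpNorm u 2 volume = ENNReal.ofReal √(∫ x, u x ^ 2) := by
  rw [hu.eLpNorm_eq_integral_rpow_norm (by norm_num) (by norm_num), Real.sqrt_eq_rpow]
  simp

lemma IsShellKernel.integral_sq_conv_le [hd : Fact (2 ≤ d)] {C R δ s : ℝ} {k : Space d → ℝ}
    (h : IsShellKernel C R δ s k) (hC : 0 ≤ C) (hδ : 0 < δ) {f : Space d → ℝ} (hf : IsNice f) :
    ∫ x, conv k f x ^ 2 ≤ C ^ 2 * δ ^ ((d : ℝ) - 1) * ∫ x, f x ^ 2 := by
  have h1 := h.eLpNorm_conv_le hC hδ hf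
  rw [eLpNorm_two_eq_ofReal_sqrt (h.isNice.conv hf.int).memLp_two,
    eLpNorm_two_eq_ofReal_sqrt hf.memLp_two, ← ENNReal.ofReal_mul (by positivity),
    ENNReal.ofReal_le_ofReal_iff (by positivity)] at h1
  have i1 : 0 ≤ ∫ x, conv k f x ^ 2 := integral_nonneg fun x => sq_nonneg _
  have i2 : 0 ≤ ∫ x, f x ^ 2 := integral_nonneg fun x => sq_nonneg _
  calc ∫ x, conv k f x ^ 2 = √(∫ x, conv k f x ^ 2) ^ 2 := (Real.sq_sqrt i1).symm
    _ ≤ (C * δ ^ (((d : ℝ) - 1) / 2) * √(∫ x, f x ^ 2)) ^ 2 := by gcongr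
    _ = _ := by
      rw [mul_pow, mul_pow, Real.sq_sqrt i2, ← Real.rpow_natCast (δ ^ _), ← Real.rpow_mul hδ.le]
      congr 3; push_cast; ring

lemma integrable_sq_of_isNice {u : Space d → ℝ} (hu : IsNice u) : Integrable (fun x => u x ^ 2) :=
  (memLp_two_iff_integrable_sq hu.int.aestronglyMeasurable).1 hu.memLp_two

lemma integrable_mul_of_isNice {u v : Space d → ℝ} (hu : IsNice u) (hv : IsNice v) :
    Integrable (fun x => u x * v x) := by
  obtain ⟨M, hM⟩ := hu.bdd
  exact hv.int.bdd_mul hu.int.aestronglyMeasurable (ae_of_all _ hM)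

lemma abs_integral_mul_le_half {u v : Space d → ℝ} (hu : IsNice u) (hv : IsNice v) :
    |∫ x, u x * v x| ≤ ((∫ x, u x ^ 2) + ∫ x, v x ^ 2) / 2 := by
  rw [← integral_add (integrable_sq_of_isNice hu) (integrable_sq_of_isNice hv), ← integral_div,
    ← Real.norm_eq_abs]
  refine norm_integral_le_of_norm_le
    (((integrable_sq_of_isNice hu).add (integrable_sq_of_isNice hv)).div_const 2)
    (ae_of_all _ fun x => ?_)
  rw [Real.norm_eq_abs, abs_le]
  constructor <;> nlinarith [sq_nonneg (u x + v x), sq_nonneg (u x - v x)]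

lemma sq_integral_mul_le {u v : Space d → ℝ} (hu : IsNice u) (hv : IsNice v) :
    (∫ x, u x * v x) ^ 2 ≤ (∫ x, u x ^ 2) * ∫ x, v x ^ 2 := by
  have key : ∀ t : ℝ, 0 ≤ (∫ x, v x ^ 2) * (t * t) + (2 * ∫ x, u x * v x) * t + ∫ x, u x ^ 2 := by
    intro t
    have i1 := integrable_sq_of_isNice hu
    have i2 := integrable_sq_of_isNice hv
    have i3 := integrable_mul_of_isNice hu hv
    have : (∫ x, v x ^ 2) * (t * t) + (2 * ∫ x, u x * v x) * t + ∫ x, u x ^ 2 =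
        ∫ x, (u x + t * v x) ^ 2 := by
      have e : ∀ x, (u x + t * v x) ^ 2 = (t * t) * v x ^ 2 + (2 * t) * (u x * v x) + u x ^ 2 :=
        fun x => by ring
      simp_rw [e]
      have i23 : Integrable (fun x => t * t * v x ^ 2 + 2 * t * (u x * v x)) :=
        (i2.const_mul _).add (i3.const_mul _)
      rw [integral_add i23 i1,
        integral_add (i2.const_mul _) (i3.const_mul _), integral_const_mul, integral_const_mul]
      ring
    rw [this]
    exact integral_nonneg fun x => sq_nonneg _
  have := discrim_le_zero key
  simp only [discrim] at this
  linarith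

/-- In a `2^(-j)`-separated subset of `E` the number of points at distance `2^(ℓ-j)` from a given
point grows at most like `2^(ℓγ + jε)`. -/
def LocalCardBound (E : Set ℝ) (γ ε : ℝ) : Prop :=
  ∃ N : ℝ, 0 ≤ N ∧ ∀ (j : ℕ) (T : Finset ℝ), (∀ t ∈ T, t ∈ E) →
    (∀ t ∈ T, ∀ t' ∈ T, t ≠ t' → (2⁻¹ : ℝ) ^ j ≤ |t - t'|) → ∀ ℓ ≤ j, ∀ t ∈ T,
    ((T.filter (fun t' => |t - t'| < 2 ^ (ℓ + 1) * (2⁻¹ : ℝ) ^ j)).card : ℝ) ≤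
      N * (2 : ℝ) ^ ((ℓ : ℝ) * γ + (j : ℝ) * ε)

/-- A geometric mean with weight `θ` on the first bound; the powers of `m` combine to `θ + 2(1 - θ)
= 2 - θ`. -/
lemma le_interpolate {X K₁ K₂ u v m θ : ℝ} (hX : 0 ≤ X) (hK₁ : 0 ≤ K₁) (hK₂ : 0 ≤ K₂) (hm : 0 ≤ m)
    (hθ0 : 0 ≤ θ) (hθ1 : θ ≤ 1) (h1 : X ≤ K₁ * 2 ^ u * m) (h2 : X ≤ K₂ * 2 ^ v * m ^ 2) :
    X ≤ K₁ ^ θ * K₂ ^ (1 - θ) * 2 ^ (u * θ + v * (1 - θ)) * m ^ (2 - θ) := by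
  have hθ' : 0 ≤ 1 - θ := by linarith
  calc X = X ^ θ * X ^ (1 - θ) := by
        rw [← Real.rpow_add_of_nonneg hX hθ0 hθ']; simp
    _ ≤ (K₁ * 2 ^ u * m) ^ θ * (K₂ * 2 ^ v * m ^ 2) ^ (1 - θ) := by gcongr
    _ = _ := by
        rw [Real.mul_rpow (by positivity) hm, Real.mul_rpow hK₁ (by positivity),
          Real.mul_rpow (by positivity) (by positivity), Real.mul_rpow hK₂ (by positivity),
          ← Real.rpow_mul (by norm_num), ← Real.rpow_mul (by norm_num),
          Real.rpow_add (by norm_num), ← Real.rpow_natCast m 2, ← Real.rpow_mul hm]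
        have : m ^ (2 - θ) = m ^ θ * m ^ (((2 : ℕ) : ℝ) * (1 - θ)) := by
          rw [← Real.rpow_add_of_nonneg hm hθ0 (by positivity)]
          congr 1; push_cast; ring
        rw [this]
        ring

/-- Absorbs the number `j + 1` of dyadic distances into an arbitrarily small exponential loss. -/
lemma exists_succ_le_two_rpow {ε : ℝ} (hε : 0 < ε) :
    ∃ B, 0 ≤ B ∧ ∀ j : ℕ, (j + 1 : ℝ) ≤ B * (2 : ℝ) ^ ((j : ℝ) * ε) := by
  have hl : 0 < log 2 := Real.log_pos (by norm_num)
  refine ⟨1 + (ε * log 2)⁻¹, by positivity, fun j => ?_⟩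
  have h1 : 1 + (j : ℝ) * ε * log 2 ≤ (2 : ℝ) ^ ((j : ℝ) * ε) := by
    rw [Real.rpow_def_of_pos (by norm_num)]
    have := Real.add_one_le_exp (log 2 * ((j : ℝ) * ε))
    linarith
  have h2 : (1 : ℝ) ≤ (2 : ℝ) ^ ((j : ℝ) * ε) := Real.one_le_rpow (by norm_num) (by positivity)
  have h3 : (j : ℝ) ≤ (ε * log 2)⁻¹ * (2 : ℝ) ^ ((j : ℝ) * ε) := by
    rw [inv_mul_eq_div, le_div_iff₀ (by positivity)]
    nlinarith
  linarith

/-- The dyadic distance of two points, in units of `2^(-j)`. -/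
noncomputable def layer (j : ℕ) (t t' : ℝ) : ℕ := Nat.log 2 ⌊|t - t'| * 2 ^ j⌋₊

lemma layer_le {j : ℕ} {t t' : ℝ} (h : |t - t'| ≤ 1) : layer j t t' ≤ j := by
  have : ⌊|t - t'| * 2 ^ j⌋₊ ≤ 2 ^ j := by
    apply Nat.floor_le_of_le
    push_cast
    exact mul_le_of_le_one_left (by positivity) h
  calc layer j t t' ≤ Nat.log 2 (2 ^ j) := Nat.log_mono_right this
    _ = j := Nat.log_pow (by norm_num) j

lemma lt_of_layer (j : ℕ) (t t' : ℝ) : |t - t'| < 2 ^ (layer j t t' + 1) * (2⁻¹ : ℝ) ^ j := by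
  have h1 : ⌊|t - t'| * 2 ^ j⌋₊ < 2 ^ (layer j t t' + 1) := Nat.lt_pow_succ_log_self (by norm_num) _
  have h2 : |t - t'| * 2 ^ j < (2 : ℝ) ^ (layer j t t' + 1) := by
    have := (Nat.floor_lt (by positivity)).1 h1
    exact_mod_cast this
  rw [inv_pow, ← div_eq_mul_inv, lt_div_iff₀ (by positivity)]
  exact h2

/-- The `2` subtracted accounts for the two displacements of the radii `s`, `s'` from `t`, `t'`. It
also makes the bound trivial for coinciding or neighbouring points. -/
lemma le_of_layer (j : ℕ) {t t' s s' : ℝ} (hs : |s - t| ≤ (2⁻¹ : ℝ) ^ j)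
    (hs' : |s' - t'| ≤ (2⁻¹ : ℝ) ^ j) :
    ((2 : ℝ) ^ (layer j t t') - 2) * (2⁻¹ : ℝ) ^ j ≤ |s - s'| := by
  have hp : 0 < (2⁻¹ : ℝ) ^ j := by positivity
  have h1 : |t - t'| ≤ |s - s'| + 2 * (2⁻¹ : ℝ) ^ j := by
    have : t - t' = (s - s') - (s - t) + (s' - t') := by ring
    rw [this]
    refine (abs_add_le _ _).trans ?_
    have := abs_sub (s - s') (s - t)
    linarith
  rcases Nat.eq_zero_or_pos (layer j t t') with h | h
  · rw [h]
    have := abs_nonneg (s - s')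
    nlinarith
  · have hne : ⌊|t - t'| * 2 ^ j⌋₊ ≠ 0 := by
      intro h0
      rw [layer, h0] at h
      simp at h
    have h2 : 2 ^ (layer j t t') ≤ ⌊|t - t'| * 2 ^ j⌋₊ := Nat.pow_log_le_self 2 hne
    have h3 : (2 : ℝ) ^ (layer j t t') ≤ |t - t'| * 2 ^ j := by
      have := (Nat.le_floor_iff (by positivity)).1 h2
      exact_mod_cast this
    have h4 : (2 : ℝ) ^ (layer j t t') * (2⁻¹ : ℝ) ^ j ≤ |t - t'| := by
      rw [inv_pow, ← div_eq_mul_inv, div_le_iff₀ (by positivity)]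
      exact h3
    linarith

lemma layer_comm (j : ℕ) (t t' : ℝ) : layer j t t' = layer j t' t := by
  rw [layer, layer, abs_sub_comm]

/-- The second exponent at which the `TT*` argument applies. -/
noncomputable def ttExponent (d : ℕ) (γ : ℝ) : ℝ := ((d : ℝ) - 1) / (2 * ((d : ℝ) - 1 + 2 * γ))

/-- The square is expanded into pairs of radii, which are grouped by dyadic distance `2^(ℓ-j)`. Each
group has two bounds: an L² bound linear in `m`, with the local count `2^(ℓγ)`, and a kernel bound
quadratic in `m`, with the decay `2^(-ℓ(d-1)/2)`. Their geometric mean with weight `2 * ttExponent d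
γ` does not depend on `ℓ`, apart from `ε` losses, so summing over the groups costs only `j + 1`. -/
lemma exists_integral_sq_sum_conv_le [hd : Fact (2 ≤ d)] {E : Set ℝ} (hE : E ⊆ Icc 1 2)
    {C R γ ε : ℝ} (hC : 0 ≤ C) (hR : 0 ≤ R) (hγ : 0 ≤ γ) (hε : 0 < ε) (hN : LocalCardBound E γ ε) :
    ∃ A, 0 ≤ A ∧ ∀ (j : ℕ) (T : Finset ℝ) (k : ℝ → Space d → ℝ), ShellFamily E C R j T k →
      ∀ (g : ℝ → Space d → ℝ) (G : ℝ → Set (Space d)), (∀ t, Measurable (g t)) →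
      (∀ t, MeasurableSet (G t)) → (∀ t, volume (G t) ≠ ∞) →
      (∀ t x, |g t x| ≤ (G t).indicator 1 x) →
      ∫ x, (∑ t ∈ T, conv (k t) (g t) x) ^ 2 ≤
        A * (2 : ℝ) ^ ((j : ℝ) * (1 - 2 * ttExponent d γ * d + 2 * ε)) *
          (∑ t ∈ T, volume.real (G t)) ^ (2 - 2 * ttExponent d γ) := by
  obtain ⟨N, hN0, hN⟩ := hN
  obtain ⟨A, hA0, hA⟩ := exists_conv_shellKernel_le (d := d) hC hR
  obtain ⟨B, hB0, hB⟩ := exists_succ_le_two_rpow hε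
  set b := ttExponent d γ with hb
  have h2d : (2 : ℝ) ≤ d := by exact_mod_cast hd.out
  have hden : 0 < (d : ℝ) - 1 + 2 * γ := by linarith
  have hb0 : 0 ≤ 2 * b := by
    rw [hb, ttExponent]
    have : 0 ≤ (d : ℝ) - 1 := by linarith
    positivity
  have hb1 : 2 * b ≤ 1 := by
    rw [hb, ttExponent, ← mul_div_assoc, mul_div_mul_left _ _ (by norm_num), div_le_one hden]
    linarith
  -- This equation determines the exponent: the growth `2^(ℓγ)` with weight `2b` exactly cancels the
  -- decay `2^(-ℓ(d-1)/2)` with weight `1 - 2b`.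
  have hbγ : γ * (2 * b) = ((d : ℝ) - 1) / 2 * (1 - 2 * b) := by
    have h1 : 2 * b * ((d : ℝ) - 1 + 2 * γ) = (d : ℝ) - 1 := by
      rw [hb, ttExponent, ← mul_div_assoc, mul_div_mul_left _ _ (by norm_num),
        div_mul_cancel₀ _ hden.ne']
    linarith
  set K : ℝ := (C ^ 2 * N) ^ (2 * b) * A ^ (1 - 2 * b)
  refine ⟨B * K, by positivity, ?_⟩
  intro j T k hfam g G hg hG hG' hgG
  set δ : ℝ := (2⁻¹ : ℝ) ^ j
  have hδ : 0 < δ := by positivity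
  set m := ∑ t ∈ T, volume.real (G t)
  have hm : 0 ≤ m := Finset.sum_nonneg fun t _ => measureReal_nonneg
  choose! s hs hk using hfam.ker
  change ∀ t ∈ T, IsShellKernel C R δ (s t) (k t) at hk
  have hgn (t) : IsNice (g t) := isNice_of_le_indicator (hg t) (hG t) (hG' t) (hgG t)
  have hcn (t) (ht : t ∈ T) : IsNice (conv (k t) (g t)) := (hk t ht).isNice.conv (hgn t).int
  set P : ℝ × ℝ → ℝ := fun q => ∫ x, conv (k q.1) (g q.1) x * conv (k q.2) (g q.2) x
  have hexp : ∫ x, (∑ t ∈ T, conv (k t) (g t) x) ^ 2 = ∑ q ∈ T ×ˢ T, P q := by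
    rw [Finset.sum_product]
    have : ∀ x, (∑ t ∈ T, conv (k t) (g t) x) ^ 2 =
        ∑ t ∈ T, ∑ t' ∈ T, conv (k t) (g t) x * conv (k t') (g t') x := fun x => by
      rw [sq, Finset.sum_mul_sum]
    simp_rw [this]
    rw [integral_finsetSum _ fun t ht => integrable_finsetSum _ fun t' ht' =>
      integrable_mul_of_isNice (hcn t ht) (hcn t' ht')]
    refine Finset.sum_congr rfl fun t ht => ?_
    rw [integral_finsetSum _ fun t' ht' => integrable_mul_of_isNice (hcn t ht) (hcn t' ht')]
  have hmaps : ∀ q ∈ T ×ˢ T, layer j q.1 q.2 ∈ Finset.range (j + 1) := by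
    intro q hq
    rw [Finset.mem_product] at hq
    rw [Finset.mem_range, Nat.lt_succ_iff]
    apply layer_le
    have h1 := hE (hfam.sub _ hq.1)
    have h2 := hE (hfam.sub _ hq.2)
    rw [abs_le]; constructor <;> linarith [h1.1, h1.2, h2.1, h2.2]
  set X : ℕ → ℝ := fun ℓ => ∑ q ∈ (T ×ˢ T).filter (fun q => layer j q.1 q.2 = ℓ), |P q|
  have hX0 (ℓ) : 0 ≤ X ℓ := Finset.sum_nonneg fun q _ => abs_nonneg _
  have hsum : ∑ q ∈ T ×ˢ T, P q ≤ ∑ ℓ ∈ Finset.range (j + 1), X ℓ := by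
    rw [Finset.sum_fiberwise_of_maps_to hmaps]
    exact Finset.sum_le_sum fun q _ => le_abs_self _
  have hpair1 (t t' : ℝ) (ht : t ∈ T) (ht' : t' ∈ T) : |P (t, t')| ≤
      C ^ 2 * δ ^ ((d : ℝ) - 1) * ((volume.real (G t) + volume.real (G t')) / 2) := by
    refine (abs_integral_mul_le_half (hcn t ht) (hcn t' ht')).trans ?_
    have h1 := (hk t ht).integral_sq_conv_le hC hδ (hgn t)
    have h2 := (hk t' ht').integral_sq_conv_le hC hδ (hgn t')
    have h3 := integral_sq_le_of_le_indicator (hG t) (hG' t) (hgG t)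
    have h4 := integral_sq_le_of_le_indicator (hG t') (hG' t') (hgG t')
    have h5 : 0 ≤ C ^ 2 * δ ^ ((d : ℝ) - 1) := by positivity
    have h6 := mul_le_mul_of_nonneg_left h3 h5
    have h7 := mul_le_mul_of_nonneg_left h4 h5
    linarith
  have hpair2 (t t' : ℝ) (ht : t ∈ T) (ht' : t' ∈ T) : |P (t, t')| ≤
      A * (δ⁻¹ * ((2 : ℝ) ^ layer j t t') ^ (-(((d : ℝ) - 1) / 2))) *
        (volume.real (G t) * volume.real (G t')) := by
    have e : P (t, t') = ∫ x, conv (conv (k t') (k t)) (g t) x * g t' x :=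
      integral_conv_mul_conv (hk t ht).isNice (hk t' ht').isNice (hgn t).int (hgn t').int
        (hk t' ht').even
    have hK := hA δ (s t') (s t) ((2 : ℝ) ^ layer j t t') (k t') (k t) hδ (hk t' ht') (hk t ht)
      (one_le_pow₀ (by norm_num)) (by
        rw [layer_comm]
        exact le_of_layer j (hs t' ht') (hs t ht))
    set κ := A * (δ⁻¹ * ((2 : ℝ) ^ layer j t t') ^ (-(((d : ℝ) - 1) / 2)))
    have hκ : 0 ≤ κ := by positivity
    have h1 (x) : |conv (conv (k t') (k t)) (g t) x| ≤ κ * volume.real (G t) :=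
      (abs_conv_le hK (hgn t).int x).trans (by
        gcongr; exact integral_abs_le_of_le_indicator (hG t) (hG' t) (hgG t))
    rw [e, ← Real.norm_eq_abs, ← mul_assoc]
    calc _ ≤ ∫ x, κ * volume.real (G t) * |g t' x| := by
          refine norm_integral_le_of_norm_le ((hgn t').int.abs.const_mul _) (ae_of_all _ fun x => ?_)
          rw [norm_mul]
          exact mul_le_mul_of_nonneg_right (h1 x) (abs_nonneg _)
      _ ≤ _ := by
          rw [integral_const_mul]
          gcongr
          exact integral_abs_le_of_le_indicator (hG t') (hG' t') (hgG t')
  have hlayer (ℓ : ℕ) (hℓ : ℓ ∈ Finset.range (j + 1)) :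
      X ℓ ≤ K * (2 : ℝ) ^ ((j : ℝ) * (1 - 2 * b * d + ε)) * m ^ (2 - 2 * b) := by
    have hℓj : ℓ ≤ j := Nat.lt_succ_iff.1 (Finset.mem_range.1 hℓ)
    have hcard (t : ℝ) (ht : t ∈ T) : ((T.filter fun t' => layer j t t' = ℓ).card : ℝ) ≤
        N * (2 : ℝ) ^ ((ℓ : ℝ) * γ + (j : ℝ) * ε) := by
      refine le_trans ?_ (hN j T hfam.sub hfam.sep ℓ hℓj t ht)
      gcongr with t' ht'
      intro hl
      rw [← hl]
      exact lt_of_layer j t t'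
    -- The energy bound for a pair is symmetrised, so for each fixed radius only the number of
    -- partners at distance about `2^(ℓ-j)` matters.
    have hU : X ℓ ≤ (C ^ 2 * N) * 2 ^ (-((j : ℝ) * ((d : ℝ) - 1)) + ((ℓ : ℝ) * γ + (j : ℝ) * ε)) * m := by
      have e1 : X ℓ ≤ ∑ q ∈ (T ×ˢ T).filter (fun q => layer j q.1 q.2 = ℓ),
          C ^ 2 * δ ^ ((d : ℝ) - 1) * ((volume.real (G q.1) + volume.real (G q.2)) / 2) := by
        refine Finset.sum_le_sum fun q hq => ?_
        rw [Finset.mem_filter, Finset.mem_product] at hq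
        exact hpair1 q.1 q.2 hq.1.1 hq.1.2
      have e2 : ∑ q ∈ (T ×ˢ T).filter (fun q => layer j q.1 q.2 = ℓ), volume.real (G q.1) ≤
          N * (2 : ℝ) ^ ((ℓ : ℝ) * γ + (j : ℝ) * ε) * m := by
        rw [Finset.sum_filter, Finset.sum_product, Finset.mul_sum]
        refine Finset.sum_le_sum fun t ht => ?_
        rw [← Finset.sum_filter]
        simp only
        rw [Finset.sum_const, nsmul_eq_mul]
        gcongr
        exact hcard t ht
      have e3 : ∑ q ∈ (T ×ˢ T).filter (fun q => layer j q.1 q.2 = ℓ), volume.real (G q.2) ≤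
          N * (2 : ℝ) ^ ((ℓ : ℝ) * γ + (j : ℝ) * ε) * m := by
        rw [Finset.sum_filter, Finset.sum_product_right, Finset.mul_sum]
        refine Finset.sum_le_sum fun t ht => ?_
        rw [← Finset.sum_filter]
        simp only
        rw [Finset.sum_const, nsmul_eq_mul]
        gcongr
        simp_rw [layer_comm j _ t]
        exact hcard t ht
      rw [← Finset.mul_sum, ← Finset.sum_div, Finset.sum_add_distrib] at e1
      refine e1.trans ?_
      have e4 : δ ^ ((d : ℝ) - 1) = 2 ^ (-((j : ℝ) * ((d : ℝ) - 1))) := inv_two_pow_rpow j _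
      rw [Real.rpow_add (by norm_num), ← e4]
      have h5 : 0 ≤ C ^ 2 * δ ^ ((d : ℝ) - 1) := by positivity
      calc _ ≤ C ^ 2 * δ ^ ((d : ℝ) - 1) * (N * (2 : ℝ) ^ ((ℓ : ℝ) * γ + (j : ℝ) * ε) * m) := by
            gcongr; linarith
        _ = _ := by ring
    -- No counting is needed here: the full double sum of `|G_t| |G_t'|` is `m²`.
    have hV : X ℓ ≤ A * 2 ^ ((j : ℝ) - ℓ * (((d : ℝ) - 1) / 2)) * m ^ 2 := by
      have e4 : δ⁻¹ * ((2 : ℝ) ^ ℓ) ^ (-(((d : ℝ) - 1) / 2)) =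
          2 ^ ((j : ℝ) - ℓ * (((d : ℝ) - 1) / 2)) := by
        have : δ⁻¹ = 2 ^ (j : ℝ) := by
          rw [Real.rpow_natCast]; simp only [δ]; rw [inv_pow, inv_inv]
        rw [this, ← Real.rpow_natCast 2 ℓ, ← Real.rpow_mul (by norm_num),
          ← Real.rpow_add (by norm_num)]
        congr 1; ring
      have e1 : X ℓ ≤ ∑ q ∈ (T ×ˢ T).filter (fun q => layer j q.1 q.2 = ℓ),
          A * 2 ^ ((j : ℝ) - ℓ * (((d : ℝ) - 1) / 2)) * (volume.real (G q.1) * volume.real (G q.2)) := by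
        refine Finset.sum_le_sum fun q hq => ?_
        rw [Finset.mem_filter, Finset.mem_product] at hq
        have := hpair2 q.1 q.2 hq.1.1 hq.1.2
        rwa [hq.2, e4] at this
      refine e1.trans ?_
      rw [← Finset.mul_sum]
      gcongr
      rw [sq, Finset.sum_mul_sum, ← Finset.sum_product (f := fun q : ℝ × ℝ => volume.real (G q.1) * volume.real (G q.2))]
      exact Finset.sum_le_sum_of_subset_of_nonneg (Finset.filter_subset _ _) fun q _ _ => by positivity
    have := le_interpolate (hX0 ℓ) (by positivity) hA0 hm hb0 hb1 hU hV
    refine this.trans ?_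
    gcongr ?_ * _
    gcongr ?_ * ?_
    apply Real.rpow_le_rpow_of_exponent_le (by norm_num)
    have hj0 : 0 ≤ (j : ℝ) * ε := by positivity
    have e5 : (-((j : ℝ) * ((d : ℝ) - 1)) + ((ℓ : ℝ) * γ + (j : ℝ) * ε)) * (2 * b) +
        ((j : ℝ) - ℓ * (((d : ℝ) - 1) / 2)) * (1 - 2 * b) =
        (j : ℝ) * (1 - 2 * b * d) + (j : ℝ) * ε * (2 * b) +
          ℓ * (γ * (2 * b) - ((d : ℝ) - 1) / 2 * (1 - 2 * b)) := by ring
    rw [e5, hbγ, sub_self, mul_zero, add_zero]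
    nlinarith
  rw [hexp]
  refine hsum.trans ((Finset.sum_le_sum hlayer).trans ?_)
  rw [Finset.sum_const, nsmul_eq_mul, Finset.card_range]
  push_cast
  calc ((j : ℝ) + 1) * (K * (2 : ℝ) ^ ((j : ℝ) * (1 - 2 * b * d + ε)) * m ^ (2 - 2 * b))
      ≤ (B * (2 : ℝ) ^ ((j : ℝ) * ε)) * (K * (2 : ℝ) ^ ((j : ℝ) * (1 - 2 * b * d + ε)) * m ^ (2 - 2 * b)) := by
        gcongr; exact hB j
    _ = B * K * ((2 : ℝ) ^ ((j : ℝ) * ε) * (2 : ℝ) ^ ((j : ℝ) * (1 - 2 * b * d + ε))) * m ^ (2 - 2 * b) := by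
        ring
    _ = _ := by
        rw [← Real.rpow_add (by norm_num)]
        congr 3; ring

/-- By duality with `g_t` the sign of `k_t * f` on `G_t`, the left side becomes the pairing of `f`
with `∑ k_t * g_t`. Cauchy–Schwarz then splits off `|F|^(1/2)`. -/
lemma restrictedBound_ttExponent [hd : Fact (2 ≤ d)] {E : Set ℝ} (hE : E ⊆ Icc 1 2)
    {C R γ ε : ℝ} (hC : 0 ≤ C) (hR : 0 ≤ R) (hγ : 0 ≤ γ) (hε : 0 < ε) (hN : LocalCardBound E γ ε) :
    RestrictedBound d E C R (1 / 2) (ttExponent d γ) (1 / 2 - d * ttExponent d γ + ε) := by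
  obtain ⟨A, hA0, hA⟩ := exists_integral_sq_sum_conv_le (d := d) hE hC hR hγ hε hN
  set b := ttExponent d γ with hb
  have h2d : (2 : ℝ) ≤ d := by exact_mod_cast hd.out
  have hb1 : b ≤ 1 := by
    rw [hb, ttExponent, div_le_one (by linarith)]
    linarith
  refine ⟨by norm_num, hb1, (√A).toNNReal, ?_⟩
  intro j T k hfam f F G hf hF hF' hfF hG hG'
  have hn := isNice_of_le_indicator hf hF hF' hfF
  have hkn : ∀ t ∈ T, IsNice (k t) := fun t ht => by
    obtain ⟨s, -, hk⟩ := hfam.ker t ht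
    exact hk.isNice
  have hkc : ∀ t ∈ T, Measurable (conv (k t) f) := fun t ht => by
    obtain ⟨s, -, hk⟩ := hfam.ker t ht
    exact (conv_continuous hk.cont hk.hasCompactSupport hn.int).measurable
  set g : ℝ → Space d → ℝ := fun t => if t ∈ T then
    (G t).indicator (fun x => if 0 ≤ conv (k t) f x then 1 else -1) else 0
  have hgm (t) : Measurable (g t) := by
    simp only [g]
    split_ifs with ht
    · refine Measurable.indicator ?_ (hG t)
      exact Measurable.ite (measurableSet_le measurable_const (hkc t ht)) measurable_const
        measurable_const
    · exact measurable_const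
  have hgG (t) (x) : |g t x| ≤ (G t).indicator 1 x := by
    simp only [g]
    split_ifs with ht
    · by_cases hx : x ∈ G t
      · simp only [indicator_of_mem hx, Pi.one_apply]
        split_ifs <;> simp
      · simp [indicator_of_notMem hx]
    · simp only [Pi.zero_apply, abs_zero]
      exact indicator_nonneg (fun _ _ => zero_le_one) x
  have hgn (t) : IsNice (g t) := isNice_of_le_indicator (hgm t) (hG t) (hG' t) (hgG t)
  have hH : IsNice (fun x => ∑ t ∈ T, conv (k t) (g t) x) := by
    refine ⟨integrable_finsetSum _ fun t ht => ((hkn t ht).conv (hgn t).int).int, ?_⟩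
    have : ∀ t ∈ T, ∃ M, ∀ x, |conv (k t) (g t) x| ≤ M := fun t ht => ((hkn t ht).conv (hgn t).int).bdd
    choose! M hM using this
    exact ⟨∑ t ∈ T, M t, fun x => (Finset.abs_sum_le_sum_abs _ _).trans
      (Finset.sum_le_sum fun t ht => hM t ht x)⟩
  have hS1 : ∀ t ∈ T, ∫⁻ x in G t, ‖conv (k t) f x‖ₑ = ENNReal.ofReal (∫ x, conv (k t) (g t) x * f x) := by
    intro t ht
    obtain ⟨s, -, hk⟩ := hfam.ker t ht
    have hc := (hkn t ht).conv hn.int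
    rw [← integral_mul_conv (hkn t ht).int (hgn t) hn.int hk.even,
      ← ofReal_integral_norm_eq_lintegral_enorm hc.int.integrableOn, ← integral_indicator (hG t)]
    congr 2
    ext x
    simp only [g, ht, if_true]
    by_cases hx : x ∈ G t
    · simp only [indicator_of_mem hx]
      split_ifs with h0
      · rw [Real.norm_of_nonneg h0, one_mul]
      · rw [Real.norm_of_nonpos (by linarith)]; ring
    · simp [indicator_of_notMem hx]
  have hpos : ∀ t ∈ T, 0 ≤ ∫ x, conv (k t) (g t) x * f x := by
    intro t ht
    obtain ⟨s, -, hk⟩ := hfam.ker t ht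
    rw [← integral_mul_conv (hkn t ht).int (hgn t) hn.int hk.even]
    refine integral_nonneg fun x => ?_
    simp only [g, ht, if_true]
    by_cases hx : x ∈ G t
    · simp only [indicator_of_mem hx]
      split_ifs with h0
      · simpa using h0
      · push Not at h0
        simp only [Pi.zero_apply]; linarith
    · simp [indicator_of_notMem hx]
  rw [Finset.sum_congr rfl hS1, ← ENNReal.ofReal_sum_of_nonneg hpos]
  have hS2 : ∑ t ∈ T, ∫ x, conv (k t) (g t) x * f x = ∫ x, f x * ∑ t ∈ T, conv (k t) (g t) x := by
    rw [← integral_finsetSum _ fun t ht => integrable_mul_of_isNice ((hkn t ht).conv (hgn t).int) hn]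
    congr 1; ext x
    rw [Finset.mul_sum]
    simp_rw [mul_comm]
  rw [hS2]
  have hsq := sq_integral_mul_le hn hH
  have h3 := integral_sq_le_of_le_indicator hF hF' hfF
  have h4 := hA j T k hfam g G hgm hG hG' hgG
  set m := ∑ t ∈ T, volume.real (G t)
  have hm : 0 ≤ m := Finset.sum_nonneg fun t _ => measureReal_nonneg
  have hb2 : 0 ≤ 1 - b := by linarith
  set Z := √A * 2 ^ ((j : ℝ) * (1 / 2 - d * b + ε)) * volume.real F ^ (1 / 2 : ℝ) * m ^ (1 - b)
  have hZ : 0 ≤ Z := by positivity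
  have h5 : ∫ x, f x * ∑ t ∈ T, conv (k t) (g t) x ≤ Z := by
    apply le_of_sq_le_sq _ hZ
    refine hsq.trans ?_
    calc _ ≤ volume.real F * (A * (2 : ℝ) ^ ((j : ℝ) * (1 - 2 * b * d + 2 * ε)) * m ^ (2 - 2 * b)) := by
          gcongr
      _ = Z ^ 2 := by
          simp only [Z]
          rw [mul_pow, mul_pow, mul_pow, Real.sq_sqrt hA0, ← Real.rpow_natCast (2 ^ _),
            ← Real.rpow_mul (by norm_num), ← Real.rpow_natCast (volume.real F ^ _),
            ← Real.rpow_mul measureReal_nonneg, ← Real.rpow_natCast (m ^ _), ← Real.rpow_mul hm]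
          have q1 : (j : ℝ) * (1 / 2 - d * b + ε) * ((2 : ℕ) : ℝ) = (j : ℝ) * (1 - 2 * b * d + 2 * ε) := by
            push_cast; ring
          have q2 : (1 / 2 : ℝ) * ((2 : ℕ) : ℝ) = 1 := by norm_num
          have q3 : (1 - b) * ((2 : ℕ) : ℝ) = 2 - 2 * b := by push_cast; ring
          rw [q1, q2, q3, Real.rpow_one]
          ring
  refine (ENNReal.ofReal_le_ofReal h5).trans (le_of_eq ?_)
  have hmE : ENNReal.ofReal m = ∑ t ∈ T, volume (G t) := by
    simp only [m]
    rw [ENNReal.ofReal_sum_of_nonneg fun t _ => measureReal_nonneg]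
    exact Finset.sum_congr rfl fun t _ => ENNReal.ofReal_toReal (hG' t)
  simp only [Z]
  rw [ENNReal.ofReal_mul (by positivity), ENNReal.ofReal_mul (by positivity),
    ENNReal.ofReal_mul (by positivity), ofReal_two_rpow,
    ← ENNReal.ofReal_rpow_of_nonneg measureReal_nonneg (by norm_num),
    ← ENNReal.ofReal_rpow_of_nonneg hm hb2, hmE, Measure.real, ENNReal.ofReal_toReal hF']
  rfl

end TTStar

/-! ### From covering numbers and dimensions to cardinalities of separated sets. -/

section Counting

lemma intervalCoveringNumber_inter_Icc_le (E : Set ℝ) (a : ℝ) {ℓ δ : ℝ} (hℓ : 0 ≤ ℓ) (hδ : 0 < δ) :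
    (intervalCoveringNumber (E ∩ Icc a (a + ℓ)) δ : ℝ≥0∞) ≤ ENNReal.ofReal (ℓ / δ + 1) := by
  set n := ⌊ℓ / δ⌋₊ + 1
  set N : Finset ℝ := (Finset.range n).image fun i : ℕ => a + (i + 1 / 2) * δ
  have hcov : IsCover (δ / 2).toNNReal (E ∩ Icc a (a + ℓ)) (N : Set ℝ) := by
    rw [isCover_iff_subset_iUnion_closedBall]
    rintro x ⟨-, hx⟩
    have h0 : 0 ≤ (x - a) / δ := div_nonneg (by linarith [hx.1]) hδ.le
    have h1 := Nat.floor_le h0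
    have h2 := Nat.lt_floor_add_one ((x - a) / δ)
    rw [le_div_iff₀ hδ] at h1
    rw [div_lt_iff₀ hδ] at h2
    simp only [mem_iUnion]
    refine ⟨a + (⌊(x - a) / δ⌋₊ + 1 / 2) * δ, ?_, ?_⟩
    · rw [Finset.mem_coe, Finset.mem_image]
      refine ⟨_, ?_, rfl⟩
      rw [Finset.mem_range]
      refine Nat.lt_succ_of_le (Nat.floor_le_floor ?_)
      gcongr
      linarith [hx.2]
    · rw [mem_closedBall, Real.dist_eq, Real.coe_toNNReal _ (by positivity), abs_le]
      constructor <;> nlinarith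
  have h1 : intervalCoveringNumber (E ∩ Icc a (a + ℓ)) δ ≤ n := by
    refine hcov.externalCoveringNumber_le_encard.trans ?_
    rw [Set.encard_coe_eq_coe_finsetCard]
    exact_mod_cast Finset.card_image_le.trans (Finset.card_range n).le
  calc (intervalCoveringNumber (E ∩ Icc a (a + ℓ)) δ : ℝ≥0∞) ≤ ((n : ℕ∞) : ℝ≥0∞) := by
        exact_mod_cast h1
    _ = ENNReal.ofReal n := by simp
    _ ≤ _ := by
        apply ENNReal.ofReal_le_ofReal
        push_cast [n]
        gcongr
        exact Nat.floor_le (by positivity)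

lemma inv_le_rpow_of_le_one {x ε : ℝ} (hx : 0 < x) (hx1 : x ≤ 1) (hε : 0 ≤ ε) :
    x⁻¹ ≤ x ^ (-1 - ε) := by
  rw [← Real.rpow_neg_one]
  exact Real.rpow_le_rpow_of_exponent_ge hx hx1 (by linarith)

/-- Exponent `1` is always admissible, so the infimum defining the dimension is over a nonempty set.
`assouadBound_one` has the same purpose. -/
lemma minkowskiBound_one {E : Set ℝ} (hE : E ⊆ Icc 1 2) : MinkowskiBound E 1 := by
  intro ε hε
  refine ⟨2, fun δ hδ hδ1 => ?_⟩
  have h := intervalCoveringNumber_inter_Icc_le E 1 zero_le_one hδ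
  rw [inter_eq_left.2 (hE.trans (by norm_num))] at h
  refine h.trans (ENNReal.ofReal_le_ofReal ?_)
  have := inv_le_rpow_of_le_one hδ hδ1.le hε.le
  have h1 : 1 ≤ δ⁻¹ := (one_le_inv₀ hδ).2 hδ1.le
  rw [one_div]; linarith

lemma assouadBound_one (E : Set ℝ) : AssouadBound E 1 := by
  refine ⟨1, one_pos, fun ε hε => ⟨2, fun δ hδ _ a ℓ hℓ _ => ?_⟩⟩
  have hℓ0 : 0 < ℓ := hδ.trans hℓ
  refine (intervalCoveringNumber_inter_Icc_le E a hℓ0.le hδ).trans (ENNReal.ofReal_le_ofReal ?_)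
  have hr : δ / ℓ ≤ 1 := (div_le_one hℓ0).2 hℓ.le
  have := inv_le_rpow_of_le_one (by positivity) hr hε.le
  have h1 : 1 ≤ (δ / ℓ)⁻¹ := (one_le_inv₀ (by positivity)).2 hr
  rw [inv_div] at *
  linarith

/-- An interval of half the separation contains at most one point of the set. Halving also turns the
weak separation inequality into the strict one required by `IsSeparated`. -/
lemma card_le_intervalCoveringNumber {A : Set ℝ} {T : Finset ℝ} {j : ℕ} (hT : ∀ t ∈ T, t ∈ A)
    (hsep : ∀ t ∈ T, ∀ t' ∈ T, t ≠ t' → (2⁻¹ : ℝ) ^ j ≤ |t - t'|) :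
    (T.card : ℝ≥0∞) ≤ intervalCoveringNumber A ((2⁻¹ : ℝ) ^ (j + 1)) := by
  have hs : IsSeparated ((2 * ((2⁻¹ : ℝ) ^ (j + 1) / 2).toNNReal : ℝ≥0) : ℝ≥0∞) (T : Set ℝ) := by
    intro t ht t' ht' hne
    have := hsep t ht t' ht' hne
    rw [edist_dist, Real.dist_eq, ← ENNReal.ofReal_coe_nnreal, ENNReal.ofReal_lt_ofReal_iff_of_nonneg
      (by positivity)]
    push_cast
    rw [Real.coe_toNNReal _ (by positivity)]
    have hp : 0 < (2⁻¹ : ℝ) ^ j := by positivity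
    rw [pow_succ]
    linarith
  have h := (hs.encard_le_packingNumber (A := A) hT).trans
    (packingNumber_two_mul_le_externalCoveringNumber _ _)
  rw [Set.encard_coe_eq_coe_finsetCard] at h
  have h' : ((T.card : ℕ∞) : ℝ≥0∞) ≤ intervalCoveringNumber A ((2⁻¹ : ℝ) ^ (j + 1)) := by
    exact_mod_cast h
  simpa using h'

lemma cardBound_of_minkowskiDim {E : Set ℝ} (hE : E ⊆ Icc 1 2) {ε : ℝ} (hε : 0 < ε) :
    CardBound E (minkowskiDim E + ε) := by
  obtain ⟨β, ⟨-, hβ⟩, hlt⟩ := exists_lt_of_csInf_lt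
    (s := {β : ℝ | 0 ≤ β ∧ MinkowskiBound E β}) ⟨1, zero_le_one, minkowskiBound_one hE⟩
    (show minkowskiDim E < minkowskiDim E + ε by linarith)
  set e := minkowskiDim E + ε
  obtain ⟨C, hC⟩ := hβ (e - β) (by linarith)
  refine ⟨(C * 2 ^ e).toNNReal, fun j T hT hsep => ?_⟩
  have h := (card_le_intervalCoveringNumber hT hsep).trans
    (hC ((2⁻¹ : ℝ) ^ (j + 1)) (by positivity) (pow_lt_one₀ (by norm_num) (by norm_num) (by simp)))
  have e1 : ((2⁻¹ : ℝ) ^ (j + 1)) ^ (-β - (e - β)) = 2 ^ e * 2 ^ ((j : ℝ) * e) := by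
    rw [inv_two_pow_rpow, ← Real.rpow_add (by norm_num)]
    congr 1; push_cast; ring
  rw [e1, ← mul_assoc, ENNReal.ofReal_mul' (by positivity), ofReal_two_rpow] at h
  exact h

/-- The Assouad bound is available only for intervals shorter than `δ₀`. At larger distances `2^j`
is bounded by a multiple of `2^ℓ`, and the global count with exponent `γ + ε` suffices. -/
lemma localCardBound_of_assouadDim {E : Set ℝ} (hγ : 0 ≤ assouadDim E) {ε : ℝ} (hε : 0 < ε)
    (hcard : CardBound E (assouadDim E + ε)) : LocalCardBound E (assouadDim E) ε := by
  obtain ⟨γ', ⟨-, hγ'⟩, hlt⟩ := exists_lt_of_csInf_lt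
    (s := {γ : ℝ | 0 ≤ γ ∧ AssouadBound E γ}) ⟨1, zero_le_one, assouadBound_one E⟩
    (show assouadDim E < assouadDim E + ε by linarith)
  set γ := assouadDim E
  obtain ⟨δ₀, hδ₀, hA⟩ := hγ'
  obtain ⟨C, hC⟩ := hA (γ + ε - γ') (by linarith)
  obtain ⟨N, hN⟩ := hcard
  refine ⟨max C 0 * 2 ^ (3 * (γ + ε)) + N * (4 / δ₀) ^ γ, by positivity, ?_⟩
  intro j T hT hsep ℓ hℓj t ht
  set r : ℝ := 2 ^ (ℓ + 1) * (2⁻¹ : ℝ) ^ j with hr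
  set T' := T.filter (fun t' => |t - t'| < r)
  have hℓj' : (ℓ : ℝ) ≤ j := by exact_mod_cast hℓj
  set X : ℝ := (2 : ℝ) ^ ((ℓ : ℝ) * γ + (j : ℝ) * ε) with hX
  have hX0 : 0 < X := by positivity
  have hp : 0 < (2⁻¹ : ℝ) ^ j := by positivity
  rcases lt_or_ge (2 * r) δ₀ with hlt' | hge
  · have hδr : (2⁻¹ : ℝ) ^ (j + 1) < 2 * r := by
      have : (1 : ℝ) ≤ 2 ^ (ℓ + 1) := one_le_pow₀ (by norm_num)
      rw [hr, pow_succ]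
      nlinarith
    have h := (card_le_intervalCoveringNumber (A := E ∩ Icc (t - r) (t - r + 2 * r)) (T := T') (j := j)
      (fun t' ht' => by
        rw [Finset.mem_filter] at ht'
        have := abs_lt.1 ht'.2
        exact ⟨hT t' ht'.1, by constructor <;> linarith⟩)
      (fun s hs s' hs' => hsep s (Finset.mem_filter.1 hs).1 s' (Finset.mem_filter.1 hs').1)).trans
      (hC _ (by positivity) (hδr.trans hlt') _ _ hδr hlt')
    -- Covering scale `2^(-(j+1))` against interval length `2r = 2^(ℓ+2-j)`; the shift by `3` goes
    -- into the constant `2^(3(γ+ε))`.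
    have e1 : (2⁻¹ : ℝ) ^ (j + 1) / (2 * r) = (2⁻¹ : ℝ) ^ (ℓ + 3) := by
      have : (2 : ℝ) ^ ℓ * (2⁻¹) ^ ℓ = 1 := by rw [← mul_pow]; norm_num
      rw [hr, div_eq_iff (by positivity)]
      linear_combination (-(1 / 2) * (2⁻¹ : ℝ) ^ j) * this
    rw [e1, inv_two_pow_rpow] at h
    have h' : (T'.card : ℝ) ≤ max C 0 * 2 ^ (-(((ℓ + 3 : ℕ) : ℝ) * (-γ' - (γ + ε - γ')))) := by
      have h2 := h.trans (ENNReal.ofReal_le_ofReal (mul_le_mul_of_nonneg_right (le_max_left C 0)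
        (by positivity)))
      rw [← ENNReal.ofReal_natCast, ENNReal.ofReal_le_ofReal_iff (by positivity)] at h2
      exact h2
    have e3 : (2 : ℝ) ^ (-(((ℓ + 3 : ℕ) : ℝ) * (-γ' - (γ + ε - γ')))) ≤ 2 ^ (3 * (γ + ε)) * X := by
      rw [hX, ← Real.rpow_add (by norm_num)]
      apply Real.rpow_le_rpow_of_exponent_le (by norm_num)
      push_cast
      nlinarith
    calc (T'.card : ℝ) ≤ max C 0 * (2 ^ (3 * (γ + ε)) * X) := h'.trans (by gcongr)
      _ ≤ _ := by
        rw [add_mul, mul_assoc]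
        have : 0 ≤ N * (4 / δ₀) ^ γ * X := by positivity
        linarith
  · have h1 : (T'.card : ℝ) ≤ N * 2 ^ ((j : ℝ) * (γ + ε)) := by
      have h2 := hN j T hT hsep
      rw [← ofReal_two_rpow, ← ENNReal.ofReal_natCast, ← ENNReal.ofReal_coe_nnreal,
        ← ENNReal.ofReal_mul (by positivity), ENNReal.ofReal_le_ofReal_iff (by positivity)] at h2
      refine le_trans ?_ h2
      exact_mod_cast Finset.card_filter_le _ _
    have h2 : (2 : ℝ) ^ (j : ℝ) ≤ 4 / δ₀ * 2 ^ (ℓ : ℝ) := by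
      rw [Real.rpow_natCast, Real.rpow_natCast, div_mul_eq_mul_div, le_div_iff₀ hδ₀]
      have e : (2 : ℝ) ^ j * (2⁻¹) ^ j = 1 := by rw [← mul_pow]; norm_num
      calc (2 : ℝ) ^ j * δ₀ ≤ 2 ^ j * (2 * r) := by gcongr
        _ = 4 * 2 ^ ℓ := by rw [hr]; linear_combination (4 * 2 ^ ℓ) * e
    have h3 : (2 : ℝ) ^ ((j : ℝ) * (γ + ε)) ≤ (4 / δ₀) ^ γ * X := by
      have := Real.rpow_le_rpow (by positivity) h2 hγ
      rw [Real.mul_rpow (by positivity) (by positivity), ← Real.rpow_mul (by norm_num),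
        ← Real.rpow_mul (by norm_num)] at this
      rw [hX, mul_add, Real.rpow_add (by norm_num), Real.rpow_add (by norm_num), ← mul_assoc]
      gcongr
    calc (T'.card : ℝ) ≤ N * ((4 / δ₀) ^ γ * X) := h1.trans (by gcongr)
      _ ≤ _ := by
        rw [add_mul, ← mul_assoc]
        have : 0 ≤ max C 0 * 2 ^ (3 * (γ + ε)) * X := by positivity
        linarith

/-- A maximal separated subset of `E` is automatically a net, and it is finite because `E` has
finite covering numbers. -/
lemma exists_separated_net {E : Set ℝ} (hE : E ⊆ Icc 1 2) (j : ℕ) :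
    ∃ T : Finset ℝ, (∀ t ∈ T, t ∈ E) ∧
      (∀ t ∈ T, ∀ t' ∈ T, t ≠ t' → (2⁻¹ : ℝ) ^ j ≤ |t - t'|) ∧
      ∀ t ∈ E, ∃ t' ∈ T, |t - t'| ≤ (2⁻¹ : ℝ) ^ j := by
  set δ : ℝ := (2⁻¹ : ℝ) ^ j
  have hδ : 0 < δ := by positivity
  have hpk : packingNumber δ.toNNReal E ≠ ⊤ := by
    intro htop
    have h1 := packingNumber_two_mul_le_externalCoveringNumber (δ / 2).toNNReal E
    have e : 2 * (δ / 2).toNNReal = δ.toNNReal := by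
      rw [← Real.toNNReal_ofNat, ← Real.toNNReal_mul (by norm_num)]; congr 1; ring
    rw [e, htop, top_le_iff] at h1
    have h2 := intervalCoveringNumber_inter_Icc_le E 1 zero_le_one hδ
    rw [inter_eq_left.2 (hE.trans (by norm_num)), intervalCoveringNumber, h1] at h2
    simp at h2
  have hfin : (maximalSeparatedSet δ.toNNReal E).Finite := by
    rw [← Set.encard_ne_top_iff, encard_maximalSeparatedSet hpk]
    exact hpk
  refine ⟨hfin.toFinset, fun t ht => maximalSeparatedSet_subset (hfin.mem_toFinset.1 ht), ?_, ?_⟩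
  · intro t ht t' ht' hne
    have h := isSeparated_maximalSeparatedSet (ε := δ.toNNReal) (A := E) (hfin.mem_toFinset.1 ht)
      (hfin.mem_toFinset.1 ht') hne
    beta_reduce at h
    rw [edist_dist, Real.dist_eq] at h
    change ENNReal.ofReal δ < _ at h
    exact ((ENNReal.ofReal_lt_ofReal_iff_of_nonneg hδ.le).1 h).le
  · intro t ht
    have h := isCover_iff_subset_iUnion_closedBall.1 (isCover_maximalSeparatedSet hpk) ht
    simp only [mem_iUnion] at h
    obtain ⟨t', ht', h'⟩ := h
    refine ⟨t', hfin.mem_toFinset.2 ht', ?_⟩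
    rwa [mem_closedBall, Real.dist_eq, Real.coe_toNNReal _ hδ.le] at h'

end Counting

/-! ### Interpolation over the quadrangle. -/

section Region

variable {d : ℕ}

/-- Restricted bounds with growth exponent arbitrarily close to `e`. -/
def AsymptoticBound (d : ℕ) (E : Set ℝ) (C R a b e : ℝ) : Prop :=
  ∀ ε > 0, RestrictedBound d E C R a b (e + ε)

variable {E : Set ℝ} {C R : ℝ}

lemma AsymptoticBound.interpolate {a₀ b₀ e₀ a₁ b₁ e₁ : ℝ}
    (h₀ : AsymptoticBound d E C R a₀ b₀ e₀) (h₁ : AsymptoticBound d E C R a₁ b₁ e₁) (s : ℝ)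
    (hs0 : 0 ≤ s) (hs1 : s ≤ 1) {a b e : ℝ} (ha : (1 - s) * a₀ + s * a₁ = a)
    (hb : (1 - s) * b₀ + s * b₁ = b) (he : (1 - s) * e₀ + s * e₁ = e) :
    AsymptoticBound d E C R a b e := by
  intro ε hε
  have h := (h₀ ε hε).interpolate (h₁ ε hε) hs0 hs1
  rw [ha, hb] at h
  convert h using 1
  rw [← he]; ring

/-- Bounds at the five exponents between which everything else is interpolated. -/
structure VertexBounds (d : ℕ) (E : Set ℝ) (C R β γ : ℝ) : Prop where
  zero_zero : AsymptoticBound d E C R 0 0 0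
  one_zero : AsymptoticBound d E C R 1 0 1
  one_one : AsymptoticBound d E C R 1 1 β
  half_half : AsymptoticBound d E C R (1 / 2) (1 / 2) ((β - ((d : ℝ) - 1)) / 2)
  half_tt : AsymptoticBound d E C R (1 / 2) (ttExponent d γ) (1 / 2 - d * ttExponent d γ)

lemma RestrictedBound.mono {a b e e' : ℝ} (h : RestrictedBound d E C R a b e) (hee' : e ≤ e') :
    RestrictedBound d E C R a b e' := by
  obtain ⟨ha, hb, A, hA⟩ := h
  refine ⟨ha, hb, A, fun j T k hfam f F G hf hF hF' hfF hG hG' =>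
    (hA j T k hfam f F G hf hF hF' hfF hG hG').trans ?_⟩
  gcongr
  norm_num

lemma vertexBounds [hd : Fact (2 ≤ d)] (hE : E ⊆ Icc 1 2) (hC : 0 ≤ C) (hR : 0 ≤ R)
    (hγ0 : 0 ≤ assouadDim E) (hβγ : minkowskiDim E ≤ assouadDim E) :
    VertexBounds d E C R (minkowskiDim E) (assouadDim E) where
  zero_zero ε hε := restrictedBound_zero_zero.mono (by linarith)
  one_zero ε hε := (restrictedBound_one_zero hC).mono (by linarith)
  one_one ε hε := restrictedBound_one_one hC (cardBound_of_minkowskiDim hE hε)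
  half_half ε hε := by
    -- The loss is doubled beforehand because the exponent of the count is halved by Cauchy–Schwarz.
    have := restrictedBound_half_half (d := d) (R := R) hC
      (cardBound_of_minkowskiDim hE (mul_pos two_pos hε))
    convert this using 1
    ring
  half_tt ε hε := by
    refine restrictedBound_ttExponent hE hC hR hγ0 hε (localCardBound_of_assouadDim hγ0 hε ?_)
    -- The inequality `β ≤ γ` turns the Minkowski count into one with exponent `γ + ε`, as needed at
    -- coarse scales.
    have := cardBound_of_minkowskiDim hE (ε := assouadDim E - minkowskiDim E + ε) (by linarith)
    convert this using 1
    ring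

variable {β γ : ℝ}

/-- The set on the right is convex, so the vertices suffice. There the positive exponent of one
known estimate cancels the nonpositive exponent of another: `Q₂` lies between `(1/2,1/2)` and
`(1,1)`, `Q₃` between `(1,0)` and `(1/2,1/2)`, `Q₄` between `(1,0)` and the `TT*` point. The
condition `2γ ≤ (d-1)²` says that the weight for `Q₄` is at most one. -/
lemma VertexBounds.quadrangle_subset (h : VertexBounds d E C R β γ) (hd : 2 ≤ d) (hβ : 0 ≤ β)
    (hβd : β < (d : ℝ) - 1) (hγ : 0 ≤ γ) (hγd : 2 * γ ≤ ((d : ℝ) - 1) ^ 2) :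
    quadrangle d β γ ⊆ {z | AsymptoticBound d E C R z.1 z.2 0 ∧ z.1 ≤ 1 ∧ 0 ≤ z.2 ∧ z.2 ≤ z.1} := by
  have h2 : (2 : ℝ) ≤ d := by exact_mod_cast hd
  apply convexHull_min
  · have hQ2 : 0 < (d : ℝ) - 1 + β := by linarith
    have hQ3 : 0 < (d : ℝ) - β + 1 := by linarith
    have hQ4 : 0 < (d : ℝ) ^ 2 + 2 * γ - 1 := by nlinarith
    have hb5 : 0 < (d : ℝ) - 1 + 2 * γ := by linarith
    rintro z (rfl | rfl | rfl | rfl)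
    · exact ⟨h.zero_zero, by simp [Q₁]⟩
    · refine ⟨?_, (div_le_one hQ2).2 (by linarith), div_nonneg (by linarith) hQ2.le, le_rfl⟩
      refine h.half_half.interpolate h.one_one (2 * (((d : ℝ) - 1) / (d - 1 + β)) - 1) ?_ ?_ ?_ ?_ ?_
      · rw [sub_nonneg, ← mul_div_assoc, le_div_iff₀ hQ2]; linarith
      · rw [sub_le_iff_le_add, ← mul_div_assoc, div_le_iff₀ hQ2]; linarith
      · simp only [Q₂]; ring
      · simp only [Q₂]; ring
      · field_simp; ring
    · refine ⟨?_, (div_le_one hQ3).2 (by linarith), div_nonneg (by linarith) hQ3.le,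
        div_le_div_of_nonneg_right (by linarith) hQ3.le⟩
      refine h.one_zero.interpolate h.half_half (2 / ((d : ℝ) - β + 1)) ?_ ?_ ?_ ?_ ?_
      · positivity
      · rw [div_le_one hQ3]; linarith
      · simp only [Q₃]; field_simp; ring
      · simp only [Q₃]; field_simp; ring
      · field_simp; ring
    · refine ⟨?_, (div_le_one hQ4).2 (by nlinarith), div_nonneg (by linarith) hQ4.le,
        div_le_div_of_nonneg_right (by nlinarith) hQ4.le⟩
      refine h.one_zero.interpolate h.half_tt
        (2 * ((d : ℝ) - 1 + 2 * γ) / (d ^ 2 + 2 * γ - 1)) ?_ ?_ ?_ ?_ ?_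
      · positivity
      · rw [div_le_one hQ4]; nlinarith
      · simp only [Q₄]; field_simp; ring
      · simp only [Q₄, ttExponent]; field_simp; ring
      · simp only [ttExponent]; field_simp; ring
  · rintro x ⟨hx, hx1, hx2, hx3⟩ y ⟨hy, hy1, hy2, hy3⟩ s t hs ht hst
    have hs' : s = 1 - t := by linarith
    subst hs'
    refine ⟨hx.interpolate hy t ht (by linarith) ?_ ?_ ?_, ?_, ?_, ?_⟩
    all_goals simp
    · nlinarith
    · positivity
    · nlinarith

/-- On the diagonal the exponent is piecewise linear and crosses zero only at `Q₂`. An interior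
point lies strictly between `(1/2,1/2)`, where the exponent is negative, and another point of the
quadrangle, where it is zero. -/
lemma VertexBounds.exists_neg (h : VertexBounds d E C R β γ) (hd : 2 ≤ d) (hβ : 0 ≤ β)
    (hβd : β < (d : ℝ) - 1) (hγ : 0 ≤ γ) (hγd : 2 * γ ≤ ((d : ℝ) - 1) ^ 2) {a b : ℝ}
    (hab : (a, b) ∈ region d β γ) (hne : a ≠ 0) :
    0 < b ∧ b ≤ a ∧ a < 1 ∧ ∃ e < 0, AsymptoticBound d E C R a b e := by
  have h2 : (2 : ℝ) ≤ d := by exact_mod_cast hd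
  have he4 : (β - ((d : ℝ) - 1)) / 2 < 0 := by linarith
  rcases hab with hab | hab
  · obtain ⟨hseg, hne2⟩ := hab
    rw [segment_eq_image'] at hseg
    obtain ⟨θ, ⟨hθ0, hθ1⟩, hθ⟩ := hseg
    have hQ2 : 0 < (d : ℝ) - 1 + β := by linarith
    set m := ((d : ℝ) - 1) / (d - 1 + β) with hm
    have hm1 : m ≤ 1 := (div_le_one hQ2).2 (by linarith)
    have hm0 : 0 < m := div_pos (by linarith) hQ2
    simp only [Q₁, Q₂, ← hm, Prod.mk_sub_mk, sub_zero, Prod.smul_mk, smul_eq_mul, Prod.mk_add_mk,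
      zero_add, Prod.mk.injEq] at hθ
    obtain ⟨rfl, rfl⟩ := hθ
    have hθlt : θ < 1 := by
      refine lt_of_le_of_ne hθ1 fun h1 => hne2 ?_
      simp [h1, Q₂, ← hm]
    have hθpos : 0 < θ := lt_of_le_of_ne hθ0 fun h0 => hne (by simp [← h0])
    have hlt : θ * m < m := by nlinarith
    set a := θ * m
    have ha0 : 0 < a := by positivity
    refine ⟨ha0, le_rfl, by linarith, ?_⟩
    rcases le_or_gt a (1 / 2) with ha | ha
    · exact ⟨_, by nlinarith, h.zero_zero.interpolate h.half_half (2 * a) (by linarith) (by linarith)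
        (by ring) (by ring) rfl⟩
    · refine ⟨_, ?_, h.half_half.interpolate h.one_one (2 * a - 1) (by linarith) (by linarith)
        (by ring) (by ring) rfl⟩
      have : a * (d - 1 + β) < (d : ℝ) - 1 := by rwa [hm, lt_div_iff₀ hQ2] at hlt
      linarith
  -- The point is pushed slightly away from `(1/2,1/2)` inside the quadrangle and then recovered by
  -- interpolating back. The pushed point also yields the strict inequalities `0 < b` and `a < 1`.
  · have hcont : Continuous fun τ : ℝ => ((a + τ * (a - 1 / 2), b + τ * (b - 1 / 2)) : ℝ × ℝ) := by
      fun_prop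
    have hmem : ∀ᶠ τ in 𝓝 (0 : ℝ), (a + τ * (a - 1 / 2), b + τ * (b - 1 / 2)) ∈ quadrangle d β γ := by
      refine hcont.continuousAt.preimage_mem_nhds ?_
      simpa using mem_interior_iff_mem_nhds.1 hab
    obtain ⟨τ, hτ, hτ0⟩ := ((hmem.filter_mono nhdsWithin_le_nhds).and
      (self_mem_nhdsWithin : Ioi (0 : ℝ) ∈ 𝓝[>] 0)).exists
    have hsub := h.quadrangle_subset hd hβ hβd hγ hγd
    obtain ⟨hA, h1, h2, h3⟩ := hsub hτ
    simp only at h1 h2 h3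
    refine ⟨by nlinarith, (hsub (interior_subset hab)).2.2.2, by nlinarith, _, ?_,
      hA.interpolate h.half_half (τ / (1 + τ)) (by positivity) ?_ ?_ ?_ rfl⟩
    · have : 0 < τ / (1 + τ) := by positivity
      nlinarith
    · rw [div_le_one (by positivity)]; linarith
    · field_simp; ring
    · field_simp; ring

/-- A small move towards `(1,0)` increases `a` and decreases `b` while the exponent stays negative.
These strict inequalities are what later makes the sums over levels of `f` and of the maximal
function converge. -/
lemma VertexBounds.exists_restrictedBound (h : VertexBounds d E C R β γ) (hd : 2 ≤ d) (hβ : 0 ≤ β)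
    (hβd : β < (d : ℝ) - 1) (hγ : 0 ≤ γ) (hγd : 2 * γ ≤ ((d : ℝ) - 1) ^ 2) {a b : ℝ}
    (hab : (a, b) ∈ region d β γ) (hne : a ≠ 0) :
    0 < b ∧ b ≤ a ∧ ∃ a' b' e, a < a' ∧ a' ≤ 1 ∧ 0 < b' ∧ b' < b ∧ e < 0 ∧
      RestrictedBound d E C R a' b' e := by
  obtain ⟨hb, hba, ha, e, he, hA⟩ := h.exists_neg hd hβ hβd hγ hγd hab hne
  refine ⟨hb, hba, ?_⟩
  -- With this weight the interpolated exponent is `e / 2`; the loss `-e / 4` chosen below leaves `e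
  -- / 4 < 0`.
  set s := -e / (2 * (1 - e)) with hs
  have h1 : 0 < 1 - e := by linarith
  have hs0 : 0 < s := div_pos (by linarith) (by linarith)
  have hs1 : s < 1 := by rw [hs, div_lt_one (by linarith)]; linarith
  have hse : s * (1 - e) = -e / 2 := by rw [hs]; field_simp
  have := hA.interpolate h.one_zero s hs0.le hs1.le rfl rfl rfl (-e / 4) (by linarith)
  refine ⟨_, _, _, ?_, ?_, ?_, ?_, ?_, this⟩
  · nlinarith
  · nlinarith
  · nlinarith
  · nlinarith
  · linarith

end Region

/-! ### Reducing the supremum over `E` to a finite net and linearising it. -/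

section Supremum

variable {d : ℕ} {M R δ : ℝ} {Θ : Sph d → Space d → ℝ} {ψ f : Space d → ℝ}

lemma IsShellProfile.abs_shellK_le [Fact (2 ≤ d)] (h : IsShellProfile M R Θ) (δ s : ℝ) (x : Space d) :
    |shellK Θ δ s x| ≤ |δ⁻¹ ^ d| * M := by
  have := norm_integral_le_of_norm_le_const (μ := sigma d)
    (f := fun y : Sph d => δ⁻¹ ^ d * Θ y (δ⁻¹ • (x - s • (y : Space d)))) (C := |δ⁻¹ ^ d| * M)
    (ae_of_all _ fun y => by
      rw [norm_mul, Real.norm_eq_abs, Real.norm_eq_abs]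
      exact mul_le_mul_of_nonneg_left (h.bdd _ _) (abs_nonneg _))
  simpa [shellK] using this

lemma IsShellProfile.continuous_conv [Fact (2 ≤ d)] (h : IsShellProfile M R Θ) (δ : ℝ)
    (hf : Integrable f) : Continuous fun p : ℝ × Space d => conv (shellK Θ δ p.1) f p.2 := by
  refine continuous_of_dominated (bound := fun y => |δ⁻¹ ^ d| * M * |f y|) ?_ ?_
    (hf.abs.const_mul _) ?_
  · intro p
    exact ((h.continuous δ p.1).comp (by fun_prop)).aestronglyMeasurable.mul hf.aestronglyMeasurable
  · intro p
    refine ae_of_all _ fun y => ?_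
    rw [norm_mul]
    exact mul_le_mul_of_nonneg_right (h.abs_shellK_le _ _ _) (abs_nonneg _)
  · refine ae_of_all _ fun y => Continuous.mul ?_ continuous_const
    exact (h.continuous_uncurry δ).comp (f := fun p : ℝ × Space d => (p.1, p.2 - y)) (by fun_prop)

lemma hasDerivAt_shellK [Fact (2 ≤ d)] (h : IsRadialTest ψ) (δ s : ℝ) (x : Space d) :
    HasDerivAt (fun s => shellK (meanProfile ψ) δ s x) (δ⁻¹ * shellK (derivProfile ψ) δ s x) s := by
  have hc := h.smooth.continuous_fderiv (by simp)
  have key := hasDerivAt_integral_sphere (d := d)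
    (Φ := fun s y => δ⁻¹ ^ d * ψ (δ⁻¹ • (x - s • (y : Space d))))
    (Φ' := fun s y => δ⁻¹ * (δ⁻¹ ^ d * -(fderiv ℝ ψ (δ⁻¹ • (x - s • (y : Space d))) (y : Space d))))
    (fun t => continuous_const.mul (h.smooth.continuous.comp (by fun_prop))) ?_ ?_ s
  · rw [integral_const_mul] at key
    exact key
  · refine continuous_const.mul (continuous_const.mul (Continuous.neg ?_))
    exact (hc.comp (f := fun p : ℝ × Sph d => δ⁻¹ • (x - p.1 • (p.2 : Space d))) (by fun_prop)).clm_apply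
      (by fun_prop)
  · intro t y
    have h1 : HasDerivAt (fun s : ℝ => δ⁻¹ • (x - s • (y : Space d))) (δ⁻¹ • (-(y : Space d))) t := by
      have := ((((hasDerivAt_id t).smul_const (y : Space d)).const_sub x).const_smul δ⁻¹)
      rw [one_smul] at this
      exact this
    have h2 := ((h.smooth.differentiable (by simp)) (δ⁻¹ • (x - t • (y : Space d)))).hasFDerivAt.comp_hasDerivAt
      t h1
    refine (h2.const_mul (δ⁻¹ ^ d)).congr_deriv ?_
    rw [map_smul, map_neg, smul_eq_mul]
    ring

lemma hasDerivAt_conv_shellK [Fact (2 ≤ d)] (h : IsRadialTest ψ) (δ s : ℝ) (x : Space d)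
    (hf : Integrable f) :
    HasDerivAt (fun s => conv (shellK (meanProfile ψ) δ s) f x)
      (δ⁻¹ * conv (shellK (derivProfile ψ) δ s) f x) s := by
  obtain ⟨M, R, hM, hR, hm, hdp⟩ := h.exists_isShellProfile
  have hm' (s) : AEStronglyMeasurable (fun y => shellK (meanProfile ψ) δ s (x - y) * f y) :=
    ((hm.continuous δ s).comp (by fun_prop)).aestronglyMeasurable.mul hf.aestronglyMeasurable
  have hd' (s) : AEStronglyMeasurable (fun y => shellK (derivProfile ψ) δ s (x - y) * f y) :=
    ((hdp.continuous δ s).comp (by fun_prop)).aestronglyMeasurable.mul hf.aestronglyMeasurable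
  have hbm (s) : Integrable (fun y => shellK (meanProfile ψ) δ s (x - y) * f y) := by
    refine Integrable.mono' (hf.abs.const_mul (|δ⁻¹ ^ d| * M)) (hm' s) (ae_of_all _ fun y => ?_)
    rw [norm_mul]
    exact mul_le_mul_of_nonneg_right (hm.abs_shellK_le _ _ _) (abs_nonneg _)
  have key := (hasDerivAt_integral_of_dominated_loc_of_deriv_le (μ := (volume : Measure (Space d)))
    (F := fun s y => shellK (meanProfile ψ) δ s (x - y) * f y)
    (F' := fun s y => δ⁻¹ * (shellK (derivProfile ψ) δ s (x - y) * f y)) (x₀ := s) (s := univ)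
    (bound := fun y => |δ⁻¹| * (|δ⁻¹ ^ d| * M * |f y|)) univ_mem
    (Eventually.of_forall fun t => hm' t) (hbm s) ((hd' s).const_mul _) ?_
    ((hf.abs.const_mul _).const_mul _) ?_).2
  · rw [integral_const_mul] at key
    exact key
  · refine ae_of_all _ fun y t _ => ?_
    rw [norm_mul, norm_mul]
    exact mul_le_mul_of_nonneg_left
      (mul_le_mul_of_nonneg_right (hdp.abs_shellK_le _ _ _) (abs_nonneg _)) (abs_nonneg _)
  · refine ae_of_all _ fun y t _ => ?_
    have := (hasDerivAt_shellK h δ t (x - y)).mul_const (f y)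
    rwa [mul_assoc] at this

/-- The fundamental theorem of calculus in the radius, rescaled by `δ`: the factor `δ⁻¹` from
`hasDerivAt_conv_shellK` cancels the length of the window. The error is thus an average of operators
with shell kernels of the same quality. -/
lemma enorm_conv_shellK_le [Fact (2 ≤ d)] (h : IsRadialTest ψ) (hδ : 0 < δ) {s s₀ : ℝ}
    (hs : |s - s₀| ≤ δ) (x : Space d) (hf : Integrable f) :
    ‖conv (shellK (meanProfile ψ) δ s) f x‖ₑ ≤ ‖conv (shellK (meanProfile ψ) δ s₀) f x‖ₑ +
      ∫⁻ θ in Icc (-1 : ℝ) 1, ‖conv (shellK (derivProfile ψ) δ (s₀ + θ * δ)) f x‖ₑ := by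
  obtain ⟨M, R, hM, hR, hm, hdp⟩ := h.exists_isShellProfile
  set u : ℝ → ℝ := fun θ => conv (shellK (meanProfile ψ) δ (s₀ + θ * δ)) f x
  set v : ℝ → ℝ := fun θ => conv (shellK (derivProfile ψ) δ (s₀ + θ * δ)) f x
  have hv : Continuous v := (hdp.continuous_conv δ hf).comp (f := fun θ : ℝ => (s₀ + θ * δ, x))
    (by fun_prop)
  have hu (θ) : HasDerivAt u (v θ) θ := by
    have h1 : HasDerivAt (fun θ : ℝ => s₀ + θ * δ) δ θ := by
      simpa using ((hasDerivAt_id θ).mul_const δ).const_add s₀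
    have := (hasDerivAt_conv_shellK h δ (s₀ + θ * δ) x hf).comp θ h1
    refine this.congr_deriv ?_
    simp only [v]
    field_simp
  set θ := (s - s₀) / δ
  have hθ : |θ| ≤ 1 := by rw [abs_div, abs_of_pos hδ, div_le_one hδ]; exact hs
  have e : u θ = u 0 + ∫ τ in (0 : ℝ)..θ, v τ := by
    rw [intervalIntegral.integral_eq_sub_of_hasDerivAt (fun τ _ => hu τ) (hv.intervalIntegrable _ _)]
    ring
  have e1 : u θ = conv (shellK (meanProfile ψ) δ s) f x := by
    simp only [u, θ]; rw [div_mul_cancel₀ _ hδ.ne', add_sub_cancel]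
  have e0 : u 0 = conv (shellK (meanProfile ψ) δ s₀) f x := by simp [u]
  rw [← e1, ← e0, e]
  refine (enorm_add_le _ _).trans ?_
  gcongr
  have : ‖∫ τ in (0 : ℝ)..θ, v τ‖ₑ = ‖∫ τ in uIoc 0 θ, v τ‖ₑ := by
    rw [← ofReal_norm, ← ofReal_norm,
      intervalIntegral.norm_integral_eq_norm_integral_uIoc]
  rw [this]
  refine (enorm_integral_le_lintegral_enorm _).trans (lintegral_mono_set ?_)
  intro τ hτ
  have := abs_le.1 hθ
  rcases mem_uIoc.1 hτ with h | h <;> constructor <;> linarith [h.1, h.2]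

/-- `G` is partitioned according to which index attains the maximum, adding one index at a time. -/
lemma exists_linearization {X ι : Type*} [MeasurableSpace X] [DecidableEq ι] {μ : Measure X}
    {Φ : ι → X → ℝ≥0∞} (hΦ : ∀ t, Measurable (Φ t)) (T : Finset ι) :
    ∀ G : Set X, MeasurableSet G → ∃ H : ι → Set X, (∀ t, MeasurableSet (H t)) ∧ (∀ t, H t ⊆ G) ∧
      ∑ t ∈ T, μ (H t) ≤ μ G ∧
      ∫⁻ x in G, T.sup (fun t => Φ t x) ∂μ ≤ ∑ t ∈ T, ∫⁻ x in H t, Φ t x ∂μ := by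
  induction T using Finset.induction_on with
  | empty => exact fun G hG => ⟨fun _ => ∅, by simp, by simp, by simp, by simp⟩
  | insert t₀ T ht₀ ih =>
    intro G hG
    have hsup : Measurable fun x => T.sup (fun t => Φ t x) := by
      simp_rw [Finset.sup_eq_iSup]
      exact Measurable.biSup _ T.countable_toSet fun t _ => hΦ t
    set S : Set X := {x | T.sup (fun t => Φ t x) ≤ Φ t₀ x}
    have hS : MeasurableSet S := measurableSet_le hsup (hΦ t₀)
    obtain ⟨H, hH, hHG, hHμ, hHi⟩ := ih (G \ S) (hG.diff hS)
    have hne : ∀ t ∈ T, t ≠ t₀ := fun t ht h => ht₀ (h ▸ ht)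
    refine ⟨Function.update H t₀ (G ∩ S), fun t => ?_, fun t => ?_, ?_, ?_⟩
    · rcases eq_or_ne t t₀ with rfl | h
      · simpa using hG.inter hS
      · simpa [h] using hH t
    · rcases eq_or_ne t t₀ with rfl | h
      · simp
      · simpa [h] using (hHG t).trans sdiff_subset
    · rw [Finset.sum_insert ht₀, Function.update_self, ← measure_inter_add_sdiff G hS]
      gcongr
      rw [Finset.sum_congr rfl fun t ht => by rw [Function.update_of_ne (hne t ht)]]
      exact hHμ
    · rw [Finset.sum_insert ht₀, Function.update_self, ← lintegral_inter_add_sdiff _ G hS]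
      rw [Finset.sum_congr rfl fun t ht => by rw [Function.update_of_ne (hne t ht)]]
      refine add_le_add ?_ (le_trans ?_ hHi)
      · refine setLIntegral_mono (hΦ t₀) fun x hx => ?_
        rw [Finset.sup_insert]
        exact sup_le le_rfl hx.2
      · refine setLIntegral_mono hsup fun x hx => ?_
        rw [Finset.sup_insert]
        exact sup_le (le_of_lt (not_le.1 hx.2)) le_rfl

/-- The supremum of the `j`-th frequency localized spherical means over all radii in `E`. -/
noncomputable def pieceMaximal (E : Set ℝ) (ψ : Space d → ℝ) (j : ℕ) (f : Space d → ℝ) (x : Space d) :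
    ℝ≥0∞ :=
  ⨆ t ∈ E, ‖conv (shellK (meanProfile ψ) ((2⁻¹ : ℝ) ^ j) t) f x‖ₑ

lemma RestrictedBound.lintegral_pieceMaximal_le [Fact (2 ≤ d)] {E : Set ℝ} (hE : E ⊆ Icc 1 2) {C R a b e : ℝ}
    (hB : RestrictedBound d E C R a b e) (hψ : IsRadialTest ψ)
    (hker : ∀ δ s : ℝ, 0 < δ → 1 / 2 ≤ s →
      IsShellKernel C R δ s (shellK (meanProfile ψ) δ s) ∧
      IsShellKernel C R δ s (shellK (derivProfile ψ) δ s)) :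
    ∃ A : ℝ≥0, ∀ j : ℕ, 1 ≤ j → ∀ (f : Space d → ℝ) (F G : Set (Space d)),
      Measurable f → MeasurableSet F → volume F ≠ ∞ → (∀ x, |f x| ≤ F.indicator 1 x) →
      MeasurableSet G → volume G ≠ ∞ →
      ∫⁻ x in G, pieceMaximal E ψ j f x ≤
        A * (2 : ℝ≥0∞) ^ ((j : ℝ) * e) * volume F ^ a * volume G ^ (1 - b) := by
  obtain ⟨-, hb1, A, hA⟩ := hB
  obtain ⟨M, R', hM, hR', hm, hdp⟩ := hψ.exists_isShellProfile
  -- One `A` for the values on the net and two for the integral over `θ ∈ [-1, 1]`.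
  refine ⟨3 * A, ?_⟩
  intro j hj f F G hf hF hF' hfF hG hG'
  have hfi : Integrable f := (isNice_of_le_indicator hf hF hF' hfF).int
  obtain ⟨T, hTE, hTsep, hTnet⟩ := exists_separated_net hE j
  set δ : ℝ := (2⁻¹ : ℝ) ^ j with hδdef
  have hδ : 0 < δ := by positivity
  -- For `j ≥ 1` the shifted radii `t + θ δ` stay at least `1/2`, as the kernel estimates require.
  have hδ2 : δ ≤ 1 / 2 := by
    calc δ ≤ (2⁻¹ : ℝ) ^ 1 := pow_le_pow_of_le_one (by norm_num) (by norm_num) hj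
      _ = 1 / 2 := by norm_num
  set Φ₁ : ℝ → Space d → ℝ≥0∞ := fun t x => ‖conv (shellK (meanProfile ψ) δ t) f x‖ₑ
  set Ψ : ℝ → ℝ → Space d → ℝ≥0∞ := fun t θ x =>
    ‖conv (shellK (derivProfile ψ) δ (t + θ * δ)) f x‖ₑ
  have hΦ₁ (t) : Measurable (Φ₁ t) :=
    ((hm.continuous_conv δ hfi).comp (f := fun x => (t, x)) (by fun_prop)).enorm.measurable
  have hΨ (t) : Measurable (Function.uncurry (Ψ t)) :=
    ((hdp.continuous_conv δ hfi).comp (f := fun p : ℝ × Space d => (t + p.1 * δ, p.2))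
      (by fun_prop)).enorm.measurable
  set Φ : ℝ → Space d → ℝ≥0∞ := fun t x => Φ₁ t x + ∫⁻ θ in Icc (-1 : ℝ) 1, Ψ t θ x
  have hΦ₂ (t) : Measurable fun x => ∫⁻ θ in Icc (-1 : ℝ) 1, Ψ t θ x := (hΨ t).lintegral_prod_left'
  have hΦ (t) : Measurable (Φ t) := (hΦ₁ t).add (hΦ₂ t)
  obtain ⟨H, hH, hHG, hHμ, hHi⟩ := exists_linearization (μ := volume) hΦ T G hG
  have hH' (t) : volume (H t) ≠ ∞ := ne_top_of_le_ne_top hG' (measure_mono (hHG t))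
  have hpt (x) : pieceMaximal E ψ j f x ≤ T.sup (fun t => Φ t x) := by
    refine iSup₂_le fun t ht => ?_
    obtain ⟨t', ht', hd'⟩ := hTnet t ht
    exact (enorm_conv_shellK_le hψ hδ hd' x hfi).trans
      (Finset.le_sup (f := fun t => Φ t x) ht')
  set B := A * (2 : ℝ≥0∞) ^ ((j : ℝ) * e) * volume F ^ a * volume G ^ (1 - b)
  have hmono : A * (2 : ℝ≥0∞) ^ ((j : ℝ) * e) * volume F ^ a * (∑ t ∈ T, volume (H t)) ^ (1 - b) ≤ B := by
    have : 0 ≤ 1 - b := by linarith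
    exact mul_le_mul' le_rfl (ENNReal.rpow_le_rpow hHμ this)
  have h1 : ∑ t ∈ T, ∫⁻ x in H t, Φ₁ t x ≤ B := by
    refine (hA j T (fun t => shellK (meanProfile ψ) δ t) ⟨hTE, hTsep, fun t ht => ?_⟩ f F H hf hF hF' hfF
      hH hH').trans hmono
    exact ⟨t, by simp, (hker δ t hδ (by linarith [(hE (hTE t ht)).1])).1⟩
  have h2 (θ : ℝ) (hθ : θ ∈ Icc (-1 : ℝ) 1) : ∑ t ∈ T, ∫⁻ x in H t, Ψ t θ x ≤ B := by
    refine (hA j T (fun t => shellK (derivProfile ψ) δ (t + θ * δ)) ⟨hTE, hTsep, fun t ht => ?_⟩ f F H hf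
      hF hF' hfF hH hH').trans hmono
    refine ⟨t + θ * δ, ?_, (hker δ _ hδ ?_).2⟩
    · rw [add_sub_cancel_left, abs_mul, abs_of_pos hδ]
      exact mul_le_of_le_one_left hδ.le (abs_le.2 hθ)
    · have := (hE (hTE t ht)).1
      nlinarith [hθ.1]
  have h3 : ∑ t ∈ T, ∫⁻ x in H t, ∫⁻ θ in Icc (-1 : ℝ) 1, Ψ t θ x ≤ 2 * B := by
    calc ∑ t ∈ T, ∫⁻ x in H t, ∫⁻ θ in Icc (-1 : ℝ) 1, Ψ t θ x
        = ∑ t ∈ T, ∫⁻ θ in Icc (-1 : ℝ) 1, ∫⁻ x in H t, Ψ t θ x := by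
          refine Finset.sum_congr rfl fun t _ => ?_
          exact lintegral_lintegral_swap ((hΨ t).comp measurable_swap).aemeasurable
      _ = ∫⁻ θ in Icc (-1 : ℝ) 1, ∑ t ∈ T, ∫⁻ x in H t, Ψ t θ x := by
          rw [lintegral_finsetSum]
          exact fun t _ => (hΨ t).lintegral_prod_right'
      _ ≤ ∫⁻ θ in Icc (-1 : ℝ) 1, B := setLIntegral_mono measurable_const h2
      _ = 2 * B := by
          rw [setLIntegral_const, Real.volume_Icc, mul_comm]
          norm_num
  calc ∫⁻ x in G, pieceMaximal E ψ j f x ≤ ∫⁻ x in G, T.sup (fun t => Φ t x) := lintegral_mono hpt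
    _ ≤ ∑ t ∈ T, ∫⁻ x in H t, Φ t x := hHi
    _ = (∑ t ∈ T, ∫⁻ x in H t, Φ₁ t x) + ∑ t ∈ T, ∫⁻ x in H t, ∫⁻ θ in Icc (-1 : ℝ) 1, Ψ t θ x := by
        rw [← Finset.sum_add_distrib]
        exact Finset.sum_congr rfl fun t _ => lintegral_add_left (hΦ₁ t) _
    _ ≤ B + 2 * B := add_le_add h1 h3
    _ = _ := by
        simp only [B]; push_cast; ring

end Supremum

/-! ### Telescoping the spherical mean into frequency pieces. -/

section Decomposition

variable {d : ℕ} {φ ψ f : Space d → ℝ}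

lemma integrable_prod_mul_translate [Fact (2 ≤ d)] (hφ : Integrable φ) (hf : Continuous f)
    (hfc : HasCompactSupport f) (t δ : ℝ) (x : Space d) :
    Integrable (fun p : Sph d × Space d => φ p.2 * f (x - t • (p.1 : Space d) - δ • p.2))
      ((sigma d).prod volume) := by
  obtain ⟨M, hM⟩ := hfc.exists_bound_of_continuous hf
  have h1 : Integrable (fun p : Sph d × Space d => φ p.2) ((sigma d).prod volume) :=
    hφ.comp_snd (sigma d)
  refine h1.mul_bdd (c := M) ?_ (ae_of_all _ fun p => hM _)
  exact (hf.comp (by fun_prop)).aestronglyMeasurable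

lemma conv_shellK_mean_eq [Fact (2 ≤ d)] (hφ : IsRadialTest φ) (hf : Continuous f)
    (hfc : HasCompactSupport f) {δ : ℝ} (hδ : 0 < δ) (t : ℝ) (x : Space d) :
    conv (shellK (meanProfile φ) δ t) f x =
      ∫ p : Sph d × Space d, φ p.2 * f (x - t • (p.1 : Space d) - δ • p.2) ∂((sigma d).prod volume) := by
  rw [integral_prod _ (integrable_prod_mul_translate hφ.integrable hf hfc t δ x)]
  have h1 (y : Sph d) : ∫ u, φ u * f (x - t • (y : Space d) - δ • u) =
      ∫ z, δ⁻¹ ^ d * φ (δ⁻¹ • (x - z - t • (y : Space d))) * f z := by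
    set v := x - t • (y : Space d)
    have := integral_rescaled_translate (fun u => φ (-u) * f (v + δ • u)) hδ v
    rw [← integral_neg_eq_self (fun u => φ u * f (v - δ • u))]
    simp only [smul_neg, sub_neg_eq_add]
    rw [← this]
    congr 1; ext z
    have e1 : -(δ⁻¹ • (z - v)) = δ⁻¹ • (x - z - t • (y : Space d)) := by
      simp only [v]; rw [← smul_neg]; congr 1; abel
    have e2 : v + δ • δ⁻¹ • (z - v) = z := by
      rw [smul_smul, mul_inv_cancel₀ hδ.ne', one_smul]; abel
    rw [e1, e2, mul_assoc]
  simp_rw [h1]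
  rw [integral_integral_swap]
  · simp only [conv, shellK, meanProfile]
    congr 1; ext z
    rw [integral_mul_const]
  · refine Continuous.integrable_of_hasCompactSupport ?_ ?_
    · exact (continuous_const.mul (hφ.smooth.continuous.comp (by fun_prop))).mul
        (hf.comp continuous_snd)
    · refine HasCompactSupport.intro (isCompact_univ.prod hfc) fun p hp => ?_
      have : p.2 ∉ tsupport f := fun h => hp ⟨mem_univ _, h⟩
      simp [Function.uncurry, image_eq_zero_of_notMem_tsupport this]

/-- In the form of `conv_shellK_mean_eq` the mollified mean is a continuous function of the scale,
also at scale zero, where it is the spherical mean because `∫ φ = 1`. -/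
lemma tendsto_conv_shellK_mean [Fact (2 ≤ d)] (hφ : IsRadialTest φ) (hφ1 : ∫ x, φ x = 1)
    (hf : Continuous f) (hfc : HasCompactSupport f) (t : ℝ) (x : Space d) :
    Tendsto (fun J : ℕ => conv (shellK (meanProfile φ) ((2⁻¹ : ℝ) ^ J) t) f x) atTop
      (𝓝 (∫ y : Sph d, f (x - t • (y : Space d)) ∂sigma d)) := by
  obtain ⟨M, hM⟩ := hfc.exists_bound_of_continuous hf
  set P : ℝ → ℝ := fun δ =>
    ∫ p : Sph d × Space d, φ p.2 * f (x - t • (p.1 : Space d) - δ • p.2) ∂((sigma d).prod volume)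
  have hP : Continuous P := by
    refine continuous_of_dominated (bound := fun p => ‖φ p.2‖ * M)
      (fun δ => (integrable_prod_mul_translate hφ.integrable hf hfc t δ x).aestronglyMeasurable) ?_
      ((hφ.integrable.norm.comp_snd (sigma d)).mul_const M) ?_
    · intro δ
      refine ae_of_all _ fun p => ?_
      rw [norm_mul]
      gcongr
      exact hM _
    · refine ae_of_all _ fun p => continuous_const.mul (hf.comp (by fun_prop))
  have hP0 : P 0 = ∫ y : Sph d, f (x - t • (y : Space d)) ∂sigma d := by
    simp only [P, zero_smul, sub_zero]
    have := integral_prod_mul (μ := sigma d) (ν := (volume : Measure (Space d)))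
      (fun y : Sph d => f (x - t • (y : Space d))) φ
    rw [hφ1, mul_one] at this
    rw [← this]
    simp_rw [mul_comm]
  rw [← hP0]
  have h2 : Tendsto (fun J : ℕ => (2⁻¹ : ℝ) ^ J) atTop (𝓝 0) :=
    tendsto_pow_atTop_nhds_zero_of_lt_one (by norm_num) (by norm_num)
  refine ((hP.tendsto 0).comp h2).congr fun J => ?_
  exact (conv_shellK_mean_eq hφ hf hfc (by positivity) t x).symm

/-- Halving the scale adds exactly one `ψ` piece, since `ψ` is the difference of `φ` and its dilate.
-/
lemma shellK_mean_succ [Fact (2 ≤ d)] (hφ : IsRadialTest φ)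
    (hψφ : ∀ x, ψ x = φ x - (2⁻¹ : ℝ) ^ d * φ ((2⁻¹ : ℝ) • x)) (j : ℕ) (t : ℝ) (x : Space d) :
    shellK (meanProfile φ) ((2⁻¹ : ℝ) ^ (j + 1)) t x =
      shellK (meanProfile φ) ((2⁻¹ : ℝ) ^ j) t x +
        shellK (meanProfile ψ) ((2⁻¹ : ℝ) ^ (j + 1)) t x := by
  have hc (δ : ℝ) : Continuous fun y : Sph d => δ⁻¹ ^ d * φ (δ⁻¹ • (x - t • (y : Space d))) :=
    continuous_const.mul (hφ.smooth.continuous.comp (by fun_prop))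
  rw [← sub_eq_iff_eq_add']
  simp only [shellK, meanProfile]
  rw [← integral_sub (integrable_sphere (hc _)) (integrable_sphere (hc _))]
  congr 1; ext y
  have e : ((2⁻¹ : ℝ) ^ j)⁻¹ = 2⁻¹ * ((2⁻¹ : ℝ) ^ (j + 1))⁻¹ := by
    rw [pow_succ, mul_inv]; ring
  rw [hψφ, e, ← smul_smul, mul_pow]
  ring

lemma conv_shellK_mean_succ [Fact (2 ≤ d)] (hφ : IsRadialTest φ) (hψ : IsRadialTest ψ)
    (hψφ : ∀ x, ψ x = φ x - (2⁻¹ : ℝ) ^ d * φ ((2⁻¹ : ℝ) • x)) (hf : Integrable f)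
    (j : ℕ) (t : ℝ) (x : Space d) :
    conv (shellK (meanProfile φ) ((2⁻¹ : ℝ) ^ (j + 1)) t) f x =
      conv (shellK (meanProfile φ) ((2⁻¹ : ℝ) ^ j) t) f x +
        conv (shellK (meanProfile ψ) ((2⁻¹ : ℝ) ^ (j + 1)) t) f x := by
  have key (χ : Space d → ℝ) (hχ : IsRadialTest χ) (δ : ℝ) :
      Integrable fun y => shellK (meanProfile χ) δ t (x - y) * f y := by
    obtain ⟨M, R, -, -, hm, -⟩ := hχ.exists_isShellProfile
    exact hf.bdd_mul ((hm.continuous δ t).comp (by fun_prop)).aestronglyMeasurable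
      (ae_of_all _ fun y => hm.abs_shellK_le _ _ _)
  simp only [conv]
  rw [← integral_add (key φ hφ _) (key ψ hψ _)]
  congr 1; ext y
  rw [shellK_mean_succ hφ hψφ, add_mul]

/-- Telescoping from scale `1` and passing to the limit. The term at scale `1` has a bounded kernel,
so it is controlled by the L¹ norm of `f`. -/
lemma exists_enorm_integral_sphere_le [Fact (2 ≤ d)] (hφ : IsRadialTest φ) (hφ1 : ∫ x, φ x = 1)
    (hψ : IsRadialTest ψ) (hψφ : ∀ x, ψ x = φ x - (2⁻¹ : ℝ) ^ d * φ ((2⁻¹ : ℝ) • x)) :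
    ∃ M : ℝ≥0, ∀ f : Space d → ℝ, Continuous f → HasCompactSupport f → ∀ (E : Set ℝ) (t : ℝ), t ∈ E →
      ∀ x : Space d, ‖∫ y : Sph d, f (x - t • (y : Space d)) ∂sigma d‖ₑ ≤
      M * (∫⁻ y, ‖f y‖ₑ) + ∑' j : ℕ, pieceMaximal E ψ (j + 1) f x := by
  obtain ⟨M, R, hM0, -, hm, -⟩ := hφ.exists_isShellProfile
  refine ⟨M.toNNReal, fun f hf hfc E t ht x => ?_⟩
  have hfi : Integrable f := hf.integrable_of_hasCompactSupport hfc
  have h0 : ‖conv (shellK (meanProfile φ) ((2⁻¹ : ℝ) ^ 0) t) f x‖ₑ ≤ M.toNNReal * ∫⁻ y, ‖f y‖ₑ := by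
    have := abs_conv_le (hm.abs_shellK_le ((2⁻¹ : ℝ) ^ 0) t) hfi x
    rw [← ofReal_norm, Real.norm_eq_abs]
    refine (ENNReal.ofReal_le_ofReal this).trans (le_of_eq ?_)
    rw [ENNReal.ofReal_mul (by positivity)]
    congr 1
    · simp [ENNReal.ofReal]
    · exact ofReal_integral_norm_eq_lintegral_enorm hfi
  have hJ (J : ℕ) : ‖conv (shellK (meanProfile φ) ((2⁻¹ : ℝ) ^ J) t) f x‖ₑ ≤
      M.toNNReal * (∫⁻ y, ‖f y‖ₑ) + ∑ j ∈ Finset.range J, pieceMaximal E ψ (j + 1) f x := by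
    induction J with
    | zero => simpa using h0
    | succ J ih =>
      rw [conv_shellK_mean_succ hφ hψ hψφ hfi, Finset.sum_range_succ, ← add_assoc]
      refine (enorm_add_le _ _).trans (add_le_add ih ?_)
      exact le_iSup₂ (f := fun t (_ : t ∈ E) =>
        ‖conv (shellK (meanProfile ψ) ((2⁻¹ : ℝ) ^ (J + 1)) t) f x‖ₑ) t ht
  refine le_of_tendsto (tendsto_conv_shellK_mean hφ hφ1 hf hfc t x).enorm
    (Eventually.of_forall fun J => (hJ J).trans ?_)
  gcongr
  exact ENNReal.sum_le_tsum _

/-- `E` may be uncountable; a supremum of continuous functions is still lower semicontinuous. -/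
lemma measurable_pieceMaximal [Fact (2 ≤ d)] (hψ : IsRadialTest ψ) (E : Set ℝ) (j : ℕ)
    (hf : Integrable f) : Measurable (pieceMaximal E ψ j f) := by
  obtain ⟨M, R, -, -, hm, -⟩ := hψ.exists_isShellProfile
  refine LowerSemicontinuous.measurable (lowerSemicontinuous_biSup fun t _ => Continuous.lowerSemicontinuous ?_)
  exact ((hm.continuous_conv _ hf).comp (f := fun x => (t, x)) (by fun_prop)).enorm

lemma pieceMaximal_sum_le [Fact (2 ≤ d)] (hψ : IsRadialTest ψ) (E : Set ℝ) (j : ℕ) {ι : Type*}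
    (S : Finset ι) (g : ι → Space d → ℝ) (hg : ∀ i ∈ S, Integrable (g i)) (x : Space d) :
    pieceMaximal E ψ j (fun y => ∑ i ∈ S, g i y) x ≤ ∑ i ∈ S, pieceMaximal E ψ j (g i) x := by
  obtain ⟨M, R, -, -, hm, -⟩ := hψ.exists_isShellProfile
  refine iSup₂_le fun t ht => ?_
  have e : conv (shellK (meanProfile ψ) ((2⁻¹ : ℝ) ^ j) t) (fun y => ∑ i ∈ S, g i y) x =
      ∑ i ∈ S, conv (shellK (meanProfile ψ) ((2⁻¹ : ℝ) ^ j) t) (g i) x := by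
    simp only [conv, Finset.mul_sum]
    exact integral_finsetSum _ fun i hi => (hg i hi).bdd_mul
      ((hm.continuous _ t).comp (by fun_prop)).aestronglyMeasurable
      (ae_of_all _ fun y => hm.abs_shellK_le _ _ _)
  rw [e]
  refine (enorm_sum_le _ _).trans (Finset.sum_le_sum fun i _ => ?_)
  exact le_iSup₂ (f := fun t (_ : t ∈ E) =>
    ‖conv (shellK (meanProfile ψ) ((2⁻¹ : ℝ) ^ j) t) (g i) x‖ₑ) t ht

lemma pieceMaximal_const_mul (E : Set ℝ) (ψ : Space d → ℝ) (j : ℕ) (c : ℝ) (f : Space d → ℝ)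
    (x : Space d) : pieceMaximal E ψ j (fun y => c * f y) x = ‖c‖ₑ * pieceMaximal E ψ j f x := by
  simp only [pieceMaximal, ENNReal.mul_iSup]
  congr 1; ext t; congr 1; ext ht
  rw [← enorm_mul]
  congr 1
  simp only [conv]
  rw [← integral_const_mul]
  congr 1; ext y; ring

end Decomposition

/-! ### From restricted weak type to strong type by summing over levels. -/

section StrongType

variable {d : ℕ}

lemma tsum_two_rpow_ne_top {ρ : ℝ} (hρ : ρ < 0) : ∑' i : ℕ, (2 : ℝ≥0∞) ^ ((i : ℝ) * ρ) ≠ ∞ := by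
  have h (i : ℕ) : (2 : ℝ≥0∞) ^ ((i : ℝ) * ρ) = ((2 : ℝ≥0∞) ^ ρ) ^ i := by
    rw [mul_comm, ENNReal.rpow_mul, ENNReal.rpow_natCast]
  simp_rw [h]
  rw [ENNReal.tsum_geometric, ENNReal.inv_ne_top]
  have : (2 : ℝ≥0∞) ^ ρ < 1 := ENNReal.rpow_lt_one_of_one_lt_of_neg (by norm_num) hρ
  exact (tsub_pos_of_lt this).ne'

lemma two_rpow_ne_top (r : ℝ) : (2 : ℝ≥0∞) ^ r ≠ ∞ :=
  ENNReal.rpow_ne_top_of_ne_zero (by norm_num) (by norm_num)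

/-- A restricted weak type estimate upgrades to a strong type estimate on sets of finite measure. -/
lemma lintegral_rpow_le_of_lintegral_le {X : Type*} [MeasurableSpace X] {μ : Measure X} {S : X → ℝ≥0∞}
    (hS : Measurable S) {B : Set X} (hB : MeasurableSet B) (hBμ : μ B ≠ ∞) {C : ℝ≥0∞} {b q : ℝ}
    (hb : 0 < b) (hq : 0 < q)
    (h : ∀ G ⊆ B, MeasurableSet G → ∫⁻ x in G, S x ∂μ ≤ C * μ G ^ (1 - b)) :
    ∫⁻ x in B, S x ^ q ∂μ ≤
      μ B + 2 ^ q * C ^ b⁻¹ * ∑' k : ℕ, (2 : ℝ≥0∞) ^ ((k : ℝ) * (q - b⁻¹)) := by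
  set L : ℕ → Set X := fun k => {x | (2 : ℝ≥0∞) ^ (k : ℝ) < S x}
  have hL (k) : MeasurableSet (L k) := measurableSet_lt measurable_const hS
  have hweak (k : ℕ) : μ (B ∩ L k) ≤ C ^ b⁻¹ * (2 : ℝ≥0∞) ^ (-((k : ℝ) * b⁻¹)) := by
    set m := μ (B ∩ L k)
    have hm : m ≠ ∞ := ne_top_of_le_ne_top hBμ (measure_mono inter_subset_left)
    rcases eq_or_ne m 0 with h0 | h0
    · rw [h0]; exact zero_le
    -- The hypothesis is tested on the part of the superlevel set inside `B`. Its measure is finite,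
    -- so `m^(1-b)` can be cancelled.
    have h1 : (2 : ℝ≥0∞) ^ (k : ℝ) * m ≤ C * m ^ (1 - b) := by
      refine le_trans ?_ (h _ inter_subset_left (hB.inter (hL k)))
      rw [← setLIntegral_const]
      exact setLIntegral_mono hS fun x hx => le_of_lt hx.2
    have h2 : m ^ b ≤ C * (2 : ℝ≥0∞) ^ (-(k : ℝ)) := by
      have e : m = m ^ b * m ^ (1 - b) := by
        rw [← ENNReal.rpow_add _ _ h0 hm]; simp
      have hmp0 : m ^ (1 - b) ≠ 0 := by
        simp [ENNReal.rpow_eq_zero_iff, h0, hm]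
      have hmpt : m ^ (1 - b) ≠ ∞ := ENNReal.rpow_ne_top_of_ne_zero h0 hm
      have h3 : (2 : ℝ≥0∞) ^ (k : ℝ) * m ^ b ≤ C := by
        refine (ENNReal.mul_le_mul_iff_left hmp0 hmpt).1 ?_
        rwa [mul_assoc, ← e]
      rw [ENNReal.rpow_neg, ← div_eq_mul_inv, ENNReal.le_div_iff_mul_le (by simp) (by simp)]
      rwa [mul_comm]
    calc m = (m ^ b) ^ b⁻¹ := by rw [← ENNReal.rpow_mul, mul_inv_cancel₀ hb.ne', ENNReal.rpow_one]
      _ ≤ (C * (2 : ℝ≥0∞) ^ (-(k : ℝ))) ^ b⁻¹ := by gcongr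
      _ = _ := by
        rw [ENNReal.mul_rpow_of_nonneg _ _ (by positivity), ← ENNReal.rpow_mul]
        congr 2; ring
  -- Only the levels `2^k` with `k ≥ 0` are needed; values up to `1` cost `μ B`.
  have hpt (x) : S x ^ q ≤ 1 + ∑' k : ℕ, (2 : ℝ≥0∞) ^ (((k : ℝ) + 1) * q) * (L k).indicator 1 x := by
    rcases le_or_gt (S x) 1 with h1 | h1
    · exact (ENNReal.rpow_le_one h1 hq.le).trans le_self_add
    rcases eq_or_ne (S x) ∞ with h2 | h2
    · have : ∑' k : ℕ, (2 : ℝ≥0∞) ^ (((k : ℝ) + 1) * q) * (L k).indicator 1 x = ∞ := by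
        rw [← top_le_iff, ← ENNReal.tsum_const_eq_top_of_ne_zero (α := ℕ) (c := 1) one_ne_zero]
        refine ENNReal.tsum_le_tsum fun k => ?_
        have hx : x ∈ L k := by
          simp only [L, mem_ofPred_eq, h2]
          exact lt_top_iff_ne_top.2 (two_rpow_ne_top _)
        rw [indicator_of_mem hx, Pi.one_apply, mul_one]
        exact ENNReal.one_le_rpow (by norm_num) (by positivity)
      rw [this]; simp
    · have hex : ∃ n : ℕ, S x ≤ (2 : ℝ≥0∞) ^ n := by
        obtain ⟨n, hn⟩ := ENNReal.exists_nat_gt h2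
        refine ⟨n, hn.le.trans ?_⟩
        exact_mod_cast Nat.lt_two_pow_self.le
      classical
      set n := Nat.find hex
      have hn : S x ≤ (2 : ℝ≥0∞) ^ n := Nat.find_spec hex
      have hn0 : n ≠ 0 := by
        intro h0
        rw [h0, pow_zero] at hn
        exact absurd h1 (not_lt.2 hn)
      obtain ⟨k, hk⟩ := Nat.exists_eq_succ_of_ne_zero hn0
      have hkL : x ∈ L k := by
        have := Nat.find_min hex (m := k) (by omega)
        simpa [L] using this
      have hle : S x ^ q ≤ (2 : ℝ≥0∞) ^ (((k : ℝ) + 1) * q) * (L k).indicator 1 x := by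
        rw [indicator_of_mem hkL, Pi.one_apply, mul_one, ENNReal.rpow_mul]
        refine ENNReal.rpow_le_rpow (hn.trans (le_of_eq ?_)) hq.le
        rw [hk, ← ENNReal.rpow_natCast]
        push_cast; rfl
      exact (hle.trans (ENNReal.le_tsum k)).trans le_add_self
  calc ∫⁻ x in B, S x ^ q ∂μ
      ≤ ∫⁻ x in B, (1 + ∑' k : ℕ, (2 : ℝ≥0∞) ^ (((k : ℝ) + 1) * q) * (L k).indicator 1 x) ∂μ :=
        lintegral_mono hpt
    _ = μ B + ∑' k : ℕ, (2 : ℝ≥0∞) ^ (((k : ℝ) + 1) * q) * μ (B ∩ L k) := by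
        rw [lintegral_add_left measurable_const, lintegral_tsum]
        · congr 1
          · simp
          · congr 1; ext k
            rw [lintegral_const_mul _ (measurable_one.indicator (hL k)), lintegral_indicator_one (hL k),
              Measure.restrict_apply (hL k), inter_comm]
        · exact fun k => ((measurable_one.indicator (hL k)).const_mul _).aemeasurable
    _ ≤ μ B + ∑' k : ℕ, 2 ^ q * C ^ b⁻¹ * (2 : ℝ≥0∞) ^ ((k : ℝ) * (q - b⁻¹)) := by
        refine add_le_add le_rfl (ENNReal.tsum_le_tsum fun k => ?_)
        calc (2 : ℝ≥0∞) ^ (((k : ℝ) + 1) * q) * μ (B ∩ L k)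
            ≤ (2 : ℝ≥0∞) ^ (((k : ℝ) + 1) * q) * (C ^ b⁻¹ * (2 : ℝ≥0∞) ^ (-((k : ℝ) * b⁻¹))) := by
              gcongr; exact hweak k
          _ = _ := by
              have : ((k : ℝ) + 1) * q = q + k * q := by ring
              rw [this, mul_sub, sub_eq_add_neg, ENNReal.rpow_add _ _ (by norm_num) (by norm_num),
                ENNReal.rpow_add _ _ (by norm_num) (by norm_num)]
              ring
    _ = _ := by rw [ENNReal.tsum_mul_left]

variable {ψ : Space d → ℝ}

lemma exists_lintegral_tsum_pieceMaximal_le [Fact (2 ≤ d)] {E : Set ℝ} (hψ : IsRadialTest ψ)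
    {a b e p : ℝ} (ha : 0 ≤ a) (he : e < 0) (hp : 0 < p) (hpa : 1 < p * a)
    (hA : ∃ A : ℝ≥0, ∀ j : ℕ, 1 ≤ j → ∀ (f : Space d → ℝ) (F G : Set (Space d)),
      Measurable f → MeasurableSet F → volume F ≠ ∞ → (∀ x, |f x| ≤ F.indicator 1 x) →
      MeasurableSet G → volume G ≠ ∞ →
      ∫⁻ x in G, pieceMaximal E ψ j f x ≤
        A * (2 : ℝ≥0∞) ^ ((j : ℝ) * e) * volume F ^ a * volume G ^ (1 - b)) (r : ℝ) :
    ∃ C : ℝ≥0∞, C ≠ ∞ ∧ ∀ (z : Space d) (f : Space d → ℝ), Continuous f → HasCompactSupport f →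
      (∀ x, 0 ≤ f x) → (∀ x ∉ closedBall z r, f x = 0) → ∫⁻ x, ENNReal.ofReal (f x) ^ p ≤ 1 →
      ∀ G : Set (Space d), MeasurableSet G → volume G ≠ ∞ →
        ∫⁻ x in G, ∑' j : ℕ, pieceMaximal E ψ (j + 1) f x ≤ C * volume G ^ (1 - b) := by
  obtain ⟨A, hA⟩ := hA
  set V := volume (closedBall (0 : Space d) r)
  have hV : V ≠ ∞ := measure_closedBall_lt_top.ne
  set D : ℝ≥0∞ := (1 + V) * 2 ^ p with hD
  have hDtop : D ≠ ∞ := ENNReal.mul_ne_top (by simp [hV]) (two_rpow_ne_top _)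
  set S₁ := ∑' i : ℕ, (2 : ℝ≥0∞) ^ ((i : ℝ) * (1 - p * a))
  set S₂ := ∑' j : ℕ, (2 : ℝ≥0∞) ^ ((j : ℝ) * e)
  have hS₁ : S₁ ≠ ∞ := tsum_two_rpow_ne_top (by linarith)
  have hS₂ : S₂ ≠ ∞ := tsum_two_rpow_ne_top he
  refine ⟨A * D ^ a * S₁ * S₂, by
    refine ENNReal.mul_ne_top (ENNReal.mul_ne_top (ENNReal.mul_ne_top (by simp) ?_) hS₁) hS₂
    exact ENNReal.rpow_ne_top_of_nonneg ha hDtop, ?_⟩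
  intro z f hf hfc hf0 hfz hfp G hG hG'
  have hfi : Integrable f := hf.integrable_of_hasCompactSupport hfc
  obtain ⟨M, hM⟩ := hfc.exists_bound_of_continuous hf
  -- Level `0` collects all values at most `1`, and level `i ≥ 1` the values in `(2^(i-1), 2^i]`.
  set lev : Space d → ℕ := fun x => Nat.clog 2 ⌈f x⌉₊
  have hlev : Measurable lev := (measurable_from_nat (f := Nat.clog 2)).comp (Nat.measurable_ceil.comp hf.measurable)
  set K := Nat.clog 2 ⌈M⌉₊
  have hlevK (x) : lev x ∈ Finset.range (K + 1) := by
    rw [Finset.mem_range, Nat.lt_succ_iff]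
    exact Nat.clog_mono_right 2 (Nat.ceil_le_ceil ((le_abs_self _).trans (hM x)))
  have hle (x) : f x ≤ 2 ^ lev x := by
    refine (Nat.le_ceil _).trans ?_
    exact_mod_cast Nat.le_pow_clog (by norm_num) ⌈f x⌉₊
  have hgt (x) (h : lev x ≠ 0) : (2 : ℝ) ^ (lev x - 1) < f x := by
    have h1 : 1 < ⌈f x⌉₊ := by
      by_contra hc
      exact h (Nat.clog_of_right_le_one (not_lt.1 hc) 2)
    have := Nat.pow_pred_clog_lt_self (b := 2) (by norm_num) h1
    rw [Nat.lt_ceil] at this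
    exact_mod_cast this
  set Λ : ℕ → Set (Space d) := fun i => lev ⁻¹' {i}
  have hΛ (i) : MeasurableSet (Λ i) := hlev (measurableSet_singleton i)
  set F : ℕ → Set (Space d) := fun i => closedBall z r ∩ Λ i
  have hF (i) : MeasurableSet (F i) := measurableSet_closedBall.inter (hΛ i)
  have hVz : volume (closedBall z r) = V := Measure.addHaar_closedBall_center _ _ _
  have hFtop (i) : volume (F i) ≠ ∞ :=
    ne_top_of_le_ne_top (hVz ▸ hV) (measure_mono inter_subset_left)
  -- Chebyshev for `i ≥ 1`, with `2^p` absorbing the shift to `2^(i-1)`; the volume of the ball for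
  -- `i = 0`. After taking the power `a`, the sum over `i` of `2^i |F i|^a` converges because `p a >
  -- 1`.
  have hFvol (i : ℕ) : volume (F i) ≤ D * 2 ^ (-((i : ℝ) * p)) := by
    rcases Nat.eq_zero_or_pos i with rfl | hi
    · simp only [Nat.cast_zero, zero_mul, neg_zero, ENNReal.rpow_zero, mul_one]
      calc volume (F 0) ≤ V := hVz ▸ measure_mono inter_subset_left
        _ ≤ (1 + V) * 1 := by rw [mul_one]; exact le_add_self
        _ ≤ D := by
          rw [hD]; gcongr
          exact ENNReal.one_le_rpow (by norm_num) hp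
    · have h1 : (2 : ℝ≥0∞) ^ (((i : ℝ) - 1) * p) * volume (F i) ≤ 1 := by
        refine le_trans ?_ hfp
        rw [← setLIntegral_const]
        refine (setLIntegral_mono (f := fun _ => _) (g := fun x => ENNReal.ofReal (f x) ^ p) ?_ ?_).trans
          (setLIntegral_le_lintegral _ _)
        · exact (ENNReal.measurable_ofReal.comp hf.measurable).pow_const p
        · rintro x ⟨-, hx⟩
          have hx' : lev x = i := hx
          rw [ENNReal.rpow_mul]
          refine ENNReal.rpow_le_rpow ?_ hp.le
          have := hgt x (by omega)
          rw [hx'] at this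
          have e : (2 : ℝ≥0∞) ^ ((i : ℝ) - 1) = ENNReal.ofReal (2 ^ (i - 1)) := by
            rw [← Nat.cast_pred hi, ENNReal.rpow_natCast, ENNReal.ofReal_pow (by norm_num)]
            simp
          rw [e]
          exact ENNReal.ofReal_le_ofReal this.le
      have h2 : volume (F i) ≤ (2 : ℝ≥0∞) ^ (-(((i : ℝ) - 1) * p)) := by
        rw [ENNReal.rpow_neg, ← one_div, ENNReal.le_div_iff_mul_le (by simp) (by simp),
          mul_comm]
        exact h1
      refine h2.trans ?_
      have e : -(((i : ℝ) - 1) * p) = p + -((i : ℝ) * p) := by ring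
      rw [e, ENNReal.rpow_add _ _ (by norm_num) (by norm_num), hD, mul_assoc]
      exact le_mul_of_one_le_left' le_self_add
  set g : ℕ → Space d → ℝ := fun i x => (2 ^ i : ℝ)⁻¹ * (Λ i).indicator f x
  have hgm (i) : Measurable (g i) := (hf.measurable.indicator (hΛ i)).const_mul _
  have hgi (i) : Integrable (fun x => (2 ^ i : ℝ) * g i x) := by
    simp only [g, ← mul_assoc]
    simp only [mul_inv_cancel₀ (pow_ne_zero i (two_ne_zero (α := ℝ))), one_mul]
    exact hfi.indicator (hΛ i)
  have hgF (i) (x) : |g i x| ≤ (F i).indicator 1 x := by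
    by_cases hx : x ∈ Λ i
    · by_cases hz : x ∈ closedBall z r
      · rw [indicator_of_mem (show x ∈ F i from ⟨hz, hx⟩), Pi.one_apply]
        simp only [g, indicator_of_mem hx]
        have hx' : lev x = i := hx
        have := hle x
        rw [hx'] at this
        rw [abs_of_nonneg (mul_nonneg (by positivity) (hf0 x)), inv_mul_le_iff₀ (by positivity), mul_one]
        exact this
      · simp only [g, indicator_of_mem hx, hfz x hz, mul_zero, abs_zero]
        exact indicator_nonneg (fun _ _ => zero_le_one) x
    · simp only [g, indicator_of_notMem hx, mul_zero, abs_zero]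
      exact indicator_nonneg (fun _ _ => zero_le_one) x
  have hfsum : f = fun x => ∑ i ∈ Finset.range (K + 1), (2 ^ i : ℝ) * g i x := by
    ext x
    rw [Finset.sum_eq_single (lev x)]
    · have hx : x ∈ Λ (lev x) := rfl
      simp only [g, indicator_of_mem hx, ← mul_assoc]
      rw [mul_inv_cancel₀ (by positivity), one_mul]
    · intro i _ hi
      have hx : x ∉ Λ i := fun h => hi (Eq.symm h)
      simp [g, indicator_of_notMem hx]
    · exact fun h => absurd (hlevK x) h
  have hj (j : ℕ) : ∫⁻ x in G, pieceMaximal E ψ (j + 1) f x ≤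
      A * D ^ a * S₁ * 2 ^ ((j : ℝ) * e) * volume G ^ (1 - b) := by
    calc ∫⁻ x in G, pieceMaximal E ψ (j + 1) f x
        ≤ ∫⁻ x in G, ∑ i ∈ Finset.range (K + 1), pieceMaximal E ψ (j + 1) (fun x => 2 ^ i * g i x) x := by
          refine lintegral_mono fun x => ?_
          conv_lhs => rw [hfsum]
          exact pieceMaximal_sum_le hψ E (j + 1) _ _ (fun i _ => hgi i) x
      _ = ∑ i ∈ Finset.range (K + 1), ∫⁻ x in G, pieceMaximal E ψ (j + 1) (fun x => 2 ^ i * g i x) x :=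
          lintegral_finsetSum _ fun i _ => measurable_pieceMaximal hψ E _ (hgi i)
      _ ≤ ∑ i ∈ Finset.range (K + 1),
          (2 : ℝ≥0∞) ^ ((i : ℝ) * (1 - p * a)) * (A * D ^ a * 2 ^ ((j : ℝ) * e) * volume G ^ (1 - b)) := by
          refine Finset.sum_le_sum fun i _ => ?_
          simp_rw [pieceMaximal_const_mul]
          rw [lintegral_const_mul' _ _ enorm_ne_top]
          have e1 : ‖(2 ^ i : ℝ)‖ₑ = (2 : ℝ≥0∞) ^ (i : ℝ) := by
            rw [← ofReal_norm, norm_pow, ENNReal.ofReal_pow (norm_nonneg _), ENNReal.rpow_natCast]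
            simp
          have e2 : (2 : ℝ≥0∞) ^ (((j + 1 : ℕ) : ℝ) * e) ≤ 2 ^ ((j : ℝ) * e) := by
            refine ENNReal.rpow_le_rpow_of_exponent_le (by norm_num) ?_
            push_cast; linarith
          have e3 : volume (F i) ^ a ≤ D ^ a * 2 ^ (-((i : ℝ) * (p * a))) := by
            refine (ENNReal.rpow_le_rpow (hFvol i) ha).trans (le_of_eq ?_)
            rw [ENNReal.mul_rpow_of_nonneg _ _ ha, ← ENNReal.rpow_mul]
            congr 2; ring
          rw [e1]
          calc (2 : ℝ≥0∞) ^ (i : ℝ) * ∫⁻ x in G, pieceMaximal E ψ (j + 1) (g i) x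
              ≤ (2 : ℝ≥0∞) ^ (i : ℝ) * (A * 2 ^ ((j : ℝ) * e) * (D ^ a * 2 ^ (-((i : ℝ) * (p * a)))) *
                  volume G ^ (1 - b)) := by
                gcongr
                refine (hA (j + 1) (by omega) (g i) (F i) G (hgm i) (hF i) (hFtop i) (hgF i) hG hG').trans ?_
                gcongr
            _ = _ := by
                have : (i : ℝ) * (1 - p * a) = i + -((i : ℝ) * (p * a)) := by ring
                rw [this, ENNReal.rpow_add _ _ (by norm_num) (by norm_num)]
                ring
      _ ≤ S₁ * (A * D ^ a * 2 ^ ((j : ℝ) * e) * volume G ^ (1 - b)) := by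
          rw [← Finset.sum_mul]
          gcongr
          exact ENNReal.sum_le_tsum _
      _ = _ := by ring
  rw [lintegral_tsum fun j => (measurable_pieceMaximal hψ E _ hfi).aemeasurable]
  refine (ENNReal.tsum_le_tsum hj).trans (le_of_eq ?_)
  rw [ENNReal.tsum_mul_right, ENNReal.tsum_mul_left]

end StrongType

/-! ### Local strong bounds and their globalisation. -/

section Global

variable {d : ℕ} {E : Set ℝ}

/-- The maximal function of a nonnegative function, defined by lower integrals. -/
noncomputable def upperMaximal (E : Set ℝ) (g : Space d → ℝ≥0∞) (x : Space d) : ℝ≥0∞ :=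
  ⨆ t ∈ E, ∫⁻ y : Sph d, g (x - t • (y : Space d)) ∂sigma d

lemma measurable_upperMaximal_of_continuous [Fact (2 ≤ d)] {g : Space d → ℝ≥0} (hg : Continuous g) :
    Measurable (upperMaximal E fun x => (g x : ℝ≥0∞)) := by
  refine LowerSemicontinuous.measurable
    (lowerSemicontinuous_biSup fun t _ => Continuous.lowerSemicontinuous ?_)
  have hi (x : Space d) : Integrable (fun y : Sph d => (g (x - t • (y : Space d)) : ℝ)) (sigma d) :=
    integrable_sphere (by fun_prop)
  have e (x : Space d) : ∫⁻ y : Sph d, (g (x - t • (y : Space d)) : ℝ≥0∞) ∂sigma d =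
      ENNReal.ofReal (∫ y : Sph d, (g (x - t • (y : Space d)) : ℝ) ∂sigma d) := by
    rw [ofReal_integral_eq_lintegral_ofReal (hi x) (ae_of_all _ fun y => NNReal.coe_nonneg _)]
    simp
  simp_rw [e]
  refine ENNReal.continuous_ofReal.comp ?_
  have := continuous_parametric_integral_of_continuous (μ := sigma d)
    (f := fun (x : Space d) (y : Sph d) => (g (x - t • (y : Space d)) : ℝ)) (by fun_prop)
    (isCompact_univ (X := Sph d))
  simpa using this

lemma enorm_integral_eq_lintegral_ofReal [Fact (2 ≤ d)] {f : Space d → ℝ} (hf : Continuous f)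
    (hf0 : ∀ x, 0 ≤ f x) (t : ℝ) (x : Space d) :
    ∫⁻ y : Sph d, ENNReal.ofReal (f (x - t • (y : Space d))) ∂sigma d =
      ‖∫ y : Sph d, f (x - t • (y : Space d)) ∂sigma d‖ₑ := by
  have hi : Integrable (fun y : Sph d => f (x - t • (y : Space d))) (sigma d) :=
    integrable_sphere (by fun_prop)
  rw [← ofReal_integral_eq_lintegral_ofReal hi (ae_of_all _ fun y => hf0 _),
    Real.enorm_of_nonneg (integral_nonneg fun y => hf0 _)]

/-- A local strong type bound for the maximal operator, for functions of norm at most one. -/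
def LocalBound (d : ℕ) (E : Set ℝ) (p q : ℝ) : Prop :=
  ∃ C : ℝ≥0∞, C ≠ ∞ ∧ ∀ (z : Space d) (f : Space d → ℝ), Continuous f → HasCompactSupport f →
    (∀ x, 0 ≤ f x) → (∀ x ∉ closedBall z 4, f x = 0) → ∫⁻ x, ENNReal.ofReal (f x) ^ p ≤ 1 →
    ∫⁻ x in closedBall z 1, upperMaximal E (fun x => ENNReal.ofReal (f x)) x ^ q ≤ C

lemma localBound_of_restrictedBound [hd : Fact (2 ≤ d)] (hE : E ⊆ Icc 1 2) {p q : ℝ}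
    (hp : 1 ≤ p) (hq : 1 ≤ q) (hB : ∀ C R, 0 ≤ C → 0 ≤ R → ∃ a b e, 0 < b ∧ e < 0 ∧ 1 < p * a ∧
      q * b < 1 ∧ RestrictedBound d E C R a b e) : LocalBound d E p q := by
  obtain ⟨φ, ψ, hφ, hψ, hφ1, hψφ, hψd⟩ := exists_littlewoodPaley (d := d) (2 * d) (3 * d + 1)
  obtain ⟨C₀, R₀, hC₀, hR₀, hker⟩ := exists_isShellKernel hψ hψd
  obtain ⟨a, b, e, hb, he, hpa, hqb, hB'⟩ := hB C₀ R₀ hC₀ hR₀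
  obtain ⟨C₁, hC₁, h₁⟩ := exists_lintegral_tsum_pieceMaximal_le hψ hB'.1 he (by linarith) hpa
    (hB'.lintegral_pieceMaximal_le hE hψ hker) 4
  obtain ⟨M, hM⟩ := exists_enorm_integral_sphere_le hφ hφ1 hψ hψφ
  set V : ℝ → ℝ≥0∞ := fun r => volume (closedBall (0 : Space d) r)
  have hV (r) : V r ≠ ∞ := measure_closedBall_lt_top.ne
  have hVz (z : Space d) (r) : volume (closedBall z r) = V r := Measure.addHaar_closedBall_center _ _ _
  set C₂ : ℝ≥0∞ := V 1 + 2 ^ q * C₁ ^ b⁻¹ * ∑' k : ℕ, (2 : ℝ≥0∞) ^ ((k : ℝ) * (q - b⁻¹))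
  have hC₂ : C₂ ≠ ∞ := by
    refine ENNReal.add_ne_top.2 ⟨hV 1, ENNReal.mul_ne_top (ENNReal.mul_ne_top (two_rpow_ne_top _)
      (ENNReal.rpow_ne_top_of_nonneg (by positivity) hC₁)) (tsum_two_rpow_ne_top ?_)⟩
    have : q < b⁻¹ := by rwa [lt_inv_comm₀ (by linarith) hb, ← one_div, lt_div_iff₀ (by linarith), mul_comm]
    linarith
  refine ⟨2 ^ (q - 1) * ((M * (V 4 + 1)) ^ q * V 1 + C₂), ?_, ?_⟩
  · refine ENNReal.mul_ne_top (two_rpow_ne_top _) (ENNReal.add_ne_top.2 ⟨ENNReal.mul_ne_top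
      (ENNReal.rpow_ne_top_of_nonneg (by linarith) (ENNReal.mul_ne_top (by simp) ?_)) (hV 1), hC₂⟩)
    exact ENNReal.add_ne_top.2 ⟨hV 4, by simp⟩
  intro z f hf hfc hf0 hfz hfp
  have hfi : Integrable f := hf.integrable_of_hasCompactSupport hfc
  set S : Space d → ℝ≥0∞ := fun x => ∑' j : ℕ, pieceMaximal E ψ (j + 1) f x
  have hS : Measurable S := Measurable.tsum fun j => measurable_pieceMaximal hψ E _ hfi
  -- Pointwise `f ≤ 1 + f^p` on the ball, since `p ≥ 1`.
  have hL1 : ∫⁻ y, ‖f y‖ₑ ≤ V 4 + 1 := by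
    calc ∫⁻ y, ‖f y‖ₑ ≤ ∫⁻ y, ((closedBall z 4).indicator 1 y + ENNReal.ofReal (f y) ^ p) := by
          refine lintegral_mono fun y => ?_
          by_cases hy : y ∈ closedBall z 4
          · rw [indicator_of_mem hy, Pi.one_apply, Real.enorm_of_nonneg (hf0 y)]
            rcases le_total (ENNReal.ofReal (f y)) 1 with h | h
            · exact h.trans le_self_add
            · refine le_trans ?_ le_add_self
              simpa using ENNReal.rpow_le_rpow_of_exponent_le h hp
          · simp [hfz y hy]
      _ = V 4 + ∫⁻ y, ENNReal.ofReal (f y) ^ p := by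
          rw [lintegral_add_left (measurable_one.indicator measurableSet_closedBall),
            lintegral_indicator_one measurableSet_closedBall, hVz]
      _ ≤ V 4 + 1 := by gcongr
  have hpt (x) : upperMaximal E (fun x => ENNReal.ofReal (f x)) x ≤ M * (V 4 + 1) + S x := by
    refine iSup₂_le fun t ht => ?_
    rw [enorm_integral_eq_lintegral_ofReal hf hf0]
    refine (hM f hf hfc E t ht x).trans ?_
    gcongr
  have hSq : ∫⁻ x in closedBall z 1, S x ^ q ≤ C₂ := by
    have := lintegral_rpow_le_of_lintegral_le (μ := volume) hS measurableSet_closedBall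
      (hVz z 1 ▸ hV 1) hb (by linarith : 0 < q) (fun G hG hGm => h₁ z f hf hfc hf0 hfz hfp G hGm
        (ne_top_of_le_ne_top (hVz z 1 ▸ hV 1) (measure_mono hG)))
    rwa [hVz] at this
  calc ∫⁻ x in closedBall z 1, upperMaximal E (fun x => ENNReal.ofReal (f x)) x ^ q
      ≤ ∫⁻ x in closedBall z 1, 2 ^ (q - 1) * ((M * (V 4 + 1)) ^ q + S x ^ q) := by
        refine lintegral_mono fun x => ?_
        refine (ENNReal.rpow_le_rpow (hpt x) (by linarith)).trans ?_
        exact ENNReal.rpow_add_le_mul_rpow_add_rpow _ _ hq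
    _ = 2 ^ (q - 1) * ((M * (V 4 + 1)) ^ q * V 1 + ∫⁻ x in closedBall z 1, S x ^ q) := by
        have hm : Measurable fun x => (M * (V 4 + 1)) ^ q + S x ^ q :=
          measurable_const.add (hS.pow_const q)
        rw [lintegral_const_mul _ hm,
          lintegral_add_left measurable_const, setLIntegral_const, hVz]
    _ ≤ _ := by gcongr

lemma lintegral_ofReal_rpow_ne_top {f : Space d → ℝ} (hf : Continuous f) (hfc : HasCompactSupport f)
    (hf0 : ∀ x, 0 ≤ f x) {p : ℝ} (hp : 0 < p) : ∫⁻ x, ENNReal.ofReal (f x) ^ p ≠ ∞ := by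
  have h1 : Integrable fun x => f x ^ p := by
    refine Continuous.integrable_of_hasCompactSupport (hf.rpow_const fun x => Or.inr hp.le) ?_
    exact hfc.comp_left (g := fun u : ℝ => u ^ p) (Real.zero_rpow hp.ne')
  have h2 := h1.lintegral_lt_top
  refine ne_top_of_le_ne_top h2.ne (lintegral_mono fun x => ?_)
  rw [ENNReal.ofReal_rpow_of_nonneg (hf0 x) hp.le]

lemma upperMaximal_const_mul {c : ℝ≥0∞} (hc : c ≠ ∞) (g : Space d → ℝ≥0∞) (x : Space d) :
    upperMaximal E (fun x => c * g x) x = c * upperMaximal E g x := by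
  simp only [upperMaximal, ENNReal.mul_iSup]
  congr 1; ext t; congr 1; ext ht
  exact lintegral_const_mul' _ _ hc

/-- Division by the norm of `f`; when the norm vanishes, continuity gives `f = 0`. -/
lemma LocalBound.homogeneous {p q : ℝ} (hp : 0 < p) (hq : 0 < q) (h : LocalBound d E p q) :
    ∃ C : ℝ≥0∞, C ≠ ∞ ∧ ∀ (z : Space d) (f : Space d → ℝ), Continuous f → HasCompactSupport f →
      (∀ x, 0 ≤ f x) → (∀ x ∉ closedBall z 4, f x = 0) →
      ∫⁻ x in closedBall z 1, upperMaximal E (fun x => ENNReal.ofReal (f x)) x ^ q ≤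
        C * (∫⁻ x, ENNReal.ofReal (f x) ^ p) ^ (q / p) := by
  obtain ⟨C, hC, h⟩ := h
  refine ⟨C, hC, fun z f hf hfc hf0 hfz => ?_⟩
  set I := ∫⁻ x, ENNReal.ofReal (f x) ^ p with hI
  have hItop : I ≠ ∞ := lintegral_ofReal_rpow_ne_top hf hfc hf0 hp
  rcases eq_or_ne I 0 with h0 | h0
  · have hf' : f = 0 := by
      have hfm : Measurable fun x => ENNReal.ofReal (f x) ^ p :=
        (ENNReal.measurable_ofReal.comp hf.measurable).pow_const p
      rw [hI, lintegral_eq_zero_iff hfm] at h0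
      refine (hf.ae_eq_iff_eq volume continuous_zero).1 ?_
      filter_upwards [h0] with x hx
      simp only [Pi.zero_apply, ENNReal.rpow_eq_zero_iff, ENNReal.ofReal_eq_zero] at hx
      rcases hx with ⟨hx, -⟩ | ⟨hx, -⟩
      · exact le_antisymm hx (hf0 x)
      · simp at hx
    have : ∀ x, upperMaximal E (fun x => ENNReal.ofReal (f x)) x ^ q = 0 := by
      intro x
      simp [upperMaximal, hf', hq]
    simp [this]
  set N : ℝ := (I ^ p⁻¹).toReal with hN
  have hIp : I ^ p⁻¹ ≠ ∞ := ENNReal.rpow_ne_top_of_nonneg (by positivity) hItop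
  have hIp0 : I ^ p⁻¹ ≠ 0 := by simp [ENNReal.rpow_eq_zero_iff, h0, hItop]
  have hNpos : 0 < N := ENNReal.toReal_pos hIp0 hIp
  have hNe : ENNReal.ofReal N = I ^ p⁻¹ := ENNReal.ofReal_toReal hIp
  have hfac (x) : ENNReal.ofReal (f x) = ENNReal.ofReal N * ENNReal.ofReal (N⁻¹ * f x) := by
    rw [← ENNReal.ofReal_mul hNpos.le, ← mul_assoc, mul_inv_cancel₀ hNpos.ne', one_mul]
  have hIN : I = ENNReal.ofReal N ^ p * ∫⁻ x, ENNReal.ofReal (N⁻¹ * f x) ^ p := by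
    rw [← lintegral_const_mul' _ _ (ENNReal.rpow_ne_top_of_nonneg hp.le ENNReal.ofReal_ne_top), hI]
    congr 1; ext x
    rw [hfac x, ENNReal.mul_rpow_of_nonneg _ _ hp.le]
  have hNp : ENNReal.ofReal N ^ p = I := by
    rw [hNe, ← ENNReal.rpow_mul, inv_mul_cancel₀ hp.ne', ENNReal.rpow_one]
  have hone : ∫⁻ x, ENNReal.ofReal (N⁻¹ * f x) ^ p ≤ 1 := by
    rw [hNp] at hIN
    refine (ENNReal.mul_le_mul_iff_right h0 hItop).1 ?_
    rw [← hIN, mul_one]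
  have key := h z (fun x => N⁻¹ * f x) (continuous_const.mul hf) hfc.mul_left
    (fun x => mul_nonneg (by positivity) (hf0 x)) (fun x hx => by rw [hfz x hx, mul_zero]) hone
  have e : (fun x => ENNReal.ofReal (f x)) = fun x => ENNReal.ofReal N * ENNReal.ofReal (N⁻¹ * f x) :=
    funext hfac
  rw [e]
  simp_rw [upperMaximal_const_mul ENNReal.ofReal_ne_top, ENNReal.mul_rpow_of_nonneg _ _ hq.le]
  rw [lintegral_const_mul' _ _ (ENNReal.rpow_ne_top_of_nonneg hq.le ENNReal.ofReal_ne_top)]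
  have e2 : ENNReal.ofReal N ^ q = I ^ (q / p) := by
    rw [hNe, ← ENNReal.rpow_mul]; congr 1; field_simp
  rw [e2, mul_comm]
  gcongr

/-- Fubini. Averaging over all centres takes the place of a covering by balls of bounded overlap. -/
lemma lintegral_lintegral_closedBall {h : Space d → ℝ≥0∞} (hh : Measurable h) (r : ℝ) :
    ∫⁻ z, ∫⁻ x in closedBall z r, h x = volume (closedBall (0 : Space d) r) * ∫⁻ x, h x := by
  have hset : MeasurableSet {w : Space d × Space d | dist w.2 w.1 ≤ r} :=
    measurableSet_le (by fun_prop) measurable_const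
  have hm : Measurable fun w : Space d × Space d =>
      {w : Space d × Space d | dist w.2 w.1 ≤ r}.indicator (fun w => h w.2) w :=
    (hh.comp measurable_snd).indicator hset
  have e1 (z : Space d) : ∫⁻ x in closedBall z r, h x =
      ∫⁻ x, {w : Space d × Space d | dist w.2 w.1 ≤ r}.indicator (fun w => h w.2) (z, x) := by
    rw [← lintegral_indicator measurableSet_closedBall]
    rfl
  simp_rw [e1]
  rw [lintegral_lintegral_swap hm.aemeasurable]
  have e2 (x : Space d) :
      ∫⁻ z, {w : Space d × Space d | dist w.2 w.1 ≤ r}.indicator (fun w => h w.2) (z, x) =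
        volume (closedBall (0 : Space d) r) * h x := by
    have : ∀ z, {w : Space d × Space d | dist w.2 w.1 ≤ r}.indicator (fun w => h w.2) (z, x) =
        (closedBall x r).indicator (fun _ => h x) z := by
      intro z
      simp only [indicator, mem_closedBall]
      rw [dist_comm z x]
      rfl
    simp_rw [this]
    rw [lintegral_indicator measurableSet_closedBall, setLIntegral_const,
      Measure.addHaar_closedBall_center, mul_comm]
  simp_rw [e2]
  rw [lintegral_const_mul _ hh]

/-- The strong type bound for the maximal operator on continuous functions of compact support. -/
def StrongBound (d : ℕ) (E : Set ℝ) (p q : ℝ) : Prop :=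
  ∃ C : ℝ≥0∞, C ≠ ∞ ∧ ∀ f : Space d → ℝ, Continuous f → HasCompactSupport f → (∀ x, 0 ≤ f x) →
    ∫⁻ x, upperMaximal E (fun x => ENNReal.ofReal (f x)) x ^ q ≤
      C * (∫⁻ x, ENNReal.ofReal (f x) ^ p) ^ (q / p)

lemma LocalBound.strongBound [hd : Fact (2 ≤ d)] (hE : E ⊆ Icc 1 2) {p q : ℝ} (hp : 0 < p)
    (hpq : p ≤ q) (h : LocalBound d E p q) : StrongBound d E p q := by
  obtain ⟨C, hC, h⟩ := h.homogeneous hp (by linarith)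
  set V : ℝ → ℝ≥0∞ := fun r => volume (closedBall (0 : Space d) r)
  have hV (r) : V r ≠ ∞ := measure_closedBall_lt_top.ne
  have hV0 : V 1 ≠ 0 := (measure_closedBall_pos volume _ one_pos).ne'
  refine ⟨(V 1)⁻¹ * (C * V 4), ENNReal.mul_ne_top (ENNReal.inv_ne_top.2 hV0)
    (ENNReal.mul_ne_top hC (hV 4)), ?_⟩
  intro f hf hfc hf0
  set I := ∫⁻ x, ENNReal.ofReal (f x) ^ p with hI
  have hItop : I ≠ ∞ := lintegral_ofReal_rpow_ne_top hf hfc hf0 hp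
  have hfm : Measurable fun x => ENNReal.ofReal (f x) ^ p :=
    (ENNReal.measurable_ofReal.comp hf.measurable).pow_const p
  have hMm : Measurable fun x => upperMaximal E (fun x => ENNReal.ofReal (f x)) x ^ q :=
    (measurable_upperMaximal_of_continuous (g := fun x => (f x).toNNReal) (by fun_prop)).pow_const q
  -- Here `p ≤ q` enters: it gives `I'^(q/p) ≤ I^(q/p-1) I'`, which is additive in the local
  -- integrals `I'`.
  have hqp : 0 ≤ q / p - 1 := by rw [sub_nonneg, one_le_div hp]; exact hpq
  have hloc (z : Space d) : ∫⁻ x in closedBall z 1, upperMaximal E (fun x => ENNReal.ofReal (f x)) x ^ q ≤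
      C * I ^ (q / p - 1) * ∫⁻ x in closedBall z 4, ENNReal.ofReal (f x) ^ p := by
    -- Radii are at most `2`, so on the unit ball around `z` the maximal function sees `f` only
    -- within distance `3`, where the cutoff equals one.
    set χ : Space d → ℝ := fun x => max 0 (min 1 (4 - dist x z))
    have hχ : Continuous χ := by fun_prop
    have hχ0 (x) : 0 ≤ χ x := le_max_left _ _
    have hχ1 (x) : χ x ≤ 1 := max_le zero_le_one (min_le_left _ _)
    have hχz (x) (hx : x ∉ closedBall z 4) : χ x = 0 := by
      rw [mem_closedBall, not_le] at hx
      exact max_eq_left ((min_le_right _ _).trans (by linarith))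
    have hχ3 (x) (hx : dist x z ≤ 3) : χ x = 1 := by
      simp only [χ]
      rw [min_eq_left (by linarith), max_eq_right zero_le_one]
    have key := h z (fun x => f x * χ x) (hf.mul hχ) hfc.mul_right
      (fun x => mul_nonneg (hf0 x) (hχ0 x)) (fun x hx => by rw [hχz x hx, mul_zero])
    have e1 : ∫⁻ x in closedBall z 1, upperMaximal E (fun x => ENNReal.ofReal (f x)) x ^ q =
        ∫⁻ x in closedBall z 1, upperMaximal E (fun x => ENNReal.ofReal (f x * χ x)) x ^ q := by
      refine setLIntegral_congr_fun measurableSet_closedBall fun x hx => ?_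
      have : upperMaximal E (fun x => ENNReal.ofReal (f x)) x =
          upperMaximal E (fun x => ENNReal.ofReal (f x * χ x)) x := by
        simp only [upperMaximal]
        refine iSup_congr fun t => iSup_congr fun ht => ?_
        congr 1; ext y
        rw [hχ3, mul_one]
        have ht := hE ht
        rw [mem_closedBall, dist_eq_norm] at hx
        rw [dist_eq_norm]
        have hy : ‖t • (y : Space d)‖ = t := by
          rw [norm_smul, norm_eq_of_mem_sphere y, mul_one, Real.norm_of_nonneg (by linarith [ht.1])]
        calc ‖x - t • (y : Space d) - z‖ = ‖(x - z) - t • (y : Space d)‖ := by congr 1; abel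
          _ ≤ ‖x - z‖ + ‖t • (y : Space d)‖ := norm_sub_le _ _
          _ ≤ 3 := by rw [hy]; linarith [ht.2]
      simp only [this]
    set I' := ∫⁻ x in closedBall z 4, ENNReal.ofReal (f x) ^ p with hI'
    have e2 : ∫⁻ x, ENNReal.ofReal (f x * χ x) ^ p ≤ I' := by
      rw [hI', ← lintegral_indicator measurableSet_closedBall]
      refine lintegral_mono fun x => ?_
      by_cases hx : x ∈ closedBall z 4
      · rw [indicator_of_mem hx]
        refine ENNReal.rpow_le_rpow (ENNReal.ofReal_le_ofReal ?_) hp.le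
        exact mul_le_of_le_one_right (hf0 x) (hχ1 x)
      · simp [hχz x hx, hp]
    have e3 : I' ≤ I := setLIntegral_le_lintegral _ _
    rw [e1]
    refine key.trans ?_
    calc C * (∫⁻ x, ENNReal.ofReal (f x * χ x) ^ p) ^ (q / p) ≤ C * I' ^ (q / p) := by
          have : 0 ≤ q / p := by linarith
          gcongr
      _ = C * (I' ^ (q / p - 1) * I') := by
          conv_lhs => rw [show q / p = (q / p - 1) + 1 by ring,
            ENNReal.rpow_add_of_nonneg _ _ hqp zero_le_one, ENNReal.rpow_one]
      _ ≤ C * (I ^ (q / p - 1) * I') := by gcongr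
      _ = _ := by ring
  have hfin : V 1 * ∫⁻ x, upperMaximal E (fun x => ENNReal.ofReal (f x)) x ^ q ≤
      C * V 4 * I ^ (q / p) := by
    rw [← lintegral_lintegral_closedBall hMm 1]
    refine (lintegral_mono hloc).trans ?_
    rw [lintegral_const_mul' _ _ (ENNReal.mul_ne_top hC (ENNReal.rpow_ne_top_of_nonneg hqp hItop)),
      lintegral_lintegral_closedBall hfm 4]
    refine le_of_eq ?_
    conv_rhs => rw [show q / p = (q / p - 1) + 1 by ring,
      ENNReal.rpow_add_of_nonneg _ _ hqp zero_le_one, ENNReal.rpow_one]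
    ring
  rw [mul_assoc, ← ENNReal.mul_le_iff_le_inv hV0 (hV 1)]
  exact hfin

end Global

/-! ### Null sets are invisible to almost all spheres. -/

section NullSets

variable {d : ℕ} {E : Set ℝ} {p q : ℝ}

/-- Indicators of open sets are limits from below of admissible functions, so estimates for
continuous functions of compact support reach open sets by Fatou. -/
lemma exists_compactSupport_approx {U : Set (Space d)} (hU : IsOpen U) :
    ∃ u : ℕ → Space d → ℝ, (∀ k, Continuous (u k)) ∧ (∀ k, HasCompactSupport (u k)) ∧
      (∀ k x, 0 ≤ u k x) ∧ (∀ k x, u k x ≤ U.indicator 1 x) ∧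
      ∀ x ∈ U, Tendsto (fun k => u k x) atTop (𝓝 1) := by
  have hF : IsClosed Uᶜ := hU.isClosed_compl
  set χ : ℕ → Space d → ℝ := fun k x => max 0 (min 1 ((k : ℝ) - ‖x‖))
  have hχ0 (k x) : 0 ≤ χ k x := le_max_left _ _
  have hχ1 (k x) : χ k x ≤ 1 := max_le zero_le_one (min_le_left _ _)
  have ha1 (k x) : (hF.apprSeq k x : ℝ) ≤ 1 := by
    exact_mod_cast HasOuterApproxClosed.apprSeq_apply_le_one hF k x
  refine ⟨fun k x => (1 - (hF.apprSeq k x : ℝ)) * χ k x, fun k => ?_, fun k => ?_, fun k x => ?_,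
    fun k x => ?_, fun x hx => ?_⟩
  · have h1 : Continuous fun x => (hF.apprSeq k x : ℝ) :=
      NNReal.continuous_coe.comp (hF.apprSeq k).continuous
    have h2 : Continuous (χ k) := by fun_prop
    exact (continuous_const.sub h1).mul h2
  · refine HasCompactSupport.mul_left (HasCompactSupport.intro (isCompact_closedBall 0 (k : ℝ)) ?_)
    intro x hx
    rw [mem_closedBall_zero_iff, not_le] at hx
    exact max_eq_left ((min_le_right _ _).trans (by linarith))
  · exact mul_nonneg (by linarith [ha1 k x]) (hχ0 k x)
  · by_cases hx : x ∈ U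
    · rw [indicator_of_mem hx, Pi.one_apply]
      exact mul_le_one₀ (by linarith [(hF.apprSeq k x).coe_nonneg]) (hχ0 k x) (hχ1 k x)
    · have := HasOuterApproxClosed.apprSeq_apply_eq_one hF k (x := x) hx
      simp [this, indicator_of_notMem hx]
  · have h1 : Tendsto (fun k => (hF.apprSeq k x : ℝ)) atTop (𝓝 0) := by
      have := tendsto_pi_nhds.1 (HasOuterApproxClosed.tendsto_apprSeq hF) x
      rw [indicator_of_notMem (by simpa using hx)] at this
      simpa using NNReal.tendsto_coe.2 this
    have h2 : Tendsto (fun k => χ k x) atTop (𝓝 1) := by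
      refine tendsto_const_nhds.congr' ?_
      filter_upwards [eventually_ge_atTop ⌈‖x‖ + 1⌉₊] with k hk
      have : ‖x‖ + 1 ≤ k := (Nat.le_ceil _).trans (by exact_mod_cast hk)
      simp only [χ]
      rw [min_eq_left (by linarith), max_eq_right zero_le_one]
    simpa using (h1.const_sub 1).mul h2

/-- For open sets, the maximal function of the indicator is dominated by a function whose norm is
controlled by the measure of the set. -/
lemma StrongBound.exists_majorant [hd : Fact (2 ≤ d)] (hp : 0 < p) (hq : 0 < q) (h : StrongBound d E p q) :
    ∃ C : ℝ≥0∞, C ≠ ∞ ∧ ∀ U : Set (Space d), IsOpen U → ∃ H : Space d → ℝ≥0∞, Measurable H ∧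
      (∀ x, ∀ t ∈ E, sigma d {y : Sph d | x - t • (y : Space d) ∈ U} ≤ H x) ∧
      ∫⁻ x, H x ^ q ≤ C * volume U ^ (q / p) := by
  obtain ⟨C, hC, h⟩ := h
  refine ⟨C, hC, fun U hU => ?_⟩
  obtain ⟨u, huc, hus, hu0, huU, hut⟩ := exists_compactSupport_approx hU
  have hm (k) : Measurable (upperMaximal E fun x => ENNReal.ofReal (u k x)) :=
    measurable_upperMaximal_of_continuous (g := fun x => (u k x).toNNReal)
      (continuous_real_toNNReal.comp (huc k))
  refine ⟨fun x => liminf (fun k => upperMaximal E (fun x => ENNReal.ofReal (u k x)) x) atTop,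
    Measurable.liminf hm, fun x t ht => ?_, ?_⟩
  · have hcont : Continuous fun y : Sph d => x - t • (y : Space d) := by fun_prop
    calc sigma d {y : Sph d | x - t • (y : Space d) ∈ U}
        = ∫⁻ y : Sph d, {y : Sph d | x - t • (y : Space d) ∈ U}.indicator 1 y ∂sigma d :=
          (lintegral_indicator_one (hcont.measurable hU.measurableSet)).symm
      _ ≤ ∫⁻ y : Sph d, liminf (fun k => ENNReal.ofReal (u k (x - t • (y : Space d)))) atTop ∂sigma d := by
          refine lintegral_mono fun y => ?_
          by_cases hy : x - t • (y : Space d) ∈ U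
          · have h1 := (ENNReal.continuous_ofReal.tendsto 1).comp (hut _ hy)
            have h2 := h1.liminf_eq
            simp only [Function.comp_def] at h2
            rw [h2]
            exact (indicator_le_self' (fun _ _ => zero_le) y).trans (by simp)
          · rw [indicator_of_notMem (show y ∉ {y : Sph d | x - t • (y : Space d) ∈ U} from hy)]
            exact zero_le
      _ ≤ liminf (fun k => ∫⁻ y : Sph d, ENNReal.ofReal (u k (x - t • (y : Space d))) ∂sigma d) atTop :=
          lintegral_liminf_le fun k => ENNReal.measurable_ofReal.comp ((huc k).comp hcont).measurable
      _ ≤ _ := liminf_le_liminf (Eventually.of_forall fun k =>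
          le_iSup₂ (f := fun t (_ : t ∈ E) =>
            ∫⁻ y : Sph d, ENNReal.ofReal (u k (x - t • (y : Space d))) ∂sigma d) t ht)
  · have e (x) : liminf (fun k => upperMaximal E (fun x => ENNReal.ofReal (u k x)) x) atTop ^ q =
        liminf (fun k => upperMaximal E (fun x => ENNReal.ofReal (u k x)) x ^ q) atTop :=
      (ENNReal.orderIsoRpow q hq).liminf_apply
    simp_rw [e]
    refine (lintegral_liminf_le fun k => (hm k).pow_const q).trans ?_
    refine liminf_le_of_le (by isBoundedDefault) fun b hb => ?_
    obtain ⟨k, hk⟩ := hb.exists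
    refine hk.trans ((h (u k) (huc k) (hus k) (hu0 k)).trans ?_)
    have : ∫⁻ x, ENNReal.ofReal (u k x) ^ p ≤ volume U := by
      rw [← lintegral_indicator_one hU.measurableSet]
      refine lintegral_mono fun x => ?_
      by_cases hx : x ∈ U
      · rw [indicator_of_mem hx, Pi.one_apply]
        refine ENNReal.rpow_le_one ?_ hp.le
        have := huU k x
        rw [indicator_of_mem hx, Pi.one_apply] at this
        simpa using ENNReal.ofReal_le_ofReal this
      · have := huU k x
        rw [indicator_of_notMem hx] at this
        simp [ENNReal.ofReal_of_nonpos this, hp]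
    have hqp : 0 ≤ q / p := by positivity
    gcongr

/-- The exceptional set of `x` must serve all `t ∈ E` at once. The null set is enclosed in open sets
of measure tending to zero; the infimum of their majorants has zero `q`-integral, so it vanishes
almost everywhere and bounds the mass of the null set for every `t`. -/
lemma StrongBound.ae_null [hd : Fact (2 ≤ d)] (hp : 0 < p) (hq : 0 < q) (h : StrongBound d E p q)
    {N : Set (Space d)} (hN : volume N = 0) :
    ∀ᵐ x : Space d, ∀ t ∈ E, ∀ᵐ y : Sph d ∂sigma d, x - t • (y : Space d) ∉ N := by
  obtain ⟨C, hC, h⟩ := h.exists_majorant hp hq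
  have hU (n : ℕ) : ∃ U ⊇ N, IsOpen U ∧ volume U < (n + 1 : ℝ≥0∞)⁻¹ :=
    Set.exists_isOpen_lt_of_lt N _ (by rw [hN]; exact ENNReal.inv_pos.2 (by finiteness))
  choose U hNU hUo hUv using hU
  choose H hHm hH hHi using fun n => h (U n) (hUo n)
  have hI₀ : ∫⁻ x, (⨅ n, H n x) ^ q = 0 := by
    have hle (n : ℕ) : ∫⁻ x, (⨅ n, H n x) ^ q ≤ C * ((n + 1 : ℝ≥0∞)⁻¹) ^ (q / p) := by
      refine (lintegral_mono fun x => ENNReal.rpow_le_rpow (iInf_le _ n) hq.le).trans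
        ((hHi n).trans ?_)
      have hqp : 0 ≤ q / p := by positivity
      have := (hUv n).le
      gcongr
    have hlim : Tendsto (fun n : ℕ => C * ((n + 1 : ℝ≥0∞)⁻¹) ^ (q / p)) atTop (𝓝 0) := by
      have h1 : Tendsto (fun n : ℕ => ((n + 1 : ℝ≥0∞)⁻¹)) atTop (𝓝 0) := by
        have := (tendsto_add_atTop_iff_nat 1).2 ENNReal.tendsto_inv_nat_nhds_zero
        simpa using this
      have h2 := (ENNReal.continuous_rpow_const (y := q / p)).tendsto 0 |>.comp h1
      rw [ENNReal.zero_rpow_of_pos (by positivity)] at h2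
      simpa using ENNReal.Tendsto.const_mul h2 (Or.inr hC)
    exact le_antisymm (ge_of_tendsto' hlim hle) zero_le
  rw [lintegral_eq_zero_iff ((Measurable.iInf hHm).pow_const q)] at hI₀
  filter_upwards [hI₀] with x hx t ht
  have hx0 : ⨅ n, H n x = 0 := by
    rw [Pi.zero_apply, ENNReal.rpow_eq_zero_iff] at hx
    rcases hx with h | h
    · exact h.1
    · exact absurd h.2 (by linarith)
  rw [ae_iff]
  refine le_antisymm (le_trans ?_ hx0.le) zero_le
  refine le_iInf fun n => le_trans (measure_mono fun y hy => ?_) (hH n x t ht)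
  simp only [not_not, mem_ofPred_eq] at hy ⊢
  exact hNU n hy

/-- With weights `2^m` the `r`-th powers are still summable in the integral, so almost everywhere `U
m x` is at most a finite multiple of `2^(-m)`. No triangle inequality is used, hence any `r > 0` is
allowed. -/
lemma ae_tsum_lt_top {X : Type*} [MeasurableSpace X] {μ : Measure X} {U : ℕ → X → ℝ≥0∞}
    (hU : ∀ m, AEMeasurable (U m) μ) {r : ℝ} (hr : 0 < r) {K : ℝ≥0∞} (hK : K ≠ ∞)
    (h : ∀ m : ℕ, ∫⁻ x, U m x ^ r ∂μ ≤ K * (2 : ℝ≥0∞) ^ (-(2 * m * r))) :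
    ∀ᵐ x ∂μ, ∑' m, U m x < ∞ := by
  have hmeas (m : ℕ) : AEMeasurable (fun x => ((2 : ℝ≥0∞) ^ (m : ℝ) * U m x) ^ r) μ :=
    ((hU m).const_mul _).pow_const r
  have hfin : ∫⁻ x, ∑' m : ℕ, ((2 : ℝ≥0∞) ^ (m : ℝ) * U m x) ^ r ∂μ ≠ ∞ := by
    rw [lintegral_tsum hmeas]
    refine ne_top_of_le_ne_top (ENNReal.mul_ne_top hK (tsum_two_rpow_ne_top (ρ := -r) (by linarith))) ?_
    rw [← ENNReal.tsum_mul_left]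
    refine ENNReal.tsum_le_tsum fun m => ?_
    simp_rw [ENNReal.mul_rpow_of_nonneg _ _ hr.le, ← ENNReal.rpow_mul]
    rw [lintegral_const_mul' _ _ (two_rpow_ne_top _)]
    calc (2 : ℝ≥0∞) ^ ((m : ℝ) * r) * ∫⁻ x, U m x ^ r ∂μ
        ≤ (2 : ℝ≥0∞) ^ ((m : ℝ) * r) * (K * (2 : ℝ≥0∞) ^ (-(2 * m * r))) := by gcongr; exact h m
      _ = K * ((2 : ℝ≥0∞) ^ ((m : ℝ) * r) * (2 : ℝ≥0∞) ^ (-(2 * m * r))) := by ring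
      _ = _ := by
          rw [← ENNReal.rpow_add _ _ (by norm_num) (by norm_num)]
          congr 2; ring
  filter_upwards [ae_lt_top' (AEMeasurable.tsum hmeas) hfin] with x hx
  set B := ∑' m : ℕ, ((2 : ℝ≥0∞) ^ (m : ℝ) * U m x) ^ r
  have hle (m : ℕ) : U m x ≤ (2 : ℝ≥0∞) ^ ((m : ℝ) * (-1)) * B ^ r⁻¹ := by
    have h1 : ((2 : ℝ≥0∞) ^ (m : ℝ) * U m x) ^ r ≤ B := ENNReal.le_tsum m
    have h2 : (2 : ℝ≥0∞) ^ (m : ℝ) * U m x ≤ B ^ r⁻¹ := by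
      have := ENNReal.rpow_le_rpow h1 (inv_nonneg.2 hr.le)
      rwa [← ENNReal.rpow_mul, mul_inv_cancel₀ hr.ne', ENNReal.rpow_one] at this
    calc U m x = (2 : ℝ≥0∞) ^ ((m : ℝ) * (-1)) * ((2 : ℝ≥0∞) ^ (m : ℝ) * U m x) := by
          rw [← mul_assoc, ← ENNReal.rpow_add _ _ (by norm_num) (by norm_num)]
          simp
      _ ≤ _ := by gcongr
  refine lt_of_le_of_lt (ENNReal.tsum_le_tsum hle) ?_
  rw [ENNReal.tsum_mul_right]
  exact ENNReal.mul_lt_top (lt_top_iff_ne_top.2 (tsum_two_rpow_ne_top (by norm_num)))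
    (ENNReal.rpow_lt_top_of_nonneg (by positivity) hx.ne)

end NullSets

/-! ### Extension from continuous functions to `L^p`. -/

section Extension

variable {d : ℕ} {E : Set ℝ} {p q : ℝ≥0∞}

lemma integral_rpow_enorm_eq {X ε : Type*} [MeasurableSpace X] [ENorm ε] {μ : Measure X} (hp0 : p ≠ 0)
    (hp : p ≠ ∞) (f : X → ε) : ∫⁻ x, ‖f x‖ₑ ^ p.toReal ∂μ = eLpNorm f p μ ^ p.toReal := by
  rw [eLpNorm_eq_lintegral_rpow_enorm_toReal hp0 hp, ← ENNReal.rpow_mul,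
    one_div_mul_cancel (ENNReal.toReal_pos hp0 hp).ne', ENNReal.rpow_one]

lemma measurable_maximalFunction_of_continuous [Fact (2 ≤ d)] {f : Space d → ℂ} (hf : Continuous f) :
    Measurable (maximalFunction E f) := by
  refine LowerSemicontinuous.measurable
    (lowerSemicontinuous_biSup fun t _ => Continuous.lowerSemicontinuous (Continuous.enorm ?_))
  have := continuous_parametric_integral_of_continuous (μ := sigma d)
    (f := fun (x : Space d) (y : Sph d) => f (x - t • (y : Space d))) (by fun_prop)
    (isCompact_univ (X := Sph d))
  simp only [Measure.restrict_univ] at this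
  exact this

lemma maximalFunction_le_upperMaximal (f : Space d → ℂ) (x : Space d) :
    maximalFunction E f x ≤ upperMaximal E (fun x => ‖f x‖ₑ) x :=
  iSup₂_mono fun _ _ => enorm_integral_le_lintegral_enorm _

lemma upperMaximal_tsum_le [Fact (2 ≤ d)] {g : ℕ → Space d → ℝ≥0∞} (hg : ∀ n, Measurable (g n))
    (x : Space d) : upperMaximal E (fun x => ∑' n, g n x) x ≤ ∑' n, upperMaximal E (g n) x := by
  refine iSup₂_le fun t ht => ?_
  have hm (n) : Measurable fun y : Sph d => g n (x - t • (y : Space d)) := (hg n).comp (by fun_prop)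
  simp only
  rw [lintegral_tsum fun n => (hm n).aemeasurable]
  exact ENNReal.tsum_le_tsum fun n => le_iSup₂ (f := fun t (_ : t ∈ E) =>
    ∫⁻ y : Sph d, g n (x - t • (y : Space d)) ∂sigma d) t ht

/-- The conclusions of the maximal theorem for one function. -/
def MaximalConclusion (E : Set ℝ) (C : ℝ≥0) (p q : ℝ≥0∞) (f : Space d → ℂ) : Prop :=
  (∀ᵐ x : Space d, ∀ t ∈ E, Integrable (fun y : Sph d => f (x - t • (y : Space d))) (sigma d)) ∧
  AEMeasurable (maximalFunction E f) volume ∧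
  eLpNorm (maximalFunction E f) q volume ≤ C * eLpNorm f p volume

lemma StrongBound.exists_eLpNorm_le (hp0 : p ≠ 0) (hp : p ≠ ∞) (hq0 : q ≠ 0) (hq : q ≠ ∞)
    (h : StrongBound d E p.toReal q.toReal) :
    ∃ K : ℝ≥0, ∀ f : Space d → ℂ, Continuous f → HasCompactSupport f →
      eLpNorm (upperMaximal E fun x => ‖f x‖ₑ) q volume ≤ K * eLpNorm f p volume := by
  obtain ⟨C, hC, h⟩ := h
  have hq' := ENNReal.toReal_pos hq0 hq
  have hp' := ENNReal.toReal_pos hp0 hp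
  have hCq : C ^ (1 / q.toReal) ≠ ∞ := ENNReal.rpow_ne_top_of_nonneg (by positivity) hC
  refine ⟨(C ^ (1 / q.toReal)).toNNReal, fun f hf hfc => ?_⟩
  rw [ENNReal.coe_toNNReal hCq]
  have key := h (fun x => ‖f x‖) hf.norm hfc.norm fun x => norm_nonneg _
  simp only [ofReal_norm] at key
  rw [integral_rpow_enorm_eq hp0 hp, ← ENNReal.rpow_mul, mul_div_cancel₀ _ hp'.ne'] at key
  rw [eLpNorm_eq_lintegral_rpow_enorm_toReal hq0 hq]
  simp only [enorm_eq_self]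
  refine (ENNReal.rpow_le_rpow key (by positivity)).trans (le_of_eq ?_)
  rw [ENNReal.mul_rpow_of_nonneg _ _ (by positivity), ← ENNReal.rpow_mul,
    mul_one_div_cancel hq'.ne', ENNReal.rpow_one]

/-- `f` is approximated by continuous `F n` with error `2^(-2n)`. The maximal functions of
consecutive differences are summable almost everywhere, which bounds `A_t(f - F n)(x)` uniformly in
`t ∈ E`. Thus the maximal function of `f` is an almost everywhere limit of measurable ones, and
Fatou gives the norm bound. -/
lemma StrongBound.maximalConclusion [hd : Fact (2 ≤ d)] (hp1 : 1 ≤ p) (hp : p ≠ ∞) (hq1 : 1 ≤ q)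
    (hq : q ≠ ∞) (h : StrongBound d E p.toReal q.toReal) :
    ∃ C : ℝ≥0, ∀ f : Space d → ℂ, MemLp f p volume → MaximalConclusion E C p q f := by
  have hp0 : p ≠ 0 := (zero_lt_one.trans_le hp1).ne'
  have hq0 : q ≠ 0 := (zero_lt_one.trans_le hq1).ne'
  have hq' := ENNReal.toReal_pos hq0 hq
  have hp' := ENNReal.toReal_pos hp0 hp
  obtain ⟨K, hK⟩ := h.exists_eLpNorm_le hp0 hp hq0 hq
  refine ⟨K, fun f hf => ?_⟩
  set ε : ℕ → ℝ≥0∞ := fun n => (2 : ℝ≥0∞) ^ (-(2 * n : ℝ))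
  have hε0 (n) : ε n ≠ 0 := by simp [ε, ENNReal.rpow_eq_zero_iff]
  choose F hFs hFε hFc hFm using fun n =>
    hf.exists_hasCompactSupport_eLpNorm_sub_le hp (hε0 n)
  have hεanti (n) : ε (n + 1) ≤ ε n := by
    refine ENNReal.rpow_le_rpow_of_exponent_le (by norm_num) ?_
    push_cast; linarith
  have hεpow (n : ℕ) (r : ℝ) : ε n ^ r = 2 ^ (-(2 * n * r)) := by
    rw [← ENNReal.rpow_mul]; congr 1; ring
  set D : ℕ → Space d → ℂ := fun n x => F (n + 1) x - F n x
  have hDc (n) : Continuous (D n) := (hFc _).sub (hFc _)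
  have hDs (n) : HasCompactSupport (D n) := (hFs _).sub (hFs _)
  have hDε (n) : eLpNorm (D n) p volume ≤ 2 * ε n := by
    have e : D n = (f - F n) - (f - F (n + 1)) := by ext x; simp [D]
    rw [e, two_mul]
    refine (eLpNorm_sub_le (hf.1.sub (hFm _).1) (hf.1.sub (hFm _).1) hp1).trans ?_
    exact add_le_add (hFε n) ((hFε _).trans (hεanti n))
  set U : ℕ → Space d → ℝ≥0∞ := fun n => upperMaximal E fun x => ‖D n x‖ₑ
  have hUm (n) : Measurable (U n) :=
    measurable_upperMaximal_of_continuous (g := fun x => ‖D n x‖₊) (hDc n).nnnorm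
  have hUsum : ∀ᵐ x, ∑' n, U n x < ∞ := by
    refine ae_tsum_lt_top (fun n => (hUm n).aemeasurable) hq' (K := (K * 2) ^ q.toReal)
      (ENNReal.rpow_ne_top_of_nonneg hq'.le (by finiteness)) fun n => ?_
    have h1 := integral_rpow_enorm_eq (μ := volume) hq0 hq (U n)
    simp only [enorm_eq_self] at h1
    rw [h1, ← hεpow, ← ENNReal.mul_rpow_of_nonneg _ _ hq'.le]
    refine ENNReal.rpow_le_rpow ?_ hq'.le
    refine (hK (D n) (hDc n) (hDs n)).trans ?_
    rw [mul_assoc]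
    gcongr
    exact hDε n
  have hFlim : ∀ᵐ x, Tendsto (fun n => ‖f x - F n x‖ₑ) atTop (𝓝 0) := by
    have : ∀ᵐ x, ∑' n, ‖f x - F n x‖ₑ < ∞ := by
      refine ae_tsum_lt_top (fun n => (hf.1.sub (hFm n).1).enorm) hp' (K := 1) (by simp) fun n => ?_
      have h1 := integral_rpow_enorm_eq (μ := volume) hp0 hp (f - F n)
      simp only [Pi.sub_apply] at h1
      rw [h1, one_mul, ← hεpow]
      exact ENNReal.rpow_le_rpow (hFε n) hp'.le
    filter_upwards [this] with x hx
    exact ENNReal.tendsto_atTop_zero_of_tsum_ne_top hx.ne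
  set R : ℕ → Space d → ℝ≥0∞ := fun n x => ∑' m, ‖D (m + n) x‖ₑ
  set f₀ := hf.1.mk f
  have hf₀ : StronglyMeasurable f₀ := hf.1.stronglyMeasurable_mk
  -- Properties valid off a null set: agreement with a measurable representative, for measurability
  -- on spheres, and domination of `f - F n` by a tail of the telescoping series.
  -- `StrongBound.ae_null` then transfers both to almost every point of the spheres.
  have hgood : ∀ᵐ x, f x = f₀ x ∧ ∀ n, ‖f x - F n x‖ₑ ≤ R n x := by
    filter_upwards [hf.1.ae_eq_mk, hFlim] with x hx hlim
    refine ⟨hx, fun n => ?_⟩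
    have hstep (m : ℕ) : ‖f x - F n x‖ₑ ≤ ‖f x - F (m + n) x‖ₑ + R n x := by
      have : ‖f x - F n x‖ₑ ≤ ‖f x - F (m + n) x‖ₑ + ∑ i ∈ Finset.range m, ‖D (i + n) x‖ₑ := by
        induction m with
        | zero => simp
        | succ m ih =>
          refine ih.trans ?_
          rw [Finset.sum_range_succ, add_comm (∑ i ∈ Finset.range m, _), ← add_assoc]
          gcongr
          have e : f x - F (m + n) x = (f x - F (m + 1 + n) x) + D (m + n) x := by
            simp only [D]
            rw [show m + 1 + n = m + n + 1 by ring]; ring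
          rw [e]
          exact enorm_add_le _ _
      refine this.trans ?_
      gcongr
      exact ENNReal.sum_le_tsum (f := fun i => ‖D (i + n) x‖ₑ) _
    have hl : Tendsto (fun m => ‖f x - F (m + n) x‖ₑ + R n x) atTop (𝓝 (0 + R n x)) :=
      ((tendsto_add_atTop_iff_nat (f := fun m => ‖f x - F m x‖ₑ) n).2 hlim).add tendsto_const_nhds
    rw [zero_add] at hl
    exact ge_of_tendsto' hl hstep
  have hnull := h.ae_null hp' hq' (ae_iff.1 hgood)
  have hmain : ∀ᵐ x, (∀ t ∈ E, Integrable (fun y : Sph d => f (x - t • (y : Space d))) (sigma d)) ∧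
      Tendsto (fun n => maximalFunction E (F n) x) atTop (𝓝 (maximalFunction E f x)) := by
    filter_upwards [hnull, hUsum] with x hx hUx
    have hx' (t) (ht : t ∈ E) : ∀ᵐ y : Sph d ∂sigma d, f (x - t • (y : Space d)) = f₀ (x - t • (y : Space d)) ∧
        ∀ n, ‖f (x - t • (y : Space d)) - F n (x - t • (y : Space d))‖ₑ ≤ R n (x - t • (y : Space d)) := by
      filter_upwards [hx t ht] with y hy
      simpa only [mem_ofPred_eq, not_not] using hy
    -- These tails do not depend on `t` and tend to zero, so they control the error of the whole
    -- supremum.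
    set W : ℕ → ℝ≥0∞ := fun n => ∑' m, U (m + n) x
    have hRW (n) (t) (ht : t ∈ E) : ∫⁻ y : Sph d, R n (x - t • (y : Space d)) ∂sigma d ≤ W n :=
      (le_iSup₂ (f := fun t (_ : t ∈ E) => ∫⁻ y : Sph d, R n (x - t • (y : Space d)) ∂sigma d) t ht).trans
        (upperMaximal_tsum_le (fun m => (hDc (m + n)).enorm.measurable) x)
    have hWlim : Tendsto W atTop (𝓝 0) := ENNReal.tendsto_sum_nat_add (fun n => U n x) hUx.ne
    have hFi (n) (t : ℝ) : Integrable (fun y : Sph d => F n (x - t • (y : Space d))) (sigma d) :=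
      integrable_sphere ((hFc n).comp (by fun_prop))
    have hdiff (n) (t) (ht : t ∈ E) :
        ∫⁻ y : Sph d, ‖f (x - t • (y : Space d)) - F n (x - t • (y : Space d))‖ₑ ∂sigma d ≤ W n :=
      (lintegral_mono_ae ((hx' t ht).mono fun y hy => hy.2 n)).trans (hRW n t ht)
    have hI₀ (t) (ht : t ∈ E) : Integrable (fun y : Sph d => f (x - t • (y : Space d))) (sigma d) := by
      have hm : AEStronglyMeasurable (fun y : Sph d => f (x - t • (y : Space d))) (sigma d) := by
        refine (hf₀.comp_measurable (g := fun y : Sph d => x - t • (y : Space d))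
          (by fun_prop)).aestronglyMeasurable.congr ?_
        filter_upwards [hx' t ht] with y hy
        exact hy.1.symm
      have h1 : Integrable (fun y : Sph d => f (x - t • (y : Space d)) - F 0 (x - t • (y : Space d)))
          (sigma d) := by
        refine ⟨hm.sub (hFi 0 t).1, lt_of_le_of_lt (hdiff 0 t ht) ?_⟩
        simpa [W] using hUx
      exact (h1.add (hFi 0 t)).congr (ae_of_all _ fun y => by simp)
    have hdist (n) (t) (ht : t ∈ E) :
        ‖sphericalMean t f x - sphericalMean t (F n) x‖ₑ ≤ W n := by
      rw [sphericalMean, sphericalMean, ← integral_sub (hI₀ t ht) (hFi n t)]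
      exact (enorm_integral_le_lintegral_enorm _).trans (hdiff n t ht)
    have hup (n) : maximalFunction E f x ≤ maximalFunction E (F n) x + W n := by
      refine iSup₂_le fun t ht => ?_
      calc ‖sphericalMean t f x‖ₑ
          = ‖sphericalMean t (F n) x + (sphericalMean t f x - sphericalMean t (F n) x)‖ₑ := by
            congr 1; ring
        _ ≤ ‖sphericalMean t (F n) x‖ₑ + ‖sphericalMean t f x - sphericalMean t (F n) x‖ₑ :=
            enorm_add_le _ _
        _ ≤ _ := add_le_add (le_iSup₂ (f := fun t (_ : t ∈ E) => ‖sphericalMean t (F n) x‖ₑ) t ht)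
            (hdist n t ht)
    have hlow (n) : maximalFunction E (F n) x ≤ maximalFunction E f x + W n := by
      refine iSup₂_le fun t ht => ?_
      calc ‖sphericalMean t (F n) x‖ₑ
          = ‖sphericalMean t f x - (sphericalMean t f x - sphericalMean t (F n) x)‖ₑ := by
            congr 1; ring
        _ ≤ ‖sphericalMean t f x‖ₑ + ‖sphericalMean t f x - sphericalMean t (F n) x‖ₑ :=
            enorm_sub_le
        _ ≤ _ := add_le_add (le_iSup₂ (f := fun t (_ : t ∈ E) => ‖sphericalMean t f x‖ₑ) t ht)
            (hdist n t ht)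
    refine ⟨hI₀, ?_⟩
    refine tendsto_of_tendsto_of_tendsto_of_le_of_le (g := fun n => maximalFunction E f x - W n)
      (h := fun n => maximalFunction E f x + W n) ?_ ?_
      (fun n => tsub_le_iff_right.2 (hup n)) hlow
    · simpa using ENNReal.Tendsto.sub tendsto_const_nhds hWlim (Or.inr (by simp))
    · simpa using (tendsto_const_nhds (x := maximalFunction E f x)).add hWlim
  have hFmeas (n) : Measurable (maximalFunction E (F n)) := measurable_maximalFunction_of_continuous (hFc n)
  refine ⟨hmain.mono fun x hx => hx.1, aemeasurable_of_tendsto_metrizable_ae atTop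
    (fun n => (hFmeas n).aemeasurable) (hmain.mono fun x hx => hx.2), ?_⟩
  have hFn (n) : ∫⁻ x, maximalFunction E (F n) x ^ q.toReal ≤
      (K * (eLpNorm f p volume + ε n)) ^ q.toReal := by
    have h1 := integral_rpow_enorm_eq (μ := volume) hq0 hq (maximalFunction E (F n))
    simp only [enorm_eq_self] at h1
    rw [h1]
    refine ENNReal.rpow_le_rpow ?_ hq'.le
    refine le_trans ?_ ((hK (F n) (hFc n) (hFs n)).trans ?_)
    · exact eLpNorm_mono_enorm fun x => by
        simpa using maximalFunction_le_upperMaximal (F n) x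
    · gcongr
      have e : F n = f - (f - F n) := by ext x; simp
      conv_lhs => rw [e]
      exact (eLpNorm_sub_le hf.1 (hf.1.sub (hFm n).1) hp1).trans (add_le_add le_rfl (hFε n))
  have hεlim : Tendsto ε atTop (𝓝 0) := by
    have := ENNReal.tendsto_atTop_zero_of_tsum_ne_top (tsum_two_rpow_ne_top (ρ := -2) (by norm_num))
    refine this.congr fun n => ?_
    simp only [ε]; congr 1; ring
  have hlim : Tendsto (fun n => (K * (eLpNorm f p volume + ε n)) ^ q.toReal) atTop
      (𝓝 ((K * eLpNorm f p volume) ^ q.toReal)) := by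
    refine ((ENNReal.continuous_rpow_const (y := q.toReal)).tendsto _).comp ?_
    refine ENNReal.Tendsto.const_mul ?_ (Or.inr (by simp))
    simpa using (tendsto_const_nhds (x := eLpNorm f p volume)).add hεlim
  have hfat : ∫⁻ x, maximalFunction E f x ^ q.toReal ≤ (K * eLpNorm f p volume) ^ q.toReal := by
    have e : ∫⁻ x, maximalFunction E f x ^ q.toReal =
        ∫⁻ x, liminf (fun n => maximalFunction E (F n) x ^ q.toReal) atTop := by
      refine lintegral_congr_ae (hmain.mono fun x hx => ?_)
      exact ((((ENNReal.continuous_rpow_const (y := q.toReal)).tendsto _).comp hx.2).liminf_eq).symm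
    rw [e]
    refine (lintegral_liminf_le fun n => (hFmeas n).pow_const _).trans ?_
    rw [← hlim.liminf_eq]
    exact liminf_le_liminf (Eventually.of_forall hFn)
  rw [eLpNorm_eq_lintegral_rpow_enorm_toReal hq0 hq]
  simp only [enorm_eq_self]
  refine (ENNReal.rpow_le_rpow hfat (by positivity)).trans (le_of_eq ?_)
  rw [← ENNReal.rpow_mul, mul_one_div_cancel hq'.ne', ENNReal.rpow_one]

end Extension

/-! ### The endpoint at infinity, the region of exponents and the theorem. -/

section Conclusion

variable {d : ℕ} {E : Set ℝ}

/-- Spheres about `x` stay in a bounded set, so truncating `f` to balls reduces integrability and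
measurability to the L² case. The norm bound only needs that the set where `‖f‖` exceeds its
essential supremum is not charged by the spheres about almost every `x`. -/
lemma StrongBound.maximalConclusion_top [hd : Fact (2 ≤ d)] (hE : E ⊆ Icc 1 2)
    (h : StrongBound d E 2 2) {f : Space d → ℂ} (hf : MemLp f ∞ volume) :
    MaximalConclusion E 1 ∞ ∞ f := by
  have h2 : (2 : ℝ≥0∞).toReal = 2 := by simp
  obtain ⟨C, hC⟩ := StrongBound.maximalConclusion (d := d) (E := E) (p := 2) (q := 2) (by norm_num)
    (by norm_num) (by norm_num) (by norm_num) (by rwa [h2])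
  set F : ℕ → Space d → ℂ := fun n => (closedBall (0 : Space d) n).indicator f
  have hF (n) : MemLp (F n) 2 volume := by
    have h1 : MemLp (F n) ∞ volume := hf.indicator measurableSet_closedBall
    rw [memLp_indicator_iff_restrict measurableSet_closedBall] at h1 ⊢
    have : IsFiniteMeasure (volume.restrict (closedBall (0 : Space d) n)) :=
      ⟨by simpa using measure_closedBall_lt_top⟩
    exact h1.mono_exponent le_top
  have heq (x : Space d) (n : ℕ) (hn : ‖x‖ + 2 ≤ n) (t) (ht : t ∈ E) (y : Sph d) :
      F n (x - t • (y : Space d)) = f (x - t • (y : Space d)) := by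
    refine indicator_of_mem ?_ f
    have ht := hE ht
    rw [mem_closedBall_zero_iff]
    have hy : ‖t • (y : Space d)‖ = t := by
      rw [norm_smul, norm_eq_of_mem_sphere y, mul_one, Real.norm_of_nonneg (by linarith [ht.1])]
    exact (norm_sub_le _ _).trans (by rw [hy]; linarith [ht.2])
  refine ⟨?_, ?_, ?_⟩
  · have := ae_all_iff.2 fun n => (hC (F n) (hF n)).1
    filter_upwards [this] with x hx t ht
    have h1 := hx ⌈‖x‖ + 2⌉₊ t ht
    simp_rw [heq x _ (Nat.le_ceil _) t ht] at h1
    exact h1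
  · refine aemeasurable_of_tendsto_metrizable_ae atTop (fun n => (hC (F n) (hF n)).2.1)
      (ae_of_all _ fun x => ?_)
    refine tendsto_const_nhds.congr' ?_
    filter_upwards [eventually_ge_atTop ⌈‖x‖ + 2⌉₊] with n hn
    have hn' : ‖x‖ + 2 ≤ n := (Nat.le_ceil _).trans (by exact_mod_cast hn)
    simp only [maximalFunction, sphericalMean]
    refine iSup_congr fun t => iSup_congr fun ht => ?_
    congr 2; ext y
    exact (heq x n hn' t ht y).symm
  · rw [ENNReal.coe_one, one_mul, eLpNorm_exponent_top, eLpNorm_exponent_top]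
    have hae : ∀ᵐ x, ‖f x‖ₑ ≤ eLpNormEssSup f volume := enorm_ae_le_eLpNormEssSup f volume
    refine essSup_le_of_ae_le _ ?_
    filter_upwards [h.ae_null two_pos two_pos (ae_iff.1 hae)] with x hx
    rw [enorm_eq_self]
    refine iSup₂_le fun t ht => (enorm_integral_le_lintegral_enorm _).trans ?_
    calc ∫⁻ y : Sph d, ‖f (x - t • (y : Space d))‖ₑ ∂sigma d
        ≤ ∫⁻ y : Sph d, eLpNormEssSup f volume ∂sigma d := by
          refine lintegral_mono_ae ?_
          filter_upwards [hx t ht] with y hy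
          simpa only [mem_ofPred_eq, not_not] using hy
      _ = _ := by simp

lemma strongBound_of_mem_region [hd : Fact (2 ≤ d)] (hE : E ⊆ Icc 1 2) (hβ : 0 ≤ minkowskiDim E)
    (hβd : minkowskiDim E < (d : ℝ) - 1) (hβγ : minkowskiDim E ≤ assouadDim E)
    (hγd : 2 * assouadDim E ≤ ((d : ℝ) - 1) ^ 2) {a b : ℝ}
    (hab : (a, b) ∈ region d (minkowskiDim E) (assouadDim E)) (hne : a ≠ 0) :
    StrongBound d E a⁻¹ b⁻¹ := by
  have hγ := hβ.trans hβγ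
  have key (C R : ℝ) (hC : 0 ≤ C) (hR : 0 ≤ R) :=
    (vertexBounds (d := d) hE hC hR hγ hβγ).exists_restrictedBound hd.out hβ hβd hγ hγd hab hne
  -- The kernel constants are irrelevant here: only the inequalities among exponents are read off,
  -- which give `0 < b ≤ a < 1`.
  obtain ⟨hb, hba, a', -, -, haa', ha'1, -⟩ := key 0 0 le_rfl le_rfl
  have ha : 0 < a := hb.trans_le hba
  refine (localBound_of_restrictedBound hE ((one_le_inv₀ ha).2 (by linarith))
    ((one_le_inv₀ hb).2 (by linarith)) fun C R hC hR => ?_).strongBound hE (inv_pos.2 ha)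
    ((inv_le_inv₀ ha hb).2 hba)
  obtain ⟨-, -, a', b', e, haa', -, hb', hbb', he, hB⟩ := key C R hC hR
  refine ⟨a', b', e, hb', he, ?_, ?_, hB⟩
  · rwa [inv_mul_eq_div, one_lt_div ha]
  · rwa [inv_mul_eq_div, div_lt_one hb]

lemma region_subset_quadrangle (d : ℕ) (β γ : ℝ) : region d β γ ⊆ quadrangle d β γ := by
  rintro z (hz | hz)
  · exact (convex_convexHull ℝ _).segment_subset (subset_convexHull ℝ _ (by simp))
      (subset_convexHull ℝ _ (by simp)) hz.1
  · exact interior_subset hz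

lemma half_mem_region {β : ℝ} (γ : ℝ) (hβ : 0 ≤ β) (hβd : β < (d : ℝ) - 1) :
    ((1 / 2 : ℝ), (1 / 2 : ℝ)) ∈ region d β γ := by
  have h1 : 0 < (d : ℝ) - 1 := by linarith
  have h2 : 0 < (d : ℝ) - 1 + β := by linarith
  refine Or.inl ⟨?_, ?_⟩
  · rw [segment_eq_image']
    refine ⟨(d - 1 + β) / (2 * (d - 1)), ⟨by positivity, ?_⟩, ?_⟩
    · rw [div_le_one (by positivity)]; linarith
    · simp only [Q₁, Q₂, Prod.mk_sub_mk, sub_zero, Prod.smul_mk, smul_eq_mul, Prod.mk_add_mk, zero_add,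
        Prod.mk.injEq, and_self]
      field_simp
  · simp only [Q₂, mem_singleton_iff, Prod.mk.injEq, and_self]
    intro h
    rw [eq_div_iff h2.ne'] at h
    linarith

end Conclusion

end SphericalMaximal

theorem theorem1p1 (d : ℕ) (β γ : ℝ)
    (hd : (3 ≤ d ∧ 0 ≤ β ∧ β ≤ γ ∧ γ ≤ 1) ∨ (d = 2 ∧ 0 ≤ β ∧ β ≤ γ ∧ γ ≤ 1 / 2))
    (E : Set ℝ) (hE : E ⊆ Set.Icc 1 2)
    (hβ : SphericalMaximal.minkowskiDim E = β) (hγ : SphericalMaximal.assouadDim E = γ)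
    (p q : ℝ≥0∞) (hp : 1 ≤ p) (hq : 1 ≤ q)
    (hpq : ((p⁻¹).toReal, (q⁻¹).toReal) ∈ SphericalMaximal.region d β γ) :
    ∃ C : ℝ≥0, ∀ f : SphericalMaximal.Space d → ℂ, MemLp f p volume →
      (∀ᵐ x : SphericalMaximal.Space d, ∀ t ∈ E,
        Integrable (fun y : Metric.sphere (0 : SphericalMaximal.Space d) 1 =>
          f (x - t • (y : SphericalMaximal.Space d))) (SphericalMaximal.sigma d)) ∧
      AEMeasurable (SphericalMaximal.maximalFunction E f) volume ∧
      eLpNorm (SphericalMaximal.maximalFunction E f) q volume ≤ C * eLpNorm f p volume := by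
  have hd2 : 2 ≤ d := by rcases hd with h | h <;> omega
  have : Fact (2 ≤ d) := ⟨hd2⟩
  have hβ0 : 0 ≤ β := by rcases hd with h | h <;> exact h.2.1
  have hβγ : β ≤ γ := by rcases hd with h | h <;> exact h.2.2.1
  have hβd : β < (d : ℝ) - 1 := by
    rcases hd with ⟨h, h1⟩ | ⟨rfl, h1⟩
    · have : (3 : ℝ) ≤ d := by exact_mod_cast h
      linarith
    · push_cast; linarith
  -- For `d = 2` this is exactly `γ ≤ 1/2`; for `d ≥ 3` the right side is at least `4`.
  have hγd : 2 * γ ≤ ((d : ℝ) - 1) ^ 2 := by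
    rcases hd with ⟨h, h1⟩ | ⟨rfl, h1⟩
    · have : (3 : ℝ) ≤ d := by exact_mod_cast h
      nlinarith
    · push_cast; linarith
  subst hβ hγ
  have hp0 : p ≠ 0 := (zero_lt_one.trans_le hp).ne'
  have hq0 : q ≠ 0 := (zero_lt_one.trans_le hq).ne'
  have hquad := (SphericalMaximal.vertexBounds (d := d) hE le_rfl le_rfl (hβ0.trans hβγ) hβγ).quadrangle_subset
    (C := 0) (R := 0) hd2 hβ0 hβd (hβ0.trans hβγ) hγd
  rcases eq_or_ne p ∞ with rfl | hptop
  -- The quadrangle lies in `0 ≤ b ≤ a`, so `p = ∞` leaves only the vertex `Q₁`.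
  · have hqtop : q = ∞ := by
      obtain ⟨-, -, h1, h2⟩ := hquad (SphericalMaximal.region_subset_quadrangle _ _ _ hpq)
      simp only [ENNReal.inv_top, ENNReal.toReal_zero] at h1 h2
      have h3 := (ENNReal.toReal_eq_zero_iff _).1 (le_antisymm h2 h1)
      simpa [hq0] using h3
    subst hqtop
    -- The point `(1/2,1/2)` always lies on the segment since `β < d - 1`, so the L² bound is
    -- available for the endpoint.
    have h22 := SphericalMaximal.strongBound_of_mem_region hE hβ0 hβd hβγ hγd (SphericalMaximal.half_mem_region _ hβ0 hβd) (by norm_num)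
    rw [show ((1 / 2 : ℝ))⁻¹ = 2 by norm_num] at h22
    exact ⟨1, fun f hf => h22.maximalConclusion_top hE hf⟩
  · have hpr : (p⁻¹).toReal ≠ 0 := by
      rw [ENNReal.toReal_inv]
      exact inv_ne_zero (ENNReal.toReal_pos hp0 hptop).ne'
    have hS := SphericalMaximal.strongBound_of_mem_region hE hβ0 hβd hβγ hγd hpq hpr
    have hqtop : q ≠ ∞ := by
      rintro rfl
      have := ((SphericalMaximal.vertexBounds (d := d) hE le_rfl le_rfl (hβ0.trans hβγ) hβγ).exists_neg
        (C := 0) (R := 0) hd2 hβ0 hβd (hβ0.trans hβγ) hγd hpq hpr).1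
      simp at this
    rw [ENNReal.toReal_inv, ENNReal.toReal_inv, inv_inv, inv_inv] at hS
    exact hS.maximalConclusion hp hptop hq hqtop
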